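/- Notation. Let $F_0=0$, $F_1=1$, $F_{j+2}=F_{j+1}+F_j$ be the Fibonacci numbers and $\gamma=(1+\sqrt5)/2$. For an integer $n\ge 0$ let $\delta_j(n)\in\{0,1\}$ ($j\ge 2$) be the digits of its Zeckendorf expansion $n=\sum_{j\ge2}\delta_j(n)F_j$ (no two consecutive digits equal to $1$), and let $s_z(n)=\sum_{j\ge 2}\delta_j(n)$. For real $x$ put $e(x)=e^{2\pi i x}$, $\|x\|=\min_{k\in\mathbb Z}|x-k|$, and $\log^+x=\max(1,\log x)$ for $x>0$. Define the $1$-periodic function $g_\lambda(x)=\sum_{j=2}^{\lambda}\delta_j'(x)$, where $\delta_j'(x)$ is the limit of $\delta_j(n)$ as the fractional part $\{n\gamma\}$ tends to $\{x\}$ from the right. For a bounded measurable $1$-periodic $f:\mathbb R\to\mathbb C$ let $$\|f\|_{U^3(\mathbb T)}^{8}=\int_{[0,1]}\int_{[0,1]^3}\prod_{\omega\in\{0,1\}^3}\mathcal C^{\omega_1+\omega_2+\omega_3}f(x+\omega_1y_1+\omega_2y_2+\omega_3y_3)\,dy\,dx,$$ where $\mathcal C$ is complex conjugation. For $f:\mathbb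 N\to\mathbb C$ and real $N,U,V\ge2$ with $UV\le N$ put $$S_{\mathrm{II}}(N,U,V)=\sqrt N(\log N)^3\max_{\substack{U\le M\le N/V\\ V\le q\le N/M}}\Bigl(\sum_{V<p\le N/M}\Bigl|\sum_{\substack{M<m\le 2M\\ m\le\min(N/p,N/q)}}f(mp)\overline{f(mq)}\Bigr|\Bigr)^{1/2},$$ where $M$ is real and $m,p,q$ are integers, and the maximum is $0$ if there is no admissible pair $(M,q)$. **Theorem.** Let $c_2>0$, and assume that $$\|e(\vartheta g_\lambda)\|_{U^3(\mathbb T)}\ll F_\lambda^{-c_2\|\vartheta\|^2}$$ uniformly for all $\vartheta\in\mathbb R$ and all integers $\lambda\ge2$. For $\vartheta\in\mathbb R$ let $S_{\mathrm{II}}$ be formed with $f(n)=e(\vartheta s_z(n))$. (i) For all real $N,U,V\ge 2$ with $UV\le N$ and all $\vartheta\in\mathbb R$, $$S_{\mathrm{II}}(N,U,V)\ll N(\log^+N)^5\left(V^{-c_2\|\vartheta\|^2/54}+\frac{N^{1/2+c_2\|\vartheta\|^2/54}}{U^{3/4+c_2\|\vartheta\|^2/54}}\right)^{1/2},$$ where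 the implied constant depends at most on $c_2$. (ii) Consequently there is a non-trivial bound when $V\gg N^{\varepsilon}$ and $U\gg N^{2/3+\varepsilon}$: for every $\varepsilon>0$ there is $\eta>0$ such that for every $a>0$, $$S_{\mathrm{II}}(N,U,V)\ll N^{1-\eta\|\vartheta\|^2}(\log^+N)^5$$ for all $\vartheta\in\mathbb R$ and all real $N,U,V\ge2$ with $UV\le N$, $V\ge aN^{\varepsilon}$ and $U\ge aN^{2/3+\varepsilon}$, with an implied constant that does not depend on $\vartheta,N,U,V$. -/

import Mathlib

open Filter Topology MeasureTheory

noncomputable section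

namespace ZeckTypeII

/-- `e(x) = exp(2πix)`. -/
def e (x : ℝ) : ℂ := Complex.exp (2 * Real.pi * Complex.I * x)

/-- `‖x‖`, the distance from `x` to the nearest integer. -/
def distInt (x : ℝ) : ℝ := |x - round x|

/-- `log⁺ x = max (1, log x)` for `x > 0`, and `log⁺ 0 = 1`. -/
def logPlus (x : ℝ) : ℝ := max 1 (Real.log x)

/-- The Zeckendorf digit `δ_j(n)`: it is `1` if `F_j` occurs in the Zeckendorf expansion of `n`,
and `0` otherwise. (`Nat.zeckendorf n` is the list of the indices that occur.) -/
def digit (j n : ℕ) : ℕ := if j ∈ Nat.zeckendorf n then 1 else 0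

/-- The Zeckendorf sum of digits of `n`: the number of nonzero digits. -/
def zeckSum (n : ℕ) : ℕ := (Nat.zeckendorf n).length

/-- The digit `δ'_j` on the torus: the limit of `δ_j(n)` as the fractional part `{nφ}` tends
to `{x}` from the right (strictly), `φ` being the golden ratio. It is `1`-periodic in `x`. -/
def torusDigit (j : ℕ) (x : ℝ) : ℕ :=
  limUnder (comap (fun n : ℕ => Int.fract ((n : ℝ) * Real.goldenRatio)) (𝓝[>] (Int.fract x)))
    (fun n : ℕ => digit j n)

/-- `g_λ(x) = ∑_{2 ≤ j ≤ λ} δ'_j(x)`. -/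
def torusSum (lam : ℕ) (x : ℝ) : ℕ := ∑ j ∈ Finset.Icc 2 lam, torusDigit j x

/-- The integral that defines the `2^s`-th power of the Gowers `s`-norm on the torus, for a
`1`-periodic `f`: the integral over `x ∈ [0,1]` and `y ∈ [0,1]^s` of the product over
`ω ∈ {0,1}^s` of `f(x + ω·y)`, conjugated if `ω` has an odd number of ones. -/
def gowersIntegral (s : ℕ) (f : ℝ → ℂ) : ℂ :=
  ∫ x in Set.Icc (0 : ℝ) 1, ∫ y in Set.Icc (0 : Fin s → ℝ) 1,
    ∏ ω : Fin s → Fin 2,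
      (⇑(starRingEnd ℂ))^[∑ i, (ω i : ℕ)] (f (x + ∑ i, y i * ((ω i : ℕ) : ℝ)))

/-- The Gowers `s`-norm on the torus. For bounded measurable `1`-periodic `f` and `s ≥ 1` the
integral is real and nonnegative, so the absolute value below is the integral itself. -/
def gowersNorm (s : ℕ) (f : ℝ → ℂ) : ℝ := ‖gowersIntegral s f‖ ^ ((1 : ℝ) / 2 ^ s)

/-- `(∑_{V < p ≤ N/M} |∑_{M < m ≤ 2M, m ≤ min(N/p, N/q)} f(mp) conj(f(mq))|)^{1/2}`, where `p`
and `m` are integers. -/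
def typeIIInner (f : ℕ → ℂ) (N V M : ℝ) (q : ℕ) : ℝ :=
  √(∑ p ∈ Finset.Ioc ⌊V⌋₊ ⌊N / M⌋₊,
    ‖∑ m ∈ (Finset.Ioc ⌊M⌋₊ ⌊2 * M⌋₊).filter (fun m : ℕ => (m : ℝ) ≤ min (N / p) (N / q)),
      f (m * p) * (starRingEnd ℂ) (f (m * q))‖)

/-- The values over which the maximum in the type II sum is taken: `M` is real and `q` is an
integer, with `U ≤ M ≤ N/V` and `V ≤ q ≤ N/M`. -/
def typeIIValues (f : ℕ → ℂ) (N U V : ℝ) : Set ℝ :=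
  {t | ∃ (M : ℝ) (q : ℕ), U ≤ M ∧ M ≤ N / V ∧ V ≤ (q : ℝ) ∧ (q : ℝ) ≤ N / M ∧
    t = typeIIInner f N V M q}

/-- The set of values is finite, so that its supremum is a maximum as soon as it is nonempty. -/
theorem typeIIValues_finite (f : ℕ → ℂ) {N U V : ℝ} (hN : 0 ≤ N) (hU : 1 ≤ U) (hV : 1 ≤ V) :
    (typeIIValues f N U V).Finite := by
  let F : ℕ × ℕ × ℕ × ℕ → ℝ := fun z =>
    √(∑ p ∈ Finset.Ioc ⌊V⌋₊ z.1,
      ‖∑ m ∈ (Finset.Ioc z.2.1 z.2.2.1).filter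
          (fun m : ℕ => (m : ℝ) ≤ min (N / p) (N / z.2.2.2)),
        f (m * p) * (starRingEnd ℂ) (f (m * z.2.2.2))‖)
  have hfin : (Set.Iic ((⌊N⌋₊, ⌊N⌋₊, ⌊2 * N⌋₊, ⌊N⌋₊) : ℕ × ℕ × ℕ × ℕ)).Finite :=
    Set.finite_Iic _
  refine (hfin.image F).subset ?_
  rintro t ⟨M, q, hUM, hMN, -, hqN, rfl⟩
  have hM : 1 ≤ M := hU.trans hUM
  have h1 : N / M ≤ N := div_le_self hN hM
  have h2 : M ≤ N := hMN.trans (div_le_self hN hV)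
  refine ⟨(⌊N / M⌋₊, ⌊M⌋₊, ⌊2 * M⌋₊, q), ?_, rfl⟩
  refine ⟨Nat.floor_mono h1, Nat.floor_mono h2, Nat.floor_mono (by linarith), ?_⟩
  exact Nat.le_floor (hqN.trans h1)

/-- The type II sum
`S_II(N,U,V) = N^{1/2} (log N)^3 max_{U ≤ M ≤ N/V, V ≤ q ≤ N/M} (…)^{1/2}`
of `f`; it is `0` if no pair `(M, q)` is admissible. -/
def typeIISum (f : ℕ → ℂ) (N U V : ℝ) : ℝ :=
  √N * Real.log N ^ 3 * sSup (typeIIValues f N U V)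

end ZeckTypeII

end

noncomputable section

namespace ZeckTypeII

/-! Write ψ for the conjugate of φ. The digits of n up to index λ can be read off from nφ modulo 1.
The representative -∑ ψ^j over the Zeckendorf indices lies in a fixed interval of length 1, and the
first digit where two integers differ puts a point -kφ, 1 ≤ k ≤ F_{λ+1}, between their
representatives (`mem_zeckSet_iff_of_no_break`). So the truncated function `torusExp` is a step
function with at most F_{λ+1} jumps per period. Along mφ, sums of a step function equal length times
integral up to O(jumps · log), because on a Fibonacci block the points fall one to each cell of a
uniform grid (`IsStep.sum_block`, `IsStep.sum_range`).

Put P = N/M. Cauchy–Schwarz over p and van der Corput with shifts r < T² lead to the differences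
f((m+r)p) conj f(mp) and the same for q. Outside a small set of m no carry passes λ
(`card_carry_le`), so the digits above λ cancel. What remains is a sum of a step function along mφ,
hence essentially `corrIntegral`, which has the form ∫ A_p(px) conj v(x) dx. Here A_p is the
multiplicative derivative of `torusExp` with step rpφ, and v does not depend on p.

The function A_p(px) has only frequencies divisible by p. The integral is therefore at most |∫ A_p|,
the autocorrelation at rpφ, plus the root of the Fourier mass of v on nonzero multiples of p
(`norm_integral_dilate_mul_conj_le`). On average over p the mass is small, since an integer has few
divisors and the coefficients of a step function decay (`exists_sum_multMass_le`). The
autocorrelation is Lipschitz and the points rpφ are well spread, so its average is governed by its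
fourth moment, which is at most the eighth power of the U³ norm (`integral_autoCorr_pow_four_le`).

The saving is T = 1/τ with τ = P^{-κ} + P^{1/2+κ} M^{-1/4}, κ = c₂‖ϑ‖²/54 and F_λ of order PT⁴. A
lower bound for the fourth moment shows that the hypothesis forces 8c₂‖ϑ‖² ≤ 1
(`exponent_le_of_autoCorr_bound`), which keeps κ small whatever c₂ is. -/

/-- A `1`-periodic step function on the line, bounded by `1`, with at most `K` jumps per period;
the value at a jump is the limit from the right. -/
structure IsStep (K : ℕ) (H : ℝ → ℂ) : Prop where
  periodic : Function.Periodic H 1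
  norm_le : ∀ x, ‖H x‖ ≤ 1
  jumps : ∃ D : Finset ℝ, D.card ≤ K ∧
    ∀ x y, x ≤ y → (∀ z ∈ Set.Ioc x y, Int.fract z ∉ D) → H x = H y

/-! ### Step functions on the torus. -/

namespace IsStep

variable {K K₁ K₂ : ℕ} {H H₁ H₂ : ℝ → ℂ}

theorem conj (h : IsStep K H) : IsStep K (fun x => (starRingEnd ℂ) (H x)) := by
  obtain ⟨D, hD, hH⟩ := h.jumps
  refine ⟨fun x => by simp only [h.periodic x], fun x => by simpa using h.norm_le x, D, hD, ?_⟩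
  intro x y hxy hz
  simp only [hH x y hxy hz]

theorem mul (h₁ : IsStep K₁ H₁) (h₂ : IsStep K₂ H₂) :
    IsStep (K₁ + K₂) (fun x => H₁ x * H₂ x) := by
  classical
  obtain ⟨D₁, hD₁, hH₁⟩ := h₁.jumps
  obtain ⟨D₂, hD₂, hH₂⟩ := h₂.jumps
  refine ⟨fun x => by simp only [h₁.periodic x, h₂.periodic x], fun x => ?_, D₁ ∪ D₂, ?_, ?_⟩
  · rw [norm_mul]
    exact mul_le_one₀ (h₁.norm_le x) (norm_nonneg _) (h₂.norm_le x)
  · exact (Finset.card_union_le _ _).trans (add_le_add hD₁ hD₂)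
  · intro x y hxy hz
    have e₁ := hH₁ x y hxy fun z hz' hd => hz z hz' (Finset.mem_union_left _ hd)
    have e₂ := hH₂ x y hxy fun z hz' hd => hz z hz' (Finset.mem_union_right _ hd)
    simp only [e₁, e₂]

theorem translate (h : IsStep K H) (a : ℝ) : IsStep K (fun x => H (x + a)) := by
  classical
  obtain ⟨D, hD, hH⟩ := h.jumps
  refine ⟨fun x => ?_, fun x => h.norm_le _, D.image (fun d => Int.fract (d - a)),
    Finset.card_image_le.trans hD, ?_⟩
  · rw [add_right_comm]; exact h.periodic _
  · intro x y hxy hz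
    refine hH _ _ (by linarith) fun z hz' hd => ?_
    refine hz (z - a) ⟨by linarith [hz'.1], by linarith [hz'.2]⟩ ?_
    refine Finset.mem_image.2 ⟨_, hd, ?_⟩
    rw [Int.fract_eq_fract]
    exact ⟨-⌊z⌋, by rw [Int.fract]; push_cast; ring⟩

theorem dilate (h : IsStep K H) {p : ℕ} (hp : 0 < p) : IsStep (p * K) (fun x => H (p * x)) := by
  classical
  obtain ⟨D, hD, hH⟩ := h.jumps
  have hp' : (0 : ℝ) < p := by exact_mod_cast hp
  refine ⟨fun x => ?_, fun x => h.norm_le _,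
    (Finset.range p ×ˢ D).image (fun i => (i.2 + i.1) / p), ?_, ?_⟩
  · have := h.periodic.nat_mul p (p * x)
    rw [mul_add]; simpa using this
  · refine Finset.card_image_le.trans ?_
    rw [Finset.card_product, Finset.card_range]
    exact Nat.mul_le_mul_left _ hD
  · intro x y hxy hz
    refine hH _ _ (by gcongr) fun z hz' hd => ?_
    refine hz (z / p) ⟨by rw [lt_div_iff₀ hp']; linarith [hz'.1],
      by rw [div_le_iff₀ hp']; linarith [hz'.2]⟩ ?_
    have h0 : 0 ≤ (p : ℝ) * Int.fract (z / p) := by positivity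
    have hfl : ⌊(p : ℝ) * Int.fract (z / p)⌋ < p := by
      rw [Int.floor_lt]
      have := Int.fract_lt_one (z / p)
      push_cast; nlinarith
    have hfl0 : 0 ≤ ⌊(p : ℝ) * Int.fract (z / p)⌋ := Int.floor_nonneg.2 h0
    obtain ⟨i, hi⟩ := Int.eq_ofNat_of_zero_le hfl0
    refine Finset.mem_image.2 ⟨(i, Int.fract z), ?_, ?_⟩
    · simp only [Finset.mem_product, Finset.mem_range]
      exact ⟨by rw [hi] at hfl; exact_mod_cast hfl, hd⟩
    · have e1 : Int.fract z = Int.fract ((p : ℝ) * Int.fract (z / p)) := by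
        rw [Int.fract_eq_fract]
        refine ⟨p * ⌊z / p⌋, ?_⟩
        rw [Int.fract]; push_cast; field_simp; ring
      have e2 : ((i : ℤ) : ℝ) = (⌊(p : ℝ) * Int.fract (z / p)⌋ : ℝ) := by rw [hi]
      have e3 : (i : ℝ) = (⌊(p : ℝ) * Int.fract (z / p)⌋ : ℝ) := by rw [← e2]; simp
      simp only
      rw [e1, e3, Int.fract_add_floor]
      field_simp

/-- Off the lifted jumps, a closed countable set, the function is locally constant; its values on a
countable set do not affect measurability. -/
theorem measurable (h : IsStep K H) : Measurable H := by
  obtain ⟨D, -, hH⟩ := h.jumps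
  set B : Set ℝ := ⋃ d ∈ D, Set.range (fun l : ℤ => d + l) with hB
  have hfB : ∀ z, Int.fract z ∈ D → z ∈ B := fun z hz => by
    simp only [hB, Set.mem_iUnion, Set.mem_range]
    exact ⟨_, hz, ⌊z⌋, Int.fract_add_floor z⟩
  have hBc : B.Countable := by
    refine Set.Countable.biUnion D.countable_toSet fun d _ => Set.countable_range _
  have hBcl : IsClosed B := by
    refine isClosed_biUnion_finset fun d _ => ?_
    have : Set.range (fun l : ℤ => d + l) = (Homeomorph.addLeft d) '' (Set.range ((↑) : ℤ → ℝ)) := by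
      rw [← Set.range_comp]; rfl
    rw [this, Homeomorph.isClosed_image]
    exact Int.isClosedEmbedding_coe_real.isClosed_range
  have hcont : ContinuousOn H Bᶜ := by
    intro x hx
    apply ContinuousAt.continuousWithinAt
    obtain ⟨ε, hε, hball⟩ := Metric.isOpen_iff.1 hBcl.isOpen_compl x hx
    have : H =ᶠ[𝓝 x] fun _ => H x := by
      filter_upwards [Metric.ball_mem_nhds x hε] with y hy
      have hconv : ∀ z, z ∈ Set.uIcc x y → z ∈ Bᶜ := fun z hz => hball <|
        (convex_ball x ε).ordConnected.uIcc_subset (Metric.mem_ball_self hε) hy hz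
      rcases le_total x y with hxy | hxy
      · refine (hH x y hxy fun z hz hd => hconv z ?_ (hfB z hd)).symm
        rw [Set.uIcc_of_le hxy]; exact Set.Ioc_subset_Icc_self hz
      · refine hH y x hxy fun z hz hd => hconv z ?_ (hfB z hd)
        rw [Set.uIcc_of_ge hxy]; exact Set.Ioc_subset_Icc_self hz
    exact continuousAt_const.congr this.symm
  classical
  have hm : Measurable (Bᶜ.piecewise H 0) :=
    hcont.measurable_piecewise continuousOn_const hBcl.isOpen_compl.measurableSet
  refine hm.measurable_of_countable_ne (hBc.mono ?_)
  intro x hx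
  by_contra hxB
  exact hx (by rw [Set.piecewise_eq_of_mem _ _ _ hxB])

theorem intervalIntegrable (h : IsStep K H) (a b : ℝ) : IntervalIntegrable H volume a b := by
  rw [intervalIntegrable_iff]
  refine Measure.integrableOn_of_bounded (M := 1) (by simp) h.measurable.aestronglyMeasurable ?_
  exact Eventually.of_forall fun x => h.norm_le x

theorem norm_integral_le_one (h : IsStep K H) : ‖∫ x in (0 : ℝ)..1, H x‖ ≤ 1 := by
  have := intervalIntegral.norm_integral_le_of_norm_le_const (a := 0) (b := 1) (f := H) (C := 1)
    fun x _ => h.norm_le x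
  simpa using this

/-- The integrand is at most 2 and vanishes unless a jump lies in (x, x + t]. Such a jump has
integer part 0 or 1, so each point of `D` excludes two intervals of length t. -/
theorem integral_shift_le (h : IsStep K H) {t : ℝ} (ht : 0 ≤ t) (ht1 : t < 1) :
    ∫ x in (0 : ℝ)..1, ‖H (x + t) - H x‖ ≤ 4 * K * t := by
  obtain ⟨D, hD, hH⟩ := h.jumps
  set S : Set ℝ := ⋃ d ∈ D, (Set.Ico (d - t) d ∪ Set.Ico (d + 1 - t) (d + 1)) with hS
  have hSm : MeasurableSet S := by
    refine Finset.measurableSet_biUnion D fun d _ => measurableSet_Ico.union measurableSet_Ico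
  have hSv : volume S ≤ ENNReal.ofReal (2 * K * t) := by
    refine (measure_biUnion_finset_le _ _).trans ?_
    have : ∀ d ∈ D, volume (Set.Ico (d - t) d ∪ Set.Ico (d + 1 - t) (d + 1)) ≤
        ENNReal.ofReal (2 * t) := fun d _ => by
      refine (measure_union_le _ _).trans ?_
      rw [Real.volume_Ico, Real.volume_Ico, ← ENNReal.ofReal_add (by linarith) (by linarith)]
      exact ENNReal.ofReal_le_ofReal (by linarith)
    refine (Finset.sum_le_card_nsmul _ _ _ this).trans ?_
    rw [nsmul_eq_mul, ← ENNReal.ofReal_natCast, ← ENNReal.ofReal_mul (by positivity)]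
    refine ENNReal.ofReal_le_ofReal ?_
    have : (D.card : ℝ) ≤ K := by exact_mod_cast hD
    nlinarith
  have hpt : ∀ x ∈ Set.Ioc (0 : ℝ) 1, ‖H (x + t) - H x‖ ≤ S.indicator (fun _ => (2 : ℝ)) x := by
    intro x hx
    by_cases hxS : x ∈ S
    · rw [Set.indicator_of_mem hxS]
      exact (norm_sub_le _ _).trans (by linarith [h.norm_le (x + t), h.norm_le x])
    · rw [Set.indicator_of_notMem hxS, hH x (x + t) (by linarith), sub_self, norm_zero]
      intro z hz hd
      apply hxS
      simp only [hS, Set.mem_iUnion]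
      refine ⟨_, hd, ?_⟩
      have e := Int.fract_add_floor z
      have h0 := Int.fract_nonneg z
      have h1 := Int.fract_lt_one z
      have hl0 : (-1 : ℝ) < ⌊z⌋ := by linarith [hz.1, hx.1]
      have hl2 : (⌊z⌋ : ℝ) < 2 := by linarith [hz.2, hx.2]
      have hl0' : -1 < ⌊z⌋ := by exact_mod_cast hl0
      have hl2' : ⌊z⌋ < 2 := by exact_mod_cast hl2
      have : ⌊z⌋ = 0 ∨ ⌊z⌋ = 1 := by omega
      rcases this with hl | hl <;> rw [hl] at e <;> push_cast at e
      · left; exact ⟨by linarith [hz.2], by linarith [hz.1]⟩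
      · right; exact ⟨by linarith [hz.2], by linarith [hz.1]⟩
  rw [intervalIntegral.integral_of_le zero_le_one]
  have hind : IntegrableOn (S.indicator (fun _ => (2 : ℝ))) (Set.Ioc (0 : ℝ) 1) :=
    ((integrable_const (2 : ℝ)).indicator hSm)
  calc ∫ x in Set.Ioc (0 : ℝ) 1, ‖H (x + t) - H x‖
      ≤ ∫ x in Set.Ioc (0 : ℝ) 1, S.indicator (fun _ => (2 : ℝ)) x := by
        refine setIntegral_mono_on ?_ hind measurableSet_Ioc hpt
        have := ((h.translate t).intervalIntegrable 0 1).sub (h.intervalIntegrable 0 1)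
        exact ((intervalIntegrable_iff_integrableOn_Ioc_of_le zero_le_one).1 this).norm
    _ = 2 * (volume.restrict (Set.Ioc (0 : ℝ) 1)).real S := by
        rw [integral_indicator_const _ hSm, smul_eq_mul, mul_comm]
    _ ≤ 2 * (2 * K * t) := by
        gcongr
        rw [Measure.real]
        refine ENNReal.toReal_le_of_le_ofReal (by positivity) ?_
        exact (Measure.restrict_apply_le _ _).trans hSv
    _ = 4 * K * t := by ring

end IsStep

/-! ### Zeckendorf expansions and the position of nφ modulo 1. -/

theorem inv_goldenRatio_sq : Real.goldenRatio⁻¹ ^ 2 = 1 - Real.goldenRatio⁻¹ := by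
  rw [Real.inv_goldenRatio]
  have := Real.goldenConj_sq
  nlinarith

theorem goldenConj_pow_eq (k : ℕ) :
    Real.goldenConj ^ k = (-1) ^ k * Real.goldenRatio⁻¹ ^ k := by
  rw [← mul_pow, Real.inv_goldenRatio]; ring

theorem inv_goldenRatio_pow_add_two (k : ℕ) :
    Real.goldenRatio⁻¹ ^ (k + 2) = Real.goldenRatio⁻¹ ^ k - Real.goldenRatio⁻¹ ^ (k + 1) := by
  rw [pow_add, inv_goldenRatio_sq]; ring

theorem inv_goldenRatio_pow_pos (k : ℕ) : 0 < Real.goldenRatio⁻¹ ^ k :=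
  pow_pos (inv_pos.2 Real.goldenRatio_pos) k

/-- An alternating sum of powers of `1/φ` over nonconsecutive exponents above `k`. -/
theorem sum_goldenConj_pow_bounds (d : ℕ) : ∀ (k : ℕ) (S : Finset ℕ), (∀ j ∈ S, k + 1 ≤ j) →
    (∀ j ∈ S, j < k + 1 + d) → (∀ j ∈ S, j + 1 ∉ S) →
    -Real.goldenRatio⁻¹ ^ k < (-1) ^ k * ∑ j ∈ S, Real.goldenConj ^ j ∧
      (-1) ^ k * ∑ j ∈ S, Real.goldenConj ^ j < Real.goldenRatio⁻¹ ^ (k + 1) := by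
  -- `d` only bounds the window that contains `S`. If k + 1 ∈ S, then k + 2 ∉ S and the bounds at k
  -- + 2 apply to the rest; otherwise those at k + 1 apply with reversed sign. Both cases close by
  -- φ^{-k} = φ^{-k-1} + φ^{-k-2}.
  induction d using Nat.strong_induction_on with
  | _ d ih =>
  intro k S h1 h2 h3
  rcases S.eq_empty_or_nonempty with rfl | ⟨i, hi⟩
  · rw [Finset.sum_empty, mul_zero]
    exact ⟨neg_lt_zero.2 (inv_goldenRatio_pow_pos k), inv_goldenRatio_pow_pos (k + 1)⟩
  have hd : 0 < d := by have := h1 i hi; have := h2 i hi; omega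
  have p0 := inv_goldenRatio_pow_pos k
  have p1 := inv_goldenRatio_pow_pos (k + 1)
  have p2 := inv_goldenRatio_pow_pos (k + 2)
  have p3 := inv_goldenRatio_pow_pos (k + 3)
  have r0 := inv_goldenRatio_pow_add_two k
  have r1 := inv_goldenRatio_pow_add_two (k + 1)
  have hpm : ((-1 : ℝ) ^ k) * (-1) ^ k = 1 := by rw [← mul_pow]; simp
  by_cases hk : k + 1 ∈ S
  · obtain ⟨b1, b2⟩ := ih (d - 1 - 1) (by omega) (k + 2) (S.erase (k + 1))
      (fun j hj => by
        obtain ⟨hne, hj⟩ := Finset.mem_erase.1 hj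
        have := h1 j hj
        have : j ≠ k + 2 := fun h => h3 _ hk (h ▸ hj)
        omega)
      (fun j hj => by
        obtain ⟨hne, hj⟩ := Finset.mem_erase.1 hj
        have := h1 j hj
        have := h2 j hj
        have : j ≠ k + 2 := fun h => h3 _ hk (h ▸ hj)
        omega)
      (fun j hj hj' => h3 j (Finset.mem_of_mem_erase hj) (Finset.mem_of_mem_erase hj'))
    rw [← Finset.add_sum_erase _ _ hk, goldenConj_pow_eq (k + 1), mul_add]
    have e1 : (-1 : ℝ) ^ k * ((-1) ^ (k + 1) * Real.goldenRatio⁻¹ ^ (k + 1)) =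
        -Real.goldenRatio⁻¹ ^ (k + 1) := by
      rw [pow_succ (-1 : ℝ) k]
      linear_combination (-Real.goldenRatio⁻¹ ^ (k + 1)) * hpm
    have e2 : (-1 : ℝ) ^ (k + 2) = (-1) ^ k := by rw [pow_add]; simp
    rw [e2] at b1 b2
    rw [e1]
    constructor <;> linarith
  · obtain ⟨b1, b2⟩ := ih (d - 1) (by omega) (k + 1) S
      (fun j hj => by
        have := h1 j hj
        have : j ≠ k + 1 := fun h => hk (h ▸ hj)
        omega)
      (fun j hj => by
        have := h2 j hj
        omega) h3
    rw [pow_succ (-1 : ℝ) k] at b1 b2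
    constructor <;> linarith

theorem sum_fib_lt_of_nonconsecutive (m : ℕ) : ∀ S : Finset ℕ, 1 ≤ m → (∀ j ∈ S, 2 ≤ j) →
    (∀ j ∈ S, j < m) → (∀ j ∈ S, j + 1 ∉ S) → ∑ j ∈ S, Nat.fib j < Nat.fib m := by
  induction m using Nat.strong_induction_on with
  | _ m ih =>
  intro S hm h1 h2 h3
  rcases S.eq_empty_or_nonempty with rfl | ⟨i, hi⟩
  · simpa using (show 0 < m from hm)
  obtain ⟨m, rfl⟩ : ∃ m', m = m' + 2 := ⟨m - 2, by have := h1 i hi; have := h2 i hi; omega⟩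
  have hm1 : 1 ≤ m := by have := h1 i hi; have := h2 i hi; omega
  by_cases hk : m + 1 ∈ S
  · have := ih m (by omega) (S.erase (m + 1)) hm1
      (fun j hj => h1 j (Finset.mem_of_mem_erase hj))
      (fun j hj => by
        obtain ⟨hne, hj⟩ := Finset.mem_erase.1 hj
        have := h2 j hj
        have : j ≠ m := fun h => h3 _ hj (h ▸ hk)
        omega)
      (fun j hj hj' => h3 j (Finset.mem_of_mem_erase hj) (Finset.mem_of_mem_erase hj'))
    rw [← Finset.add_sum_erase _ _ hk, Nat.fib_add_two]
    omega
  · refine (ih (m + 1) (by omega) S (by omega) h1 (fun j hj => ?_) h3).trans_le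
      (Nat.fib_mono (by omega))
    have := h2 j hj
    have : j ≠ m + 1 := fun h => hk (h ▸ hj)
    omega

theorem zeckendorf_pairwise (n : ℕ) : (Nat.zeckendorf n).Pairwise (fun a b => b + 2 ≤ a) ∧
    ∀ j ∈ Nat.zeckendorf n, 2 ≤ j := by
  have h := Nat.isZeckendorfRep_zeckendorf n
  have : IsTrans ℕ fun a b => b + 2 ≤ a := ⟨fun a b c hab hbc => by omega⟩
  rw [List.IsZeckendorfRep, List.isChain_iff_pairwise, List.pairwise_append] at h
  exact ⟨h.1, fun j hj => by simpa using h.2.2 j hj 0⟩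

/-- The set of indices in the Zeckendorf expansion. -/
def zeckSet (n : ℕ) : Finset ℕ := (Nat.zeckendorf n).toFinset

theorem zeckendorf_nodup (n : ℕ) : (Nat.zeckendorf n).Nodup :=
  (zeckendorf_pairwise n).1.imp fun h => by omega

theorem two_le_of_mem_zeckSet {n j : ℕ} (h : j ∈ zeckSet n) : 2 ≤ j :=
  (zeckendorf_pairwise n).2 j (List.mem_toFinset.1 h)

theorem succ_notMem_zeckSet {n j : ℕ} (h : j ∈ zeckSet n) : j + 1 ∉ zeckSet n := by
  intro h'
  rw [zeckSet, List.mem_toFinset] at h h'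
  have hp : (Nat.zeckendorf n).Pairwise (fun a b => b + 2 ≤ a ∨ a + 2 ≤ b) :=
    (zeckendorf_pairwise n).1.imp fun h => Or.inl h
  have : Std.Symm (fun a b : ℕ => b + 2 ≤ a ∨ a + 2 ≤ b) := ⟨fun _ _ h => Or.symm h⟩
  have := hp.forall h h' (by omega)
  omega

theorem sum_fib_zeckSet (n : ℕ) : ∑ j ∈ zeckSet n, Nat.fib j = n := by
  rw [zeckSet, List.sum_toFinset _ (zeckendorf_nodup n)]
  exact Nat.sum_zeckendorf_fib n

theorem card_zeckSet (n : ℕ) : (zeckSet n).card = zeckSum n :=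
  List.toFinset_card_of_nodup (zeckendorf_nodup n)

theorem digit_eq (j n : ℕ) : digit j n = if j ∈ zeckSet n then 1 else 0 := by
  simp [digit, zeckSet]

theorem sum_fib_mul_goldenRatio (S : Finset ℕ) :
    ((∑ j ∈ S, Nat.fib j : ℕ) : ℝ) * Real.goldenRatio =
      ((∑ j ∈ S, Nat.fib (j + 1) : ℕ) : ℝ) - ∑ j ∈ S, Real.goldenConj ^ j := by
  push_cast
  rw [Finset.sum_mul, ← Finset.sum_sub_distrib]
  refine Finset.sum_congr rfl fun j _ => ?_
  rw [← Real.fib_succ_sub_goldenRatio_mul_fib]; ring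

/-- The representative of `nφ` modulo `1` in `(-1/φ, 1/φ²)`. -/
def zeckRep (n : ℕ) : ℝ := -∑ j ∈ zeckSet n, Real.goldenConj ^ j

theorem exists_zeckRep_eq (n : ℕ) : ∃ l : ℤ, zeckRep n = n * Real.goldenRatio + l := by
  refine ⟨-(∑ j ∈ zeckSet n, Nat.fib (j + 1) : ℕ), ?_⟩
  have := sum_fib_mul_goldenRatio (zeckSet n)
  rw [sum_fib_zeckSet] at this
  rw [zeckRep, this]; push_cast; ring

theorem bounds_of_le (S : Finset ℕ) (k : ℕ) (h1 : ∀ j ∈ S, k + 1 ≤ j)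
    (h3 : ∀ j ∈ S, j + 1 ∉ S) :
    -Real.goldenRatio⁻¹ ^ k < (-1) ^ k * ∑ j ∈ S, Real.goldenConj ^ j ∧
      (-1) ^ k * ∑ j ∈ S, Real.goldenConj ^ j < Real.goldenRatio⁻¹ ^ (k + 1) := by
  refine sum_goldenConj_pow_bounds (S.sup id + 1) k S h1 (fun j hj => ?_) h3
  have : j ≤ S.sup id := Finset.le_sup (f := id) hj
  omega

theorem zeckRep_mem (n : ℕ) :
    -Real.goldenRatio⁻¹ < zeckRep n ∧ zeckRep n < 1 - Real.goldenRatio⁻¹ := by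
  have := bounds_of_le (zeckSet n) 1 (fun j hj => two_le_of_mem_zeckSet hj)
    (fun j hj => succ_notMem_zeckSet hj)
  have e := inv_goldenRatio_sq
  rw [zeckRep]
  rw [pow_one, pow_one, show 1 + 1 = 2 from rfl, e] at this
  constructor <;> linarith [this.1, this.2]

/-! ### Break points of the digits. -/

/-- The points `-kφ` modulo `1`, `1 ≤ k ≤ F_{λ+1}`, where the digits up to `λ` change. -/
def IsBreak (lam : ℕ) (z : ℝ) : Prop :=
  ∃ k : ℕ, 1 ≤ k ∧ k ≤ Nat.fib (lam + 1) ∧ ∃ l : ℤ, z = l - k * Real.goldenRatio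

theorem IsBreak.add_int {lam : ℕ} {z : ℝ} (h : IsBreak lam z) (t : ℤ) : IsBreak lam (z + t) := by
  obtain ⟨k, h1, h2, l, rfl⟩ := h
  exact ⟨k, h1, h2, l + t, by push_cast; ring⟩

/-- The digits below the first differing index j contribute the same part -w to both
representatives. The tail bounds meet exactly at ψ^{j+1}: multiplied by (-1)^j, the remaining part
is above -φ^{-(j+1)} if digit j is 0 and below it if digit j is 1. -/
theorem exists_isBreak_between_aux {lam j n n' : ℕ} (hj : j ≤ lam) (hn : j ∉ zeckSet n)
    (hn' : j ∈ zeckSet n') (hlt : ∀ i < j, i ∈ zeckSet n ↔ i ∈ zeckSet n') :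
    ∃ z, IsBreak lam z ∧ ((zeckRep n < z ∧ z < zeckRep n') ∨ (zeckRep n' < z ∧ z < zeckRep n)) := by
  set U := (zeckSet n).filter (· < j) with hU
  have hU' : U = (zeckSet n').filter (· < j) := by
    ext i; simp only [hU, Finset.mem_filter]
    constructor <;> rintro ⟨h, hi⟩
    · exact ⟨(hlt i hi).1 h, hi⟩
    · exact ⟨(hlt i hi).2 h, hi⟩
  set S := (zeckSet n).filter (fun i => ¬ i < j) with hS
  set S' := ((zeckSet n').filter (fun i => ¬ i < j)).erase j with hS'
  have e : ∑ i ∈ zeckSet n, Real.goldenConj ^ i =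
      ∑ i ∈ U, Real.goldenConj ^ i + ∑ i ∈ S, Real.goldenConj ^ i :=
    (Finset.sum_filter_add_sum_filter_not _ _ _).symm
  have e' : ∑ i ∈ zeckSet n', Real.goldenConj ^ i =
      ∑ i ∈ U, Real.goldenConj ^ i + (Real.goldenConj ^ j + ∑ i ∈ S', Real.goldenConj ^ i) := by
    rw [hS', Finset.add_sum_erase _ (fun i => Real.goldenConj ^ i) (by simp [hn']), hU']
    exact (Finset.sum_filter_add_sum_filter_not _ _ _).symm
  obtain ⟨-, b⟩ := bounds_of_le S j (fun i hi => by
      rw [hS, Finset.mem_filter] at hi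
      have : i ≠ j := fun h => hn (h ▸ hi.1)
      omega)
    (fun i hi hi' => by
      rw [hS, Finset.mem_filter] at hi hi'
      exact succ_notMem_zeckSet hi.1 hi'.1)
  obtain ⟨-, b'⟩ := bounds_of_le S' (j + 1) (fun i hi => by
      rw [hS', Finset.mem_erase, Finset.mem_filter] at hi
      have : i ≠ j + 1 := fun h => succ_notMem_zeckSet hn' (h ▸ hi.2.1)
      omega)
    (fun i hi hi' => by
      rw [hS', Finset.mem_erase, Finset.mem_filter] at hi hi'
      exact succ_notMem_zeckSet hi.2.1 hi'.2.1)
  have hu : ∑ i ∈ U, Nat.fib i < Nat.fib (j + 1) := by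
    have hj2 := two_le_of_mem_zeckSet hn'
    refine sum_fib_lt_of_nonconsecutive (j + 1) U (by omega)
      (fun i hi => two_le_of_mem_zeckSet (Finset.mem_filter.1 hi).1)
      (fun i hi => by have := (Finset.mem_filter.1 hi).2; omega)
      (fun i hi hi' => succ_notMem_zeckSet (Finset.mem_filter.1 hi).1 (Finset.mem_filter.1 hi').1)
  have hsum := sum_fib_mul_goldenRatio U
  have hfib := Real.fib_succ_sub_goldenRatio_mul_fib (j + 1)
  set u := ∑ i ∈ U, Nat.fib i with hu_def
  set w := ∑ i ∈ U, Real.goldenConj ^ i with hw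
  set s := ∑ i ∈ S, Real.goldenConj ^ i
  set s' := ∑ i ∈ S', Real.goldenConj ^ i
  -- Modulo 1 this point is -kφ with k = F_{j+1} - u, because uφ ≡ -w and F_{j+2} - φF_{j+1} =
  -- ψ^{j+1}. The bound u < F_{j+1} for nonconsecutive indices below j makes k positive.
  refine ⟨-w + Real.goldenConj ^ (j + 1), ⟨Nat.fib (j + 1) - u, by omega,
    (Nat.sub_le _ _).trans (Nat.fib_mono (by omega)),
    (Nat.fib (j + 1 + 1) : ℤ) - (∑ i ∈ U, Nat.fib (i + 1) : ℕ), ?_⟩, ?_⟩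
  · rw [Nat.cast_sub hu.le, ← hfib]; push_cast at hsum ⊢; linarith
  · simp only [zeckRep, e, e']
    have r := inv_goldenRatio_pow_add_two j
    have r1 := inv_goldenRatio_pow_add_two (j + 1)
    have p3 := inv_goldenRatio_pow_pos (j + 3)
    rw [goldenConj_pow_eq j, goldenConj_pow_eq (j + 1)]
    rcases neg_one_pow_eq_or ℝ j with h | h <;> rw [pow_succ (-1 : ℝ) j, h] at b' ⊢ <;>
      rw [h] at b
    · right; constructor <;> linarith
    · left; constructor <;> linarith

theorem exists_isBreak_between {lam j n n' : ℕ} (hj : j ≤ lam)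
    (hne : ¬ (j ∈ zeckSet n ↔ j ∈ zeckSet n')) :
    ∃ z, IsBreak lam z ∧ ((zeckRep n < z ∧ z < zeckRep n') ∨ (zeckRep n' < z ∧ z < zeckRep n)) := by
  classical
  have hex : ∃ i, ¬ (i ∈ zeckSet n ↔ i ∈ zeckSet n') := ⟨j, hne⟩
  have hi := Nat.find_spec hex
  have hmin : ∀ i < Nat.find hex, i ∈ zeckSet n ↔ i ∈ zeckSet n' := fun i hi =>
    not_not.1 (Nat.find_min hex hi)
  have hle : Nat.find hex ≤ lam := (Nat.find_min' hex hne).trans hj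
  set i := Nat.find hex
  by_cases h : i ∈ zeckSet n
  · have h' : i ∉ zeckSet n' := fun h' => hi ⟨fun _ => h', fun _ => h⟩
    obtain ⟨z, hz, hz'⟩ := exists_isBreak_between_aux hle h' h fun i hi => (hmin i hi).symm
    exact ⟨z, hz, hz'.symm⟩
  · have h' : i ∈ zeckSet n' := by
      by_contra h'
      exact hi ⟨fun a => absurd a h, fun a => absurd a h'⟩
    exact exists_isBreak_between_aux hle h h' hmin

/-- The digits up to `λ` agree if no break point separates the points on the line. -/
theorem mem_zeckSet_iff_of_no_break {lam j n n' : ℕ} {l l' : ℤ} (hj : j ≤ lam)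
    (hlt : n * Real.goldenRatio + l ≤ n' * Real.goldenRatio + l')
    (hno : ∀ z ∈ Set.Ioc (n * Real.goldenRatio + l) (n' * Real.goldenRatio + l'),
      ¬ IsBreak lam z) : j ∈ zeckSet n ↔ j ∈ zeckSet n' := by
  by_contra hne
  obtain ⟨a, ha⟩ := exists_zeckRep_eq n
  obtain ⟨a', ha'⟩ := exists_zeckRep_eq n'
  have hm := zeckRep_mem n
  have hm' := zeckRep_mem n'
  have hphi : Real.goldenRatio⁻¹ = Real.goldenRatio - 1 := by
    rw [Real.inv_goldenRatio]; linarith [Real.one_sub_goldenConj]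
  -- The right end 1 - 1/φ of the fundamental interval is itself a break point (k = 1). Hence the
  -- two points cannot wrap around, and one integer shift carries both to their representatives.
  have hB : ∀ t : ℤ, IsBreak lam (1 - Real.goldenRatio⁻¹ + t) := fun t => by
    refine IsBreak.add_int ⟨1, le_rfl, Nat.fib_pos.2 (by omega), 2, ?_⟩ t
    rw [hphi]; push_cast; ring
  have hy : n' * Real.goldenRatio + l' + (a - l) < 1 - Real.goldenRatio⁻¹ := by
    by_contra hcon
    refine hno (1 - Real.goldenRatio⁻¹ + ((l - a : ℤ) : ℝ)) ⟨?_, ?_⟩ (hB _)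
    · push_cast; linarith
    · push_cast; linarith
  have heq : a' = l' + (a - l) := by
    have h1 : ((a' - (l' + (a - l)) : ℤ) : ℝ) < 1 := by push_cast; linarith
    have h2 : (-1 : ℝ) < ((a' - (l' + (a - l)) : ℤ) : ℝ) := by push_cast; linarith
    have h1' : a' - (l' + (a - l)) < 1 := by exact_mod_cast h1
    have h2' : -1 < a' - (l' + (a - l)) := by exact_mod_cast h2
    omega
  obtain ⟨z, hz, h | h⟩ := exists_isBreak_between hj hne
  · refine hno (z + ((l - a : ℤ) : ℝ)) ⟨?_, ?_⟩ (hz.add_int _)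
    · push_cast; linarith
    · rw [heq] at ha'; push_cast at ha' ⊢; linarith
  · rw [heq] at ha'; push_cast at ha'; linarith

/-! ### Digits on the torus. -/

theorem exists_nat_mul_goldenRatio_mem {α β : ℝ} (h : α < β) :
    ∃ (n : ℕ) (l : ℤ), α < n * Real.goldenRatio + l ∧ n * Real.goldenRatio + l < β := by
  have ha1 : Real.goldenRatio⁻¹ < 1 := inv_lt_one_of_one_lt₀ Real.one_lt_goldenRatio
  obtain ⟨j, hj⟩ := exists_pow_lt_of_lt_one (sub_pos.2 h) ha1
  -- With an odd index, φF_{2j+1} exceeds the integer F_{2j+2} by δ > 0, so its natural multiples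
  -- advance modulo 1 in steps of δ < β - α, starting from ⌊α⌋.
  set δ := Real.goldenRatio⁻¹ ^ (2 * j + 1) with hδ
  have hδ0 : 0 < δ := inv_goldenRatio_pow_pos _
  have hδ1 : δ < β - α := lt_of_le_of_lt
    (pow_le_pow_of_le_one (inv_pos.2 Real.goldenRatio_pos).le ha1.le (by omega)) hj
  have hfib := Real.fib_succ_sub_goldenRatio_mul_fib (2 * j + 1)
  rw [goldenConj_pow_eq, ← hδ, Odd.neg_one_pow ⟨j, rfl⟩] at hfib
  set i := ⌊(α - ⌊α⌋) / δ⌋₊ + 1 with hi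
  have h0 : 0 ≤ (α - ⌊α⌋) / δ := div_nonneg (by linarith [Int.floor_le α]) hδ0.le
  have h1 : (α - ⌊α⌋) / δ < i := by rw [hi]; push_cast; exact Nat.lt_floor_add_one _
  have h2 : (i : ℝ) ≤ (α - ⌊α⌋) / δ + 1 := by
    rw [hi]; push_cast; linarith [Nat.floor_le h0]
  rw [div_lt_iff₀ hδ0] at h1
  have h2' : (i : ℝ) * δ ≤ α - ⌊α⌋ + δ := by
    calc (i : ℝ) * δ ≤ ((α - ⌊α⌋) / δ + 1) * δ := by gcongr
      _ = _ := by field_simp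
  refine ⟨i * Nat.fib (2 * j + 1), ⌊α⌋ - i * Nat.fib (2 * j + 1 + 1), ?_, ?_⟩
  all_goals
    have : ((i * Nat.fib (2 * j + 1) : ℕ) : ℝ) * Real.goldenRatio +
      ((⌊α⌋ - i * Nat.fib (2 * j + 1 + 1) : ℤ) : ℝ) = i * δ + ⌊α⌋ := by
      push_cast; linear_combination (-(i : ℝ)) * hfib
    rw [this]; linarith

theorem exists_right_no_break (lam : ℕ) (y : ℝ) :
    ∃ u, y < u ∧ ∀ z ∈ Set.Ioo y u, ¬ IsBreak lam z := by
  have : ∀ᶠ z in 𝓝[>] y, ∀ k ∈ Finset.Icc 1 (Nat.fib (lam + 1)),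
      ∀ l : ℤ, z ≠ l - k * Real.goldenRatio := by
    rw [Filter.eventually_all_finset]
    intro k _
    have hlt : y < ⌊y + k * Real.goldenRatio⌋ + 1 - k * Real.goldenRatio := by
      linarith [Int.lt_floor_add_one (y + k * Real.goldenRatio)]
    filter_upwards [Ioo_mem_nhdsGT hlt] with z hz l hl
    have h1 : ((⌊y + k * Real.goldenRatio⌋ : ℤ) : ℝ) < l := by
      linarith [hz.1, Int.floor_le (y + k * Real.goldenRatio)]
    have h2 : ((l : ℤ) : ℝ) < (⌊y + k * Real.goldenRatio⌋ : ℝ) + 1 := by linarith [hz.2]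
    have h1' : ⌊y + k * Real.goldenRatio⌋ < l := by exact_mod_cast h1
    have h2' : l < ⌊y + k * Real.goldenRatio⌋ + 1 := by exact_mod_cast h2
    omega
  obtain ⟨u, hu, hsub⟩ := mem_nhdsGT_iff_exists_Ioo_subset.1 this
  refine ⟨u, hu, fun z hz ⟨k, h1, h2, l, hl⟩ => hsub hz k (Finset.mem_Icc.2 ⟨h1, h2⟩) l hl⟩

theorem exists_right_nat (lam : ℕ) (y : ℝ) : ∃ (n : ℕ) (l : ℤ), y < n * Real.goldenRatio + l ∧
    ∀ z ∈ Set.Ioc y (n * Real.goldenRatio + l), ¬ IsBreak lam z := by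
  obtain ⟨u, hu, hno⟩ := exists_right_no_break lam y
  obtain ⟨n, l, h1, h2⟩ := exists_nat_mul_goldenRatio_mem hu
  exact ⟨n, l, h1, fun z hz => hno z ⟨hz.1, hz.2.trans_lt h2⟩⟩

/-- No break point separates nφ + l from the points mφ, modulo 1, that lie just to the right of x,
so the digit is eventually constant along the filter. Density of mφ makes the filter nontrivial,
which is needed to identify `limUnder`. -/
theorem torusDigit_eq_digit {lam j n : ℕ} {l : ℤ} {x : ℝ} (hj : j ≤ lam)
    (hx : x < n * Real.goldenRatio + l)
    (hno : ∀ z ∈ Set.Ioc x (n * Real.goldenRatio + l), ¬ IsBreak lam z) :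
    torusDigit j x = digit j n := by
  set ρ := n * Real.goldenRatio + l - x with hρ
  have hρ0 : 0 < ρ := by rw [hρ]; linarith
  have hev : ∀ᶠ m in comap (fun n : ℕ => Int.fract ((n : ℝ) * Real.goldenRatio))
      (𝓝[>] (Int.fract x)), digit j m = digit j n := by
    refine mem_comap.2 ⟨Set.Ioo (Int.fract x) (Int.fract x + ρ), Ioo_mem_nhdsGT (by linarith), ?_⟩
    intro m hm
    obtain ⟨hm1, hm2⟩ : Int.fract x < Int.fract (m * Real.goldenRatio) ∧
      Int.fract (m * Real.goldenRatio) < Int.fract x + ρ := hm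
    have e1 := Int.fract_add_floor x
    have e2 := Int.fract_add_floor ((m : ℝ) * Real.goldenRatio)
    have key : j ∈ zeckSet m ↔ j ∈ zeckSet n := by
      refine mem_zeckSet_iff_of_no_break (l := ⌊x⌋ - ⌊(m : ℝ) * Real.goldenRatio⌋) (l' := l) hj
        ?_ ?_
      · push_cast; linarith
      · intro z hz
        refine hno z ⟨?_, hz.2⟩
        have := hz.1
        push_cast at this; linarith
    simp only [Set.mem_ofPred_eq, digit_eq, key]
  have hne : (comap (fun n : ℕ => Int.fract ((n : ℝ) * Real.goldenRatio))
      (𝓝[>] (Int.fract x))).NeBot := by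
    rw [comap_neBot_iff]
    intro t ht
    have ht' : t ∩ Set.Ioo (Int.fract x) 1 ∈ 𝓝[>] (Int.fract x) :=
      inter_mem ht (Ioo_mem_nhdsGT (Int.fract_lt_one x))
    obtain ⟨u, hu, hsub⟩ := mem_nhdsGT_iff_exists_Ioo_subset.1 ht'
    obtain ⟨m, b, h1, h2⟩ := exists_nat_mul_goldenRatio_mem hu
    have hmem := hsub ⟨h1, h2⟩
    refine ⟨m, ?_⟩
    have : Int.fract ((m : ℝ) * Real.goldenRatio) = m * Real.goldenRatio + b := by
      rw [Int.fract_eq_iff]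
      exact ⟨(Int.fract_nonneg x).trans hmem.2.1.le, hmem.2.2, -b, by push_cast; ring⟩
    rw [this]; exact hmem.1
  refine Tendsto.limUnder_eq ?_
  exact tendsto_nhds_of_eventually_eq hev

theorem torusDigit_eq_of_no_break {lam j : ℕ} {x y : ℝ} (hj : j ≤ lam) (hxy : x ≤ y)
    (hno : ∀ z ∈ Set.Ioc x y, ¬ IsBreak lam z) : torusDigit j x = torusDigit j y := by
  obtain ⟨n, l, h1, h2⟩ := exists_right_nat lam y
  rw [torusDigit_eq_digit hj h1 h2, torusDigit_eq_digit hj (hxy.trans_lt h1)]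
  intro z hz
  rcases le_or_gt z y with h | h
  · exact hno z ⟨hz.1, h⟩
  · exact h2 z ⟨h, hz.2⟩

theorem torusDigit_nat_mul (j n : ℕ) : torusDigit j (n * Real.goldenRatio) = digit j n := by
  obtain ⟨m, l, h1, h2⟩ := exists_right_nat j (n * Real.goldenRatio)
  rw [torusDigit_eq_digit le_rfl h1 h2, digit_eq, digit_eq]
  have := mem_zeckSet_iff_of_no_break (l := 0) (l' := l) (n := n) (n' := m) (lam := j) le_rfl
    (by simpa using h1.le) (by simpa using h2)
  simp only [this]

theorem torusDigit_add_one (j : ℕ) (x : ℝ) : torusDigit j (x + 1) = torusDigit j x := by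
  simp only [torusDigit, Int.fract_add_one]

theorem torusSum_add_one (lam : ℕ) (x : ℝ) : torusSum lam (x + 1) = torusSum lam x := by
  simp only [torusSum, torusDigit_add_one]

/-- The number of Zeckendorf digits with index at most `λ`. -/
def lowSum (lam n : ℕ) : ℕ := ((zeckSet n).filter (· ≤ lam)).card

theorem torusSum_nat_mul (lam n : ℕ) : torusSum lam (n * Real.goldenRatio) = lowSum lam n := by
  simp only [torusSum, torusDigit_nat_mul, digit_eq, lowSum]
  rw [← Finset.sum_filter, Finset.sum_const, smul_eq_mul, mul_one]
  congr 1
  ext j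
  simp only [Finset.mem_filter, Finset.mem_Icc]
  constructor
  · rintro ⟨⟨-, h⟩, h'⟩; exact ⟨h', h⟩
  · rintro ⟨h', h⟩; exact ⟨⟨two_le_of_mem_zeckSet h', h⟩, h'⟩

theorem norm_e (x : ℝ) : ‖e x‖ = 1 := by
  rw [e, show 2 * (Real.pi : ℂ) * Complex.I * x = ((2 * Real.pi * x : ℝ) : ℂ) * Complex.I by
    push_cast; ring]
  exact Complex.norm_exp_ofReal_mul_I _

theorem e_add (x y : ℝ) : e (x + y) = e x * e y := by
  simp only [e]; rw [← Complex.exp_add]; push_cast; ring_nf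

theorem conj_e (x : ℝ) : (starRingEnd ℂ) (e x) = e (-x) := by
  simp only [e]; rw [← Complex.exp_conj]; simp [Complex.conj_ofNat]

theorem e_int (n : ℤ) : e n = 1 := by
  rw [e, Complex.exp_eq_one_iff]; exact ⟨n, by push_cast; ring⟩

/-- The function `e(ϑ g_λ)` on the torus. -/
def torusExp (ϑ : ℝ) (lam : ℕ) (x : ℝ) : ℂ := e (ϑ * (torusSum lam x : ℝ))

theorem isStep_torusExp (ϑ : ℝ) (lam : ℕ) : IsStep (Nat.fib (lam + 1)) (torusExp ϑ lam) := by
  classical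
  refine ⟨fun x => by simp only [torusExp, torusSum_add_one], fun x => (norm_e _).le,
    (Finset.Icc 1 (Nat.fib (lam + 1))).image (fun k : ℕ => Int.fract (-(k * Real.goldenRatio))),
    ?_, ?_⟩
  · exact Finset.card_image_le.trans (by simp)
  · intro x y hxy hz
    have : ∀ z ∈ Set.Ioc x y, ¬ IsBreak lam z := by
      rintro z hz' ⟨k, h1, h2, l, hl⟩
      refine hz z hz' (Finset.mem_image.2 ⟨k, Finset.mem_Icc.2 ⟨h1, h2⟩, ?_⟩)
      rw [Int.fract_eq_fract]
      exact ⟨-l, by rw [hl]; push_cast; ring⟩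
    simp only [torusExp, torusSum]
    rw [Finset.sum_congr rfl fun j hj =>
      torusDigit_eq_of_no_break (Finset.mem_Icc.1 hj).2 hxy this]

theorem norm_torusExp (ϑ : ℝ) (lam : ℕ) (x : ℝ) : ‖torusExp ϑ lam x‖ = 1 := norm_e _

theorem torusExp_nat_mul (ϑ : ℝ) (lam n : ℕ) :
    torusExp ϑ lam (n * Real.goldenRatio) = e (ϑ * (lowSum lam n : ℝ)) := by
  rw [torusExp, torusSum_nat_mul]

/-! ### Equidistribution of mφ for step functions. -/

theorem IsStep.integral_translate {K : ℕ} {H : ℝ → ℂ} (h : IsStep K H) (a : ℝ) :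
    ∫ x in (0 : ℝ)..1, H (x + a) = ∫ x in (0 : ℝ)..1, H x := by
  rw [intervalIntegral.integral_comp_add_right, zero_add, add_comm 1 a]
  simpa using h.periodic.intervalIntegral_add_eq a 0

theorem fib_succ_le_goldenRatio_pow (j : ℕ) : (Nat.fib (j + 1) : ℝ) ≤ Real.goldenRatio ^ j := by
  induction j using Nat.strong_induction_on with
  | _ j ih =>
  rcases j with _ | _ | j
  · simp
  · simpa using Real.one_lt_goldenRatio.le
  · have h1 := ih (j + 1) (by omega)
    have h0 := ih j (by omega)
    rw [Nat.fib_add_two]; push_cast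
    have := Real.goldenRatio_pow_sub_goldenRatio_pow j
    linarith

theorem inv_goldenRatio_pow_le (j : ℕ) : Real.goldenRatio⁻¹ ^ j ≤ 1 / (Nat.fib (j + 1) : ℝ) := by
  have h : (0 : ℝ) < Nat.fib (j + 1) := by exact_mod_cast Nat.fib_pos.2 (by omega)
  rw [inv_pow, ← one_div]
  exact one_div_le_one_div_of_le h (fib_succ_le_goldenRatio_pow j)

/-- The cell of length `1/F_j` to which the point `mφ` is close. -/
def cellIdx (j m : ℕ) : ℕ := m * Nat.fib (j + 1) % Nat.fib j

theorem image_cellIdx {j : ℕ} (hj : 1 ≤ j) :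
    (Finset.range (Nat.fib j)).image (cellIdx j) = Finset.range (Nat.fib j) ∧
      Set.InjOn (cellIdx j) (Finset.range (Nat.fib j)) := by
  have hpos : 0 < Nat.fib j := Nat.fib_pos.2 hj
  have hinj : Set.InjOn (cellIdx j) (Finset.range (Nat.fib j)) := by
    intro m hm n hn h
    simp only [Finset.coe_range, Set.mem_Iio] at hm hn
    have h' : m * Nat.fib (j + 1) ≡ n * Nat.fib (j + 1) [MOD Nat.fib j] := h
    have := Nat.ModEq.cancel_right_of_coprime (Nat.fib_coprime_fib_succ j) h'
    exact this.eq_of_lt_of_lt hm hn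
  refine ⟨Finset.eq_of_subset_of_card_le ?_ ?_, hinj⟩
  · intro k hk
    obtain ⟨m, -, rfl⟩ := Finset.mem_image.1 hk
    exact Finset.mem_range.2 (Nat.mod_lt _ hpos)
  · rw [Finset.card_image_of_injOn hinj]

theorem sum_cellIdx {α : Type*} [AddCommMonoid α] {j : ℕ} (hj : 1 ≤ j) (G : ℕ → α) :
    ∑ m ∈ Finset.range (Nat.fib j), G (cellIdx j m) = ∑ k ∈ Finset.range (Nat.fib j), G k := by
  obtain ⟨h1, h2⟩ := image_cellIdx hj
  conv_rhs => rw [← h1]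
  rw [Finset.sum_image h2]

/-- The error of F_{j+1}/F_j as an approximation to φ is |ψ|^j/F_j, and multiplication by m < F_j
leaves at most φ^{-j} ≤ 1/F_j. -/
theorem exists_near_cellIdx {j m : ℕ} (hj : 1 ≤ j) (hm : m < Nat.fib j) :
    ∃ l : ℤ, |m * Real.goldenRatio + l - cellIdx j m / Nat.fib j| ≤ 1 / Nat.fib j := by
  have hpos : (0 : ℝ) < Nat.fib j := by exact_mod_cast Nat.fib_pos.2 hj
  set d : ℕ := m * Nat.fib (j + 1) / Nat.fib j with hd
  refine ⟨-(d : ℤ), ?_⟩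
  have e1 : ((m * Nat.fib (j + 1) % Nat.fib j : ℕ) : ℝ) +
      Nat.fib j * (d : ℝ) = m * Nat.fib (j + 1) := by
    exact_mod_cast Nat.mod_add_div (m * Nat.fib (j + 1)) (Nat.fib j)
  have e2 := Real.fib_succ_sub_goldenRatio_mul_fib j
  have e3 : m * Real.goldenRatio + ((-(d : ℤ) : ℤ) : ℝ) -
      cellIdx j m / Nat.fib j = -(m / Nat.fib j * Real.goldenConj ^ j) := by
    have e4 : (Nat.fib j : ℝ) * ((cellIdx j m : ℝ) / Nat.fib j) = cellIdx j m :=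
      mul_div_cancel₀ _ hpos.ne'
    have e5 : (Nat.fib j : ℝ) * ((m : ℝ) / Nat.fib j) = m := mul_div_cancel₀ _ hpos.ne'
    refine mul_left_cancel₀ hpos.ne' ?_
    rw [← cellIdx] at e1
    push_cast
    linear_combination (-1 : ℝ) * e1 - (m : ℝ) * e2 - e4 + Real.goldenConj ^ j * e5
  have hle : (Nat.fib j : ℝ) ≤ Nat.fib (j + 1) := by exact_mod_cast Nat.fib_mono (Nat.le_succ j)
  rw [e3, abs_neg, abs_mul, goldenConj_pow_eq, abs_mul, abs_pow, abs_neg, abs_one, one_pow, one_mul,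
    abs_of_pos (inv_goldenRatio_pow_pos j), abs_of_nonneg (by positivity)]
  calc (m : ℝ) / Nat.fib j * Real.goldenRatio⁻¹ ^ j ≤ 1 * (1 / Nat.fib (j + 1)) := by
        have hm' : (m : ℝ) ≤ Nat.fib j := by exact_mod_cast hm.le
        exact mul_le_mul ((div_le_one hpos).2 hm') (inv_goldenRatio_pow_le j)
          (inv_goldenRatio_pow_pos j).le zero_le_one
    _ ≤ 1 / Nat.fib j := by
        rw [one_mul]; exact one_div_le_one_div_of_le hpos hle

theorem sum_integral_cells {E : Type*} [NormedAddCommGroup E] [NormedSpace ℝ E] {f : ℝ → E}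
    (hf : ∀ a b : ℝ, IntervalIntegrable f volume a b) {Q : ℕ} (hQ : 0 < Q) :
    ∑ k ∈ Finset.range Q, ∫ x in (k / Q : ℝ)..((k + 1) / Q), f x = ∫ x in (0 : ℝ)..1, f x := by
  have := intervalIntegral.sum_integral_adjacent_intervals (μ := volume) (f := f)
    (a := fun k : ℕ => (k / Q : ℝ)) (n := Q) (fun k _ => hf _ _)
  have hQ' : (Q : ℝ) ≠ 0 := by exact_mod_cast hQ.ne'
  simpa [div_self hQ'] using this

/-- The cells of length `1/Q` whose neighbourhood contains a given set of jumps. -/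
theorem card_bad_cells_le (D : Finset ℝ) {Q : ℕ} (hQ : 0 < Q) (B : Finset ℕ)
    (hB : B ⊆ Finset.range Q)
    (hBD : ∀ k ∈ B, ∃ z ∈ Set.Ioc ((k - 1) / Q : ℝ) ((k + 1) / Q), Int.fract z ∈ D) :
    B.card ≤ 2 * D.card := by
  classical
  have hQ' : (0 : ℝ) < Q := by exact_mod_cast hQ
  -- A jump z in ((k-1)/Q, (k+1)/Q] has ⌈zQ⌉ equal to k or k + 1, so it can spoil at most two cells.
  -- Reduction modulo Q accounts for replacing z by its fractional part.
  have hsub : B ⊆ (D ×ˢ ({0, 1} : Finset ℤ)).image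
      (fun x : ℝ × ℤ => ((⌈x.1 * (Q : ℝ)⌉ - x.2) % (Q : ℤ)).toNat) := by
    intro k hk
    obtain ⟨z, hz, hd⟩ := hBD k hk
    have hkQ := Finset.mem_range.1 (hB hk)
    have h1 : (k : ℝ) - 1 < z * Q := by have := hz.1; rwa [div_lt_iff₀ hQ'] at this
    have h2 : z * Q ≤ (k : ℝ) + 1 := by have := hz.2; rwa [le_div_iff₀ hQ'] at this
    have hc1 : (k : ℤ) - 1 < ⌈z * Q⌉ := by rw [Int.lt_ceil]; push_cast; exact h1
    have hc2 : ⌈z * Q⌉ ≤ (k : ℤ) + 1 := by rw [Int.ceil_le]; push_cast; exact h2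
    have hc : ⌈z * Q⌉ = ⌈Int.fract z * Q⌉ + ⌊z⌋ * Q := by
      rw [← Int.ceil_add_intCast]
      congr 1
      rw [Int.fract]; push_cast; ring
    refine Finset.mem_image.2 ⟨(Int.fract z, ⌈z * Q⌉ - k), ?_, ?_⟩
    · simp only [Finset.mem_product, Finset.mem_insert, Finset.mem_singleton]
      exact ⟨hd, by omega⟩
    · have : ⌈Int.fract z * (Q : ℝ)⌉ - (⌈z * Q⌉ - (k : ℤ)) = k + Q * (-⌊z⌋) := by rw [hc]; ring
      simp only
      rw [this, Int.add_mul_emod_self_left, Int.emod_eq_of_lt (by omega) (by exact_mod_cast hkQ)]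
      simp
  calc B.card ≤ _ := Finset.card_le_card hsub
    _ ≤ (D ×ˢ ({0, 1} : Finset ℤ)).card := Finset.card_image_le
    _ = 2 * D.card := by rw [Finset.card_product]; simp [mul_comm]

/-- The F_j points correspond one to one to the cells, since F_j and F_{j+1} are coprime. If no jump
is near a cell, the value at its point equals the mean over the cell. At most 2K cells are
exceptional, and each costs at most 2. -/
theorem IsStep.sum_block {K : ℕ} {H : ℝ → ℂ} (h : IsStep K H) {j : ℕ} (hj : 1 ≤ j) :
    ‖∑ m ∈ Finset.range (Nat.fib j), H (m * Real.goldenRatio) -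
      Nat.fib j * ∫ x in (0 : ℝ)..1, H x‖ ≤ 4 * K := by
  classical
  obtain ⟨D, hD, hH⟩ := h.jumps
  set Q := Nat.fib j with hQ
  have hQ0 : 0 < Q := Nat.fib_pos.2 hj
  have hQ' : (0 : ℝ) < Q := by exact_mod_cast hQ0
  set B := (Finset.range Q).filter
    (fun k : ℕ => ∃ z ∈ Set.Ioc ((k - 1) / Q : ℝ) ((k + 1) / Q), Int.fract z ∈ D) with hB
  have hcard : B.card ≤ 2 * D.card := card_bad_cells_le D hQ0 B (Finset.filter_subset _ _)
    fun k hk => (Finset.mem_filter.1 hk).2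
  have hterm : ∀ m ∈ Finset.range Q, ‖H (m * Real.goldenRatio) -
      Q * ∫ x in (cellIdx j m / Q : ℝ)..((cellIdx j m + 1) / Q), H x‖ ≤
        if cellIdx j m ∈ B then 2 else 0 := by
    intro m hm
    obtain ⟨l, hl⟩ := exists_near_cellIdx hj (Finset.mem_range.1 hm)
    set k := cellIdx j m with hk
    have hkQ : k < Q := Nat.mod_lt _ hQ0
    rw [abs_le] at hl
    have hlen : ((k : ℝ) + 1) / Q - k / Q = 1 / Q := by ring
    have hle : (k : ℝ) / Q ≤ (k + 1) / Q := by linarith [one_div_pos.2 hQ']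
    have e1 : (k - 1 : ℝ) / Q = k / Q - 1 / Q := by ring
    have e : H (m * Real.goldenRatio) - Q * ∫ x in (k / Q : ℝ)..((k + 1) / Q), H x =
        Q * ∫ x in (k / Q : ℝ)..((k + 1) / Q), (H (m * Real.goldenRatio + l) - H x) := by
      rw [intervalIntegral.integral_sub (by simp) (h.intervalIntegrable _ _),
        intervalIntegral.integral_const, hlen, show (l : ℝ) = l * (1 : ℝ) by ring,
        h.periodic.int_mul l]
      rw [Complex.real_smul, mul_sub, ← mul_assoc]
      push_cast
      rw [mul_one_div_cancel (by exact_mod_cast hQ0.ne'), one_mul]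
    have hbound : ∀ C : ℝ, (∀ x ∈ Set.uIoc (k / Q : ℝ) ((k + 1) / Q),
        ‖H (m * Real.goldenRatio + l) - H x‖ ≤ C) →
        ‖H (m * Real.goldenRatio) - Q * ∫ x in (k / Q : ℝ)..((k + 1) / Q), H x‖ ≤ C := by
      intro C hC
      rw [e, norm_mul, Complex.norm_natCast]
      have := intervalIntegral.norm_integral_le_of_norm_le_const hC
      rw [hlen, abs_of_pos (by positivity)] at this
      calc (Q : ℝ) * _ ≤ Q * (C * (1 / Q)) := by gcongr
        _ = C := by field_simp
    split_ifs with hkB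
    · refine hbound 2 fun x _ => (norm_sub_le _ _).trans ?_
      linarith [h.norm_le (m * Real.goldenRatio + l), h.norm_le x]
    · refine hbound 0 fun x hx => ?_
      rw [Set.uIoc_of_le hle] at hx
      have hno : ∀ z ∈ Set.Ioc ((k - 1) / Q : ℝ) ((k + 1) / Q), Int.fract z ∉ D :=
        fun z hz hd => hkB (Finset.mem_filter.2 ⟨Finset.mem_range.2 hkQ, z, hz, hd⟩)
      have hconst : ∀ y, (k - 1 : ℝ) / Q ≤ y → y ≤ (k + 1) / Q → H ((k - 1 : ℝ) / Q) = H y :=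
        fun y hy1 hy2 => hH _ _ hy1 fun z hz => hno z ⟨hz.1, hz.2.trans hy2⟩
      rw [← hconst (m * Real.goldenRatio + l) (by linarith) (by linarith),
        ← hconst x (by linarith [hx.1, one_div_pos.2 hQ']) hx.2, sub_self, norm_zero]
  rw [← sum_integral_cells (h.intervalIntegrable) hQ0,
    ← sum_cellIdx hj (fun k => ∫ x in (k / Q : ℝ)..((k + 1) / Q), H x), Finset.mul_sum,
    ← Finset.sum_sub_distrib]
  refine (norm_sum_le _ _).trans ((Finset.sum_le_sum hterm).trans ?_)
  rw [sum_cellIdx hj (fun k => if k ∈ B then (2 : ℝ) else 0), Finset.sum_ite_mem,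
    Finset.sum_const, nsmul_eq_mul]
  have h1 : ((Finset.range Q ∩ B).card : ℝ) ≤ 2 * K := by
    exact_mod_cast (Finset.card_le_card Finset.inter_subset_right).trans (hcard.trans (by omega))
  linarith

/-- Greedy splitting: the largest Fibonacci number not exceeding L is more than L/2. The rest is the
same problem for a translate, with the same integral, so k blocks suffice. -/
theorem IsStep.sum_range {K : ℕ} (k : ℕ) : ∀ {H : ℝ → ℂ} (_ : IsStep K H) {L : ℕ}, L < 2 ^ k →
    ‖∑ m ∈ Finset.range L, H (m * Real.goldenRatio) - L * ∫ x in (0 : ℝ)..1, H x‖ ≤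
      4 * K * k := by
  induction k with
  | zero =>
    intro H h L hL
    have : L = 0 := by omega
    simp [this]
  | succ k ih =>
    intro H h L hL
    rcases Nat.eq_zero_or_pos L with rfl | hL0
    · simp; positivity
    obtain ⟨g, hg, hQL, hL2⟩ : ∃ g, 1 ≤ g ∧ Nat.fib g ≤ L ∧ L < Nat.fib g + Nat.fib g := by
      have hg : 1 ≤ Nat.greatestFib L := Nat.greatestFib_pos.2 hL0
      refine ⟨_, hg, Nat.fib_greatestFib_le L, ?_⟩
      refine (Nat.lt_fib_greatestFib_add_one L).trans_le ?_
      rw [Nat.fib_add_one (by omega), add_comm]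
      exact Nat.add_le_add_left (Nat.fib_mono (Nat.sub_le _ _)) _
    set Q := Nat.fib g with hQ
    have h1 := h.sum_block hg
    have h2 := ih (h.translate (Q * Real.goldenRatio)) (L := L - Q) (by rw [pow_succ] at hL; omega)
    rw [h.integral_translate] at h2
    obtain ⟨r, rfl⟩ := Nat.exists_eq_add_of_le hQL
    rw [Nat.add_sub_cancel_left] at h2
    have e : ∑ m ∈ Finset.range (Q + r), H (m * Real.goldenRatio) -
        ((Q + r : ℕ) : ℂ) * ∫ x in (0 : ℝ)..1, H x =
        (∑ m ∈ Finset.range Q, H (m * Real.goldenRatio) - Q * ∫ x in (0 : ℝ)..1, H x) +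
        (∑ m ∈ Finset.range r, H (m * Real.goldenRatio + Q * Real.goldenRatio) -
          r * ∫ x in (0 : ℝ)..1, H x) := by
      rw [Finset.sum_range_add]
      have : ∀ m : ℕ, ((Q + m : ℕ) : ℝ) * Real.goldenRatio =
          m * Real.goldenRatio + Q * Real.goldenRatio := fun m => by push_cast; ring
      simp only [this]
      push_cast; ring
    rw [e]
    refine (norm_add_le _ _).trans ((add_le_add h1 h2).trans_eq ?_)
    push_cast; ring

theorem IsStep.sum_Ioc {K : ℕ} {H : ℝ → ℂ} (h : IsStep K H) {a b k : ℕ} (hab : a ≤ b)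
    (hk : b - a < 2 ^ k) :
    ‖∑ m ∈ Finset.Ioc a b, H (m * Real.goldenRatio) -
      ((b - a : ℕ) : ℂ) * ∫ x in (0 : ℝ)..1, H x‖ ≤ 4 * K * k := by
  have := (h.translate ((a + 1) * Real.goldenRatio)).sum_range k hk
  rw [h.integral_translate] at this
  have e : ∑ m ∈ Finset.Ioc a b, H (m * Real.goldenRatio) =
      ∑ m ∈ Finset.range (b - a), H (m * Real.goldenRatio + (a + 1) * Real.goldenRatio) := by
    rw [show Finset.Ioc a b = Finset.Ico (a + 1) (b + 1) by ext; simp,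
      Finset.sum_Ico_eq_sum_range]
    rw [show b + 1 - (a + 1) = b - a by omega]
    refine Finset.sum_congr rfl fun m _ => ?_
    congr 1; push_cast; ring
  rwa [e]

/-! ### Carries beyond the digit λ. -/

theorem zeckSet_of_pos {n : ℕ} (hn : 0 < n) :
    zeckSet n = insert (Nat.greatestFib n) (zeckSet (n - Nat.fib (Nat.greatestFib n))) := by
  simp only [zeckSet]
  rw [Nat.zeckendorf_of_pos hn, List.toFinset_cons]

theorem greatestFib_notMem {n : ℕ} (hn : 0 < n) :
    Nat.greatestFib n ∉ zeckSet (n - Nat.fib (Nat.greatestFib n)) := by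
  have := zeckendorf_nodup n
  rw [Nat.zeckendorf_of_pos hn, List.nodup_cons] at this
  simpa [zeckSet] using this.1

/-- The number of Zeckendorf digits with index greater than `λ`. -/
def highSum (lam n : ℕ) : ℕ := ((zeckSet n).filter (lam < ·)).card

theorem lowSum_add_highSum (lam n : ℕ) : lowSum lam n + highSum lam n = zeckSum n := by
  have := Finset.card_filter_add_card_filter_not (s := zeckSet n) (· ≤ lam)
  simp only [not_le] at this
  rw [← card_zeckSet, lowSum, highSum, this]

/-- All Zeckendorf digits with index at most `λ` vanish. -/
def HighOnly (lam w : ℕ) : Prop := ∀ j ∈ zeckSet w, lam < j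

theorem highSum_eq_zero {lam n : ℕ} (h : n < Nat.fib (lam + 1)) : highSum lam n = 0 := by
  rw [highSum, Finset.card_eq_zero, Finset.filter_eq_empty_iff]
  intro j hj hlt
  have h1 : Nat.fib j ≤ n := by
    conv_rhs => rw [← sum_fib_zeckSet n]
    exact Finset.single_le_sum (f := Nat.fib) (fun _ _ => Nat.zero_le _) hj
  have h2 : Nat.fib (lam + 1) ≤ Nat.fib j := Nat.fib_mono hlt
  omega

/-- Adding 1 disturbs digits above λ only through a carry, and after such a carry all digits up to λ
are 0. The induction strips the leading Fibonacci number, which n and n + 1 share unless n + 1 is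
itself a Fibonacci number, a case that `h` excludes. -/
theorem highSum_succ (lam n : ℕ) (h : ¬ HighOnly lam (n + 1)) :
    highSum lam (n + 1) = highSum lam n := by
  induction n using Nat.strong_induction_on with
  | _ n ih =>
  rcases lt_or_ge (n + 1) (Nat.fib (lam + 1)) with hlt | hge
  · rw [highSum_eq_zero hlt, highSum_eq_zero (by omega)]
  · set g := Nat.greatestFib (n + 1) with hg
    have hglam : lam + 1 ≤ g := Nat.le_greatestFib.2 hge
    have hgn : Nat.fib g ≤ n + 1 := Nat.fib_greatestFib_le _
    have hgpos : 0 < Nat.fib g := Nat.fib_pos.2 (by omega)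
    have hset := zeckSet_of_pos (Nat.succ_pos n)
    have hnot := greatestFib_notMem (Nat.succ_pos n)
    simp only [Nat.succ_eq_add_one, ← hg] at hset hnot
    rcases hgn.eq_or_lt with heq | hlt
    · refine absurd (fun j hj => ?_) h
      rw [hset, heq, Nat.sub_self] at hj
      simp only [zeckSet, Nat.zeckendorf_zero, List.toFinset_nil, Finset.mem_insert,
        Finset.notMem_empty, or_false] at hj
      omega
    · have hn : 0 < n := by omega
      have hg' : Nat.greatestFib n = g := by
        refine le_antisymm (Nat.greatestFib_mono (Nat.le_succ n)) (Nat.le_greatestFib.2 (by omega))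
      have hset' := zeckSet_of_pos hn
      have hnot' := greatestFib_notMem hn
      rw [hg'] at hset' hnot'
      have e : n + 1 - Nat.fib g = n - Nat.fib g + 1 := by omega
      rw [e] at hset hnot
      have := ih (n - Nat.fib g) (by omega) (fun hW => h fun j hj => by
        rw [hset, Finset.mem_insert] at hj
        rcases hj with rfl | hj
        · omega
        · exact hW j hj)
      simp only [highSum] at this ⊢
      rw [hset, hset', Finset.filter_insert, Finset.filter_insert, if_pos (by omega),
        if_pos (by omega), Finset.card_insert_of_notMem (fun h => hnot (Finset.mem_filter.1 h).1),
        Finset.card_insert_of_notMem (fun h => hnot' (Finset.mem_filter.1 h).1), this]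

theorem highSum_add (lam n t : ℕ) (h : ∀ i ∈ Finset.Ioc 0 t, ¬ HighOnly lam (n + i)) :
    highSum lam (n + t) = highSum lam n := by
  induction t with
  | zero => rfl
  | succ t ih =>
    rw [← add_assoc, highSum_succ lam (n + t)
      (h (t + 1) (Finset.mem_Ioc.2 ⟨Nat.succ_pos _, le_rfl⟩))]
    refine ih fun i hi => h i ?_
    rw [Finset.mem_Ioc] at hi ⊢; omega

/-- When all indices exceed λ, (-1)^λ times the representative lies between -φ^{-(λ+1)} and φ^{-λ},
an interval of length φ^{-(λ-1)}. The parity of λ decides which shift moves the left end to 0. -/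
theorem HighOnly.fract_lt {lam w : ℕ} (hlam : 1 ≤ lam) (h : HighOnly lam w) :
    Int.fract (w * Real.goldenRatio +
      (if Even lam then Real.goldenRatio⁻¹ ^ (lam + 1) else Real.goldenRatio⁻¹ ^ lam)) <
      Real.goldenRatio⁻¹ ^ (lam - 1) := by
  obtain ⟨l, hl⟩ := exists_zeckRep_eq w
  have hb := bounds_of_le (zeckSet w) lam (fun j hj => h j hj)
    (fun j hj => succ_notMem_zeckSet hj)
  obtain ⟨lam, rfl⟩ := Nat.exists_eq_add_of_le' hlam
  have r := inv_goldenRatio_pow_add_two lam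
  have ha1 : Real.goldenRatio⁻¹ ^ lam ≤ 1 :=
    pow_le_one₀ (inv_pos.2 Real.goldenRatio_pos).le
      (inv_lt_one_of_one_lt₀ Real.one_lt_goldenRatio).le
  have key : ∀ c : ℝ, 0 ≤ zeckRep w + c → zeckRep w + c < Real.goldenRatio⁻¹ ^ lam →
      Int.fract (w * Real.goldenRatio + c) < Real.goldenRatio⁻¹ ^ lam := by
    intro c h1 h2
    have : Int.fract (w * Real.goldenRatio + c) = zeckRep w + c := by
      rw [Int.fract_eq_iff]
      exact ⟨h1, h2.trans_le ha1, -l, by rw [hl]; push_cast; ring⟩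
    rwa [this]
  rw [Nat.add_sub_cancel]
  refine key _ ?_ ?_ <;> rw [zeckRep] <;> split_ifs with hev
  · rw [hev.neg_one_pow] at hb; linarith [hb.2]
  · rw [(Nat.not_even_iff_odd.1 hev).neg_one_pow] at hb; linarith [hb.1]
  · rw [hev.neg_one_pow] at hb; linarith [hb.1]
  · rw [(Nat.not_even_iff_odd.1 hev).neg_one_pow] at hb; linarith [hb.2]

/-- The indicator function of the interval `[0, ℓ)` modulo `1`. -/
def arcInd (ℓ x : ℝ) : ℂ := if Int.fract x < ℓ then 1 else 0

theorem isStep_arcInd (ℓ : ℝ) : IsStep 2 (arcInd ℓ) := by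
  classical
  refine ⟨fun x => by simp only [arcInd, Int.fract_add_one], fun x => ?_, {0, ℓ},
    Finset.card_le_two, ?_⟩
  · rw [arcInd]; split_ifs <;> simp
  · intro x y hxy hz
    simp only [Finset.mem_insert, Finset.mem_singleton, not_or] at hz
    have hfl : ⌊x⌋ = ⌊y⌋ := by
      refine le_antisymm (Int.floor_mono hxy) ?_
      by_contra hlt
      rw [not_le] at hlt
      exact (hz ⌊y⌋ ⟨Int.floor_lt.1 hlt, Int.floor_le y⟩).1 (Int.fract_intCast _)
    have hx := Int.fract_add_floor x
    have hy := Int.fract_add_floor y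
    rw [hfl] at hx
    have : Int.fract x < ℓ ↔ Int.fract y < ℓ := by
      constructor
      · intro h
        by_contra h'
        rw [not_lt] at h'
        refine (hz (ℓ + ⌊y⌋) ⟨by linarith, by linarith⟩).2 ?_
        rw [Int.fract_add_intCast, Int.fract_eq_self]
        exact ⟨(Int.fract_nonneg x).trans h.le, h'.trans_lt (Int.fract_lt_one y)⟩
      · intro h; linarith
    simp only [arcInd, this]

theorem norm_integral_arcInd_le {ℓ : ℝ} (h0 : 0 ≤ ℓ) :
    ‖∫ x in (0 : ℝ)..1, arcInd ℓ x‖ ≤ ℓ := by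
  rw [intervalIntegral.integral_of_le zero_le_one, integral_Ioc_eq_integral_Ioo,
    setIntegral_congr_fun (g := (Set.Ico 0 ℓ).indicator (fun _ => (1 : ℂ))) measurableSet_Ioo]
  · rw [integral_indicator_const _ measurableSet_Ico, norm_smul, norm_one, mul_one,
      Real.norm_of_nonneg measureReal_nonneg]
    have : volume.restrict (Set.Ioo (0 : ℝ) 1) (Set.Ico 0 ℓ) ≤ ENNReal.ofReal ℓ := by
      refine (Measure.restrict_apply_le _ _).trans ?_
      rw [Real.volume_Ico, sub_zero]
    exact ENNReal.toReal_le_of_le_ofReal h0 this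
  · intro x hx
    have : Int.fract x = x := Int.fract_eq_self.2 ⟨hx.1.le, hx.2⟩
    simp only [arcInd, this, Set.indicator_apply, Set.mem_Ico, hx.1.le, true_and]

theorem IsStep.integral_dilate {K : ℕ} {H : ℝ → ℂ} (h : IsStep K H) {p : ℕ} (hp : 0 < p) :
    ∫ x in (0 : ℝ)..1, H (p * x) = ∫ x in (0 : ℝ)..1, H x := by
  have hp' : (p : ℝ) ≠ 0 := by exact_mod_cast hp.ne'
  rw [intervalIntegral.integral_comp_mul_left _ hp', mul_zero, mul_one]
  have : ∫ x in (0 : ℝ)..p, H x = p • ∫ x in (0 : ℝ)..1, H x := by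
    have := h.periodic.intervalIntegral_add_zsmul_eq p 0 (fun a b => h.intervalIntegrable a b)
    simpa using this
  rw [this, ← Nat.cast_smul_eq_nsmul ℝ, smul_smul, inv_mul_cancel₀ hp', one_smul]

open Classical in
/-- The number of multiples `mp` for which a carry beyond the digit `λ` can occur when `t` is
added. -/
theorem card_carry_le {lam a b k p t : ℕ} (hlam : 1 ≤ lam) (hab : a ≤ b) (hk : b - a < 2 ^ k)
    (hp : 0 < p) :
    ((((Finset.Ioc a b).filter
      (fun m => ∃ i ∈ Finset.Ioc 0 t, HighOnly lam (m * p + i))).card : ℕ) : ℝ) ≤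
      t * ((b - a : ℕ) / Nat.fib lam + 8 * p * k) := by
  obtain ⟨lam, rfl⟩ := Nat.exists_eq_add_of_le' hlam
  set c : ℝ := if Even (lam + 1) then Real.goldenRatio⁻¹ ^ (lam + 1 + 1) else
    Real.goldenRatio⁻¹ ^ (lam + 1) with hc
  set ℓ := Real.goldenRatio⁻¹ ^ lam with hℓ
  have hℓ0 : 0 < ℓ := inv_goldenRatio_pow_pos lam
  have hone : ∀ i : ℕ, ((((Finset.Ioc a b).filter
      (fun m => HighOnly (lam + 1) (m * p + i))).card : ℕ) : ℝ) ≤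
      (b - a : ℕ) / Nat.fib (lam + 1) + 8 * p * k := by
    intro i
    -- `HighOnly` puts (mp + i)φ into a short arc, so the number of such m is at most the sum along
    -- mφ of a dilated arc indicator, which has 2p jumps.
    have hG := (isStep_arcInd ℓ).translate (i * Real.goldenRatio + c)
    have hs := (hG.dilate hp).sum_Ioc hab hk
    rw [hG.integral_dilate hp, (isStep_arcInd ℓ).integral_translate] at hs
    have hint := norm_integral_arcInd_le hℓ0.le
    set I := ∫ x in (0 : ℝ)..1, arcInd ℓ x
    set s := ∑ m ∈ Finset.Ioc a b,
      arcInd ℓ (p * (m * Real.goldenRatio) + (i * Real.goldenRatio + c)) with hs_def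
    have hcard : ((((Finset.Ioc a b).filter
        (fun m => HighOnly (lam + 1) (m * p + i))).card : ℕ) : ℝ) ≤ ‖s‖ := by
      have : s = ((((Finset.Ioc a b).filter (fun m : ℕ => Int.fract
          (p * (m * Real.goldenRatio) + (i * Real.goldenRatio + c)) < ℓ)).card : ℕ) : ℂ) := by
        rw [hs_def]; simp only [arcInd]; rw [Finset.sum_boole]
      rw [this, Complex.norm_natCast]
      refine Nat.cast_le.2 (Finset.card_le_card fun m hm => ?_)
      rw [Finset.mem_filter] at hm ⊢
      refine ⟨hm.1, ?_⟩
      have := hm.2.fract_lt (by omega)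
      rw [Nat.add_sub_cancel, ← hc, ← hℓ] at this
      convert this using 2
      push_cast; ring
    have h1 : ‖((b - a : ℕ) : ℂ) * I‖ ≤ (b - a : ℕ) / Nat.fib (lam + 1) := by
      rw [norm_mul, Complex.norm_natCast, div_eq_mul_one_div]
      have := hint.trans (inv_goldenRatio_pow_le lam)
      gcongr
    have h2 : ‖s‖ ≤ ‖s - ((b - a : ℕ) : ℂ) * I‖ + ‖((b - a : ℕ) : ℂ) * I‖ := by
      simpa using norm_add_le (s - ((b - a : ℕ) : ℂ) * I) (((b - a : ℕ) : ℂ) * I)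
    have h3 : (4 : ℝ) * (p * 2 : ℕ) * k = 8 * p * k := by push_cast; ring
    rw [h3] at hs
    linarith
  have hsub : (Finset.Ioc a b).filter
      (fun m => ∃ i ∈ Finset.Ioc 0 t, HighOnly (lam + 1) (m * p + i)) ⊆
      (Finset.Ioc 0 t).biUnion (fun i => (Finset.Ioc a b).filter
        (fun m => HighOnly (lam + 1) (m * p + i))) := by
    intro m hm
    rw [Finset.mem_filter] at hm
    obtain ⟨hm, i, hi, hW⟩ := hm
    exact Finset.mem_biUnion.2 ⟨i, hi, Finset.mem_filter.2 ⟨hm, hW⟩⟩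
  calc _ ≤ (((Finset.Ioc 0 t).biUnion (fun i => (Finset.Ioc a b).filter
        (fun m => HighOnly (lam + 1) (m * p + i)))).card : ℝ) :=
        Nat.cast_le.2 (Finset.card_le_card hsub)
    _ ≤ ∑ i ∈ Finset.Ioc 0 t, (((Finset.Ioc a b).filter
        (fun m => HighOnly (lam + 1) (m * p + i))).card : ℝ) := by
        exact_mod_cast Finset.card_biUnion_le
    _ ≤ ∑ i ∈ Finset.Ioc 0 t, (((b - a : ℕ) : ℝ) / Nat.fib (lam + 1) + 8 * p * k) :=
        Finset.sum_le_sum fun i _ => hone i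
    _ = _ := by rw [Finset.sum_const, Nat.card_Ioc, nsmul_eq_mul]; simp

/-! ### From digit correlations to integrals. -/

/-- `e(ϑ s_z(n))`. -/
def zeckExp (ϑ : ℝ) (n : ℕ) : ℂ := e (ϑ * (zeckSum n : ℝ))

theorem norm_zeckExp (ϑ : ℝ) (n : ℕ) : ‖zeckExp ϑ n‖ = 1 := norm_e _

theorem zeckExp_add_mul_conj {lam n t : ℕ} (ϑ : ℝ)
    (h : ¬ ∃ i ∈ Finset.Ioc 0 t, HighOnly lam (n + i)) :
    zeckExp ϑ (n + t) * (starRingEnd ℂ) (zeckExp ϑ n) =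
      torusExp ϑ lam ((n + t : ℕ) * Real.goldenRatio) *
        (starRingEnd ℂ) (torusExp ϑ lam (n * Real.goldenRatio)) := by
  have hh := highSum_add lam n t fun i hi hW => h ⟨i, hi, hW⟩
  rw [torusExp_nat_mul, torusExp_nat_mul, zeckExp, zeckExp, conj_e, conj_e, ← e_add, ← e_add,
    ← lowSum_add_highSum lam, ← lowSum_add_highSum lam, hh]
  congr 1
  push_cast; ring

/-- The multiplicative derivative of `e(ϑ g_λ)`. -/
def torusDiff (ϑ : ℝ) (lam : ℕ) (h x : ℝ) : ℂ :=
  torusExp ϑ lam (x + h) * (starRingEnd ℂ) (torusExp ϑ lam x)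

theorem isStep_torusDiff (ϑ : ℝ) (lam : ℕ) (h : ℝ) :
    IsStep (2 * Nat.fib (lam + 1)) (torusDiff ϑ lam h) := by
  have := ((isStep_torusExp ϑ lam).translate h).mul (isStep_torusExp ϑ lam).conj
  rw [← two_mul] at this
  exact this

/-- The integral that governs the correlation of `e(ϑ s_z(pm))` and `e(ϑ s_z(qm))` after a shift
by `r`. -/
def corrIntegral (ϑ : ℝ) (lam p q r : ℕ) : ℂ :=
  ∫ x in (0 : ℝ)..1, torusDiff ϑ lam (r * p * Real.goldenRatio) (p * x) *
    (starRingEnd ℂ) (torusDiff ϑ lam (r * q * Real.goldenRatio) (q * x))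

/-- If neither multiple carries past λ, the digits above λ cancel and the summand is a step function
of mφ, to which equidistribution applies. An m with a carry costs at most 2 for each of p and q. -/
theorem norm_shifted_sum_le {ϑ : ℝ} {lam a b k p q r : ℕ} (hlam : 1 ≤ lam) (hab : a ≤ b)
    (hk : b - a < 2 ^ k) (hp : 0 < p) (hq : 0 < q) :
    ‖∑ m ∈ Finset.Ioc a b, (zeckExp ϑ ((m + r) * p) * (starRingEnd ℂ) (zeckExp ϑ ((m + r) * q))) *
        (starRingEnd ℂ) (zeckExp ϑ (m * p) * (starRingEnd ℂ) (zeckExp ϑ (m * q)))‖ ≤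
      (b - a : ℕ) * ‖corrIntegral ϑ lam p q r‖ + 8 * (p + q) * Nat.fib (lam + 1) * k +
        2 * (r * p * ((b - a : ℕ) / Nat.fib lam + 8 * p * k) +
          r * q * ((b - a : ℕ) / Nat.fib lam + 8 * q * k)) := by
  classical
  set H : ℝ → ℂ := fun x => torusDiff ϑ lam (r * p * Real.goldenRatio) (p * x) *
    (starRingEnd ℂ) (torusDiff ϑ lam (r * q * Real.goldenRatio) (q * x)) with hH
  have hHs : IsStep (p * (2 * Nat.fib (lam + 1)) + q * (2 * Nat.fib (lam + 1))) H :=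
    ((isStep_torusDiff ϑ lam _).dilate hp).mul ((isStep_torusDiff ϑ lam _).dilate hq).conj
  have hs := hHs.sum_Ioc hab hk
  have hK : (4 : ℝ) * (p * (2 * Nat.fib (lam + 1)) + q * (2 * Nat.fib (lam + 1)) : ℕ) * k =
    8 * (p + q) * Nat.fib (lam + 1) * k := by push_cast; ring
  rw [hK] at hs
  set B := fun p : ℕ => (Finset.Ioc a b).filter
    (fun m => ∃ i ∈ Finset.Ioc 0 (r * p), HighOnly lam (m * p + i)) with hB
  have hBp := card_carry_le (t := r * p) hlam hab hk hp
  have hBq := card_carry_le (t := r * q) hlam hab hk hq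
  rw [Nat.cast_mul] at hBp hBq
  set g : ℕ → ℂ := fun m =>
    (zeckExp ϑ ((m + r) * p) * (starRingEnd ℂ) (zeckExp ϑ ((m + r) * q))) *
        (starRingEnd ℂ) (zeckExp ϑ (m * p) * (starRingEnd ℂ) (zeckExp ϑ (m * q))) with hg
  have hterm : ∀ m ∈ Finset.Ioc a b, ‖g m - H (m * Real.goldenRatio)‖ ≤
      (if m ∈ B p then (2 : ℝ) else 0) + if m ∈ B q then (2 : ℝ) else 0 := by
    intro m hm
    by_cases hmB : m ∈ B p ∨ m ∈ B q
    · have : ‖g m - H (m * Real.goldenRatio)‖ ≤ 2 := by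
        refine (norm_sub_le _ _).trans ?_
        have h1 : ‖g m‖ = 1 := by simp only [hg, norm_mul, RCLike.norm_conj, norm_zeckExp, one_mul]
        linarith [hHs.norm_le (m * Real.goldenRatio)]
      refine this.trans ?_
      rcases hmB with h | h
      · rw [if_pos h]; split_ifs <;> norm_num
      · rw [if_pos h]; split_ifs <;> norm_num
    · rw [not_or] at hmB
      rw [if_neg hmB.1, if_neg hmB.2]
      have hpp : ∀ p : ℕ, m ∉ B p → zeckExp ϑ ((m + r) * p) * (starRingEnd ℂ) (zeckExp ϑ (m * p)) =
          torusDiff ϑ lam (r * p * Real.goldenRatio) (p * (m * Real.goldenRatio)) := by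
        intro p hmp
        have := zeckExp_add_mul_conj (n := m * p) (t := r * p) (lam := lam) ϑ
          (fun h => hmp (Finset.mem_filter.2 ⟨hm, h⟩))
        rw [add_mul, this, torusDiff]
        push_cast
        congr 2
        · ring
        · congr 1; ring
      have : g m = H (m * Real.goldenRatio) := by
        simp only [hH]
        rw [← hpp p hmB.1, ← hpp q hmB.2]
        simp only [hg, map_mul, Complex.conj_conj]; ring
      rw [this, sub_self, norm_zero, add_zero]
  have hdiff : ‖∑ m ∈ Finset.Ioc a b, g m - ∑ m ∈ Finset.Ioc a b, H (m * Real.goldenRatio)‖ ≤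
      2 * ((B p).card + (B q).card) := by
    rw [← Finset.sum_sub_distrib]
    refine (norm_sum_le _ _).trans ((Finset.sum_le_sum hterm).trans ?_)
    rw [Finset.sum_add_distrib, Finset.sum_ite_mem, Finset.sum_ite_mem, Finset.sum_const,
      Finset.sum_const, nsmul_eq_mul, nsmul_eq_mul]
    have : ∀ p, ((Finset.Ioc a b ∩ B p).card : ℝ) ≤ (B p).card := fun p =>
      Nat.cast_le.2 (Finset.card_le_card Finset.inter_subset_right)
    linarith [this p, this q]
  set I := ((b - a : ℕ) : ℂ) * ∫ x in (0 : ℝ)..1, H x with hI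
  have hIn : ‖I‖ = (b - a : ℕ) * ‖corrIntegral ϑ lam p q r‖ := by
    rw [hI, norm_mul, Complex.norm_natCast]; rfl
  set sg := ∑ m ∈ Finset.Ioc a b, g m
  set sH := ∑ m ∈ Finset.Ioc a b, H (m * Real.goldenRatio)
  have htri : ‖sg‖ ≤ ‖sg - sH‖ + ‖sH - I‖ + ‖I‖ := by
    have h1 : sg = (sg - sH) + (sH - I) + I := by ring
    calc ‖sg‖ = ‖(sg - sH) + (sH - I) + I‖ := by rw [← h1]
      _ ≤ _ := norm_add₃_le
  linarith

/-! ### Van der Corput's inequality. -/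

theorem sum_dist_le (c : ℕ → ℝ) (hc : ∀ r, 0 ≤ c r) {R i : ℕ} (hi : i < R) :
    ∑ i' ∈ Finset.range R, c (if i ≤ i' then i' - i else i - i') ≤
      c 0 + 2 * ∑ r ∈ Finset.Ico 1 R, c r := by
  classical
  have h1 : ∑ i' ∈ (Finset.range R).filter (fun i' => i ≤ i'), c (i' - i) ≤
      ∑ r ∈ Finset.range R, c r := by
    rw [← Finset.sum_image (f := c) (g := fun i' => i' - i)]
    · refine Finset.sum_le_sum_of_subset_of_nonneg ?_ fun _ _ _ => hc _
      intro r hr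
      simp only [Finset.mem_image, Finset.mem_filter, Finset.mem_range] at hr ⊢
      omega
    · intro x hx y hy hxy
      simp only [Finset.coe_filter, Finset.mem_range, Set.mem_ofPred_eq] at hx hy hxy
      omega
  have h2 : ∑ i' ∈ (Finset.range R).filter (fun i' => ¬ i ≤ i'), c (i - i') ≤
      ∑ r ∈ Finset.Ico 1 R, c r := by
    rw [← Finset.sum_image (f := c) (g := fun i' => i - i')]
    · refine Finset.sum_le_sum_of_subset_of_nonneg ?_ fun _ _ _ => hc _
      intro r hr
      simp only [Finset.mem_image, Finset.mem_filter, Finset.mem_range, Finset.mem_Ico] at hr ⊢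
      omega
    · intro x hx y hy hxy
      simp only [Finset.coe_filter, Finset.mem_range, Set.mem_ofPred_eq] at hx hy hxy
      omega
  have h3 : ∑ r ∈ Finset.range R, c r = c 0 + ∑ r ∈ Finset.Ico 1 R, c r := by
    rw [Finset.range_eq_Ico, Finset.sum_eq_sum_Ico_succ_bot (by omega)]
  rw [← Finset.sum_filter_add_sum_filter_not _ (fun i' => i ≤ i')]
  rw [Finset.sum_congr rfl fun x hx => by rw [if_pos (Finset.mem_filter.1 hx).2],
    Finset.sum_congr (s₁ := (Finset.range R).filter (fun i' => ¬ i ≤ i')) rfl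
      fun x hx => by rw [if_neg (Finset.mem_filter.1 hx).2]]
  linarith

/-- Van der Corput's inequality. -/
theorem van_der_corput (g : ℕ → ℂ) (hg : ∀ m, ‖g m‖ ≤ 1) {a b R : ℕ} (hab : a ≤ b) (hR : 0 < R) :
    ‖∑ m ∈ Finset.Ioc a b, g m‖ ^ 2 ≤ ((b - a : ℕ) + R) / R *
      ((b - a : ℕ) + 2 * ∑ r ∈ Finset.Ico 1 R,
        ‖∑ m ∈ Finset.Ioc a (b - r), g (m + r) * (starRingEnd ℂ) (g m)‖) := by
  classical
  -- `G i` is the cut-off g translated by i. Each of the R translates has the same total over `X`,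
  -- so R times the sum is a sum over `X` of inner sums over i, and Cauchy–Schwarz over `X` produces
  -- the correlations `C`.
  set G : ℕ → ℕ → ℂ := fun i n => if i ≤ n ∧ n - i ∈ Finset.Ioc a b then g (n - i) else 0 with hG
  set X := Finset.Ioc a (b + R) with hX
  set S := ∑ m ∈ Finset.Ioc a b, g m with hS
  set C : ℕ → ℂ := fun r => ∑ m ∈ Finset.Ioc a (b - r), g (m + r) * (starRingEnd ℂ) (g m) with hC
  have hsum : ∀ i ∈ Finset.range R, ∑ n ∈ X, G i n = S := by
    intro i hi
    rw [Finset.mem_range] at hi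
    simp only [hG]
    rw [← Finset.sum_filter, hS]
    symm
    refine Finset.sum_bij (fun m _ => m + i) ?_ ?_ ?_ ?_
    · intro m hm
      simp only [hX, Finset.mem_filter, Finset.mem_Ioc] at hm ⊢; omega
    · intro x _ y _ h; omega
    · intro n hn
      simp only [hX, Finset.mem_filter, Finset.mem_Ioc] at hn
      exact ⟨n - i, Finset.mem_Ioc.2 hn.2.2, by omega⟩
    · intro m _; rw [Nat.add_sub_cancel]
  have hT : ∀ i < R, ∀ i' < R, i ≤ i' → ∑ n ∈ X, G i n * (starRingEnd ℂ) (G i' n) = C (i' - i) := by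
    intro i hi i' hi' hle
    have : ∀ n, G i n * (starRingEnd ℂ) (G i' n) =
        if i' ≤ n ∧ n - i' ∈ Finset.Ioc a b ∧ n - i ∈ Finset.Ioc a b then
          g (n - i) * (starRingEnd ℂ) (g (n - i')) else 0 := by
      intro n
      simp only [hG]
      by_cases h1 : i ≤ n ∧ n - i ∈ Finset.Ioc a b <;>
        by_cases h2 : i' ≤ n ∧ n - i' ∈ Finset.Ioc a b
      · rw [if_pos h1, if_pos h2, if_pos ⟨h2.1, h2.2, h1.2⟩]
      · rw [if_neg h2, map_zero, mul_zero, if_neg fun h => h2 ⟨h.1, h.2.1⟩]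
      · rw [if_neg h1, zero_mul, if_neg fun h => h1 ⟨hle.trans h.1, h.2.2⟩]
      · rw [if_neg h1, zero_mul, if_neg fun h => h1 ⟨hle.trans h.1, h.2.2⟩]
    simp only [this]
    rw [← Finset.sum_filter, hC]
    symm
    refine Finset.sum_bij (fun m _ => m + i') ?_ ?_ ?_ ?_
    · intro m hm
      simp only [hX, Finset.mem_filter, Finset.mem_Ioc] at hm ⊢; omega
    · intro x _ y _ h; omega
    · intro n hn
      simp only [hX, Finset.mem_filter, Finset.mem_Ioc] at hn
      exact ⟨n - i', Finset.mem_Ioc.2 (by omega), by omega⟩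
    · intro m _
      rw [Nat.add_sub_cancel, show m + i' - i = m + (i' - i) by omega]
  have hTn : ∀ i < R, ∀ i' < R, ‖∑ n ∈ X, G i n * (starRingEnd ℂ) (G i' n)‖ =
      ‖C (if i ≤ i' then i' - i else i - i')‖ := by
    intro i hi i' hi'
    split_ifs with h
    · rw [hT i hi i' hi' h]
    · rw [← hT i' hi' i hi (by omega), ← RCLike.norm_conj, map_sum]
      simp only [map_mul, Complex.conj_conj, mul_comm]
  have hC0 : ‖C 0‖ ≤ (b - a : ℕ) := by
    refine (norm_sum_le _ _).trans ?_
    refine (Finset.sum_le_card_nsmul _ _ 1 fun m _ => ?_).trans_eq (by simp)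
    rw [norm_mul, RCLike.norm_conj]
    exact mul_le_one₀ (hg _) (norm_nonneg _) (hg _)
  have hsq : ∑ n ∈ X, ‖∑ i ∈ Finset.range R, G i n‖ ^ 2 ≤
      R * ((b - a : ℕ) + 2 * ∑ r ∈ Finset.Ico 1 R, ‖C r‖) := by
    have e : ((∑ n ∈ X, ‖∑ i ∈ Finset.range R, G i n‖ ^ 2 : ℝ) : ℂ) =
        ∑ i ∈ Finset.range R, ∑ i' ∈ Finset.range R,
          ∑ n ∈ X, G i n * (starRingEnd ℂ) (G i' n) := by
      push_cast
      simp only [← Complex.mul_conj', map_sum, Finset.sum_mul_sum]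
      rw [Finset.sum_comm]
      exact Finset.sum_congr rfl fun i _ => Finset.sum_comm
    have hnn : 0 ≤ ∑ n ∈ X, ‖∑ i ∈ Finset.range R, G i n‖ ^ 2 := by positivity
    rw [← Real.norm_of_nonneg hnn, ← Complex.norm_real, e]
    refine (norm_sum_le _ _).trans ?_
    have : ∀ i ∈ Finset.range R, ‖∑ i' ∈ Finset.range R,
        ∑ n ∈ X, G i n * (starRingEnd ℂ) (G i' n)‖ ≤
        (b - a : ℕ) + 2 * ∑ r ∈ Finset.Ico 1 R, ‖C r‖ := by
      intro i hi
      rw [Finset.mem_range] at hi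
      refine (norm_sum_le _ _).trans ?_
      rw [Finset.sum_congr rfl fun i' hi' => hTn i hi i' (Finset.mem_range.1 hi')]
      refine (sum_dist_le (fun r => ‖C r‖) (fun r => norm_nonneg _) hi).trans ?_
      linarith
    refine (Finset.sum_le_card_nsmul _ _ _ this).trans_eq ?_
    rw [Finset.card_range, nsmul_eq_mul]
  have hRS : (R : ℂ) * S = ∑ n ∈ X, ∑ i ∈ Finset.range R, G i n := by
    rw [Finset.sum_comm, Finset.sum_congr rfl hsum, Finset.sum_const, Finset.card_range,
      nsmul_eq_mul]
  have hcs : (R * ‖S‖) ^ 2 ≤ ((b - a : ℕ) + R) * ∑ n ∈ X, ‖∑ i ∈ Finset.range R, G i n‖ ^ 2 := by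
    have h1 : R * ‖S‖ ≤ ∑ n ∈ X, ‖∑ i ∈ Finset.range R, G i n‖ := by
      rw [← Complex.norm_natCast, ← norm_mul, hRS]
      exact norm_sum_le _ _
    have h2 : (R * ‖S‖) ^ 2 ≤ (∑ n ∈ X, ‖∑ i ∈ Finset.range R, G i n‖) ^ 2 :=
      pow_le_pow_left₀ (by positivity) h1 2
    refine h2.trans (sq_sum_le_card_mul_sum_sq.trans_eq ?_)
    rw [hX, Nat.card_Ioc, show b + R - a = b - a + R by omega]
    push_cast; rfl
  have hR' : (0 : ℝ) < R := by exact_mod_cast hR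
  have hfin : (R : ℝ) ^ 2 * ‖S‖ ^ 2 ≤ ((b - a : ℕ) + R) *
      (R * ((b - a : ℕ) + 2 * ∑ r ∈ Finset.Ico 1 R, ‖C r‖)) := by
    rw [← mul_pow]
    exact hcs.trans (by gcongr)
  have : ((b - a : ℕ) + (R : ℝ)) / R * ((b - a : ℕ) + 2 * ∑ r ∈ Finset.Ico 1 R, ‖C r‖) =
      (((b - a : ℕ) + R) * (R * ((b - a : ℕ) + 2 * ∑ r ∈ Finset.Ico 1 R, ‖C r‖))) / R ^ 2 := by
    field_simp
  rw [this, le_div_iff₀ (by positivity)]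
  linarith

/-! ### The U³ norm and the autocorrelation. -/

/-- Lebesgue measure on the unit interval. -/
abbrev unitMeas : Measure ℝ := volume.restrict (Set.Icc (0 : ℝ) 1)

instance isProbabilityMeasure_unitMeas : IsProbabilityMeasure unitMeas :=
  ⟨by simp [unitMeas]⟩

theorem integral_unitMeas {E : Type*} [NormedAddCommGroup E] [NormedSpace ℝ E] (f : ℝ → E) :
    ∫ x, f x ∂unitMeas = ∫ x in (0 : ℝ)..1, f x := by
  rw [intervalIntegral.integral_of_le zero_le_one, ← integral_Icc_eq_integral_Ioc]

theorem integral_unitMeas_shift {E : Type*} [NormedAddCommGroup E] [NormedSpace ℝ E] {f : ℝ → E}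
    (hf : Function.Periodic f 1) (a : ℝ) :
    ∫ x, f (x + a) ∂unitMeas = ∫ x, f x ∂unitMeas := by
  rw [integral_unitMeas, integral_unitMeas, intervalIntegral.integral_comp_add_right, zero_add,
    add_comm 1 a]
  simpa using hf.intervalIntegral_add_eq a 0

theorem integrable_of_norm_le_one {α : Type*} [MeasurableSpace α] {μ : Measure α}
    [IsFiniteMeasure μ] {f : α → ℂ} (hf : StronglyMeasurable f) (h1 : ∀ x, ‖f x‖ ≤ 1) :
    Integrable f μ :=
  Integrable.of_bound hf.aestronglyMeasurable 1 (Eventually.of_forall h1)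

theorem norm_integral_le_one_of_norm_le_one {α : Type*} [MeasurableSpace α] {μ : Measure α}
    [IsProbabilityMeasure μ] {f : α → ℂ} (h1 : ∀ x, ‖f x‖ ≤ 1) : ‖∫ x, f x ∂μ‖ ≤ 1 := by
  simpa using norm_integral_le_of_norm_le_const (μ := μ) (Eventually.of_forall h1)

theorem sq_norm_integral_le {α : Type*} [MeasurableSpace α] {μ : Measure α}
    [IsProbabilityMeasure μ] {f : α → ℂ} (hf : StronglyMeasurable f) (h1 : ∀ x, ‖f x‖ ≤ 1) :
    ‖∫ x, f x ∂μ‖ ^ 2 ≤ ∫ x, ‖f x‖ ^ 2 ∂μ := by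
  have h := (Even.convexOn_pow (𝕜 := ℝ) even_two).map_integral_le (μ := μ)
    (f := fun x => ‖f x‖) (continuous_pow 2).continuousOn isClosed_univ (by simp)
    (integrable_of_norm_le_one hf h1).norm
    (Integrable.of_bound (hf.norm.pow 2).aestronglyMeasurable 1
      (Eventually.of_forall fun x => by
        simp only [Function.comp, norm_pow, norm_norm]
        exact pow_le_one₀ (norm_nonneg _) (h1 x)))
  exact (pow_le_pow_left₀ (norm_nonneg _) (norm_integral_le_integral_norm f) 2).trans h

theorem integral_pi_succ {n : ℕ} (μ : Measure ℝ) [IsFiniteMeasure μ] {f : (Fin (n + 1) → ℝ) → ℂ}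
    (hf : Measurable f) (h1 : ∀ x, ‖f x‖ ≤ 1) :
    ∫ y, f y ∂(Measure.pi fun _ : Fin (n + 1) => μ) =
      ∫ a, ∫ y, f (Fin.cons a y) ∂(Measure.pi fun _ : Fin n => μ) ∂μ := by
  have hmp := (measurePreserving_piFinSuccAbove (fun _ : Fin (n + 1) => μ) 0).symm
  rw [← hmp.integral_comp' (g := f), integral_prod]
  · have : ∀ (a : ℝ) (y : Fin n → ℝ),
        (MeasurableEquiv.piFinSuccAbove (fun _ : Fin (n + 1) => ℝ) 0).symm (a, y) = Fin.cons a y :=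
      fun a y => Fin.insertNth_zero' a y
    simp only [this]
  · refine integrable_of_norm_le_one ?_ fun x => h1 _
    exact (hf.comp (MeasurableEquiv.measurable _)).stronglyMeasurable

theorem integral_pi_three (μ : Measure ℝ) [IsFiniteMeasure μ] {f : (Fin 3 → ℝ) → ℂ}
    (hf : Measurable f) (h1 : ∀ x, ‖f x‖ ≤ 1) :
    ∫ y, f y ∂(Measure.pi fun _ : Fin 3 => μ) = ∫ a, ∫ b, ∫ c, f ![a, b, c] ∂μ ∂μ ∂μ := by
  have hcons : ∀ (n : ℕ) (a : ℝ), Measurable fun y : Fin n → ℝ => (Fin.cons a y : Fin (n + 1) → ℝ) := by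
    intro n a
    rw [measurable_pi_iff]
    intro i
    refine Fin.cases ?_ (fun i => ?_) i
    · simp
    · simpa using measurable_pi_apply i
  rw [integral_pi_succ μ hf h1]
  refine integral_congr_ae (Eventually.of_forall fun a => ?_)
  simp only
  rw [integral_pi_succ μ (f := fun y => f (Fin.cons a y)) (hf.comp (hcons 2 a)) fun x => h1 _]
  refine integral_congr_ae (Eventually.of_forall fun b => ?_)
  simp only
  rw [integral_pi_succ μ (f := fun y => f (Fin.cons a (Fin.cons b y)))
    ((hf.comp (hcons 2 a)).comp (hcons 1 b)) fun x => h1 _]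
  refine integral_congr_ae (Eventually.of_forall fun c => ?_)
  simp only
  rw [Measure.pi_of_empty, integral_dirac]
  congr 1

theorem prod_cube (g : (Fin 3 → Fin 2) → ℂ) : ∏ ω, g ω = g ![0, 0, 0] * g ![1, 0, 0] *
    g ![0, 1, 0] * g ![1, 1, 0] * g ![0, 0, 1] * g ![1, 0, 1] * g ![0, 1, 1] * g ![1, 1, 1] := by
  have : (Finset.univ : Finset (Fin 3 → Fin 2)) = {![0, 0, 0], ![1, 0, 0], ![0, 1, 0], ![1, 1, 0],
    ![0, 0, 1], ![1, 0, 1], ![0, 1, 1], ![1, 1, 1]} := by decide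
  rw [this]
  simp [Finset.prod_insert, mul_assoc]

/-- The autocorrelation of a function on the torus. -/
def autoCorr (F : ℝ → ℂ) (h : ℝ) : ℂ := ∫ x in (0 : ℝ)..1, F (x + h) * (starRingEnd ℂ) (F x)

/-- Pairs the eight factors along the direction a: they become values of the single derivative u ↦
F(u + a) conj F(u) at the corners of the square spanned by b and c. -/
theorem gowersIntegral_three_eq {F : ℝ → ℂ} (hF : Measurable F) (h1 : ∀ x, ‖F x‖ ≤ 1) :
    gowersIntegral 3 F = ∫ x, ∫ a, ∫ b, ∫ c,
      (starRingEnd ℂ) (F (x + a) * (starRingEnd ℂ) (F x)) *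
        (F (x + b + a) * (starRingEnd ℂ) (F (x + b))) *
        ((F (x + c + a) * (starRingEnd ℂ) (F (x + c))) *
        (starRingEnd ℂ) (F (x + b + c + a) * (starRingEnd ℂ) (F (x + b + c))))
      ∂unitMeas ∂unitMeas ∂unitMeas ∂unitMeas := by
  have hpi : (volume : Measure (Fin 3 → ℝ)).restrict (Set.Icc 0 1) =
      Measure.pi fun _ : Fin 3 => unitMeas := by
    rw [volume_pi, ← Measure.restrict_pi_pi]
    congr 1
    ext y; simp [Set.mem_Icc, Pi.le_def]
  rw [gowersIntegral, hpi]
  refine integral_congr_ae (Eventually.of_forall fun x => ?_)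
  have hit : ∀ (n : ℕ) (z : ℂ), ‖(⇑(starRingEnd ℂ))^[n] z‖ = ‖z‖ := by
    intro n z
    induction n with
    | zero => rfl
    | succ n ih => rw [Function.iterate_succ_apply', RCLike.norm_conj, ih]
  have hitm : ∀ n : ℕ, Measurable ((⇑(starRingEnd ℂ))^[n]) := fun n =>
    (Complex.continuous_conj.iterate n).measurable
  simp only
  rw [integral_pi_three]
  · refine integral_congr_ae (Eventually.of_forall fun a => ?_)
    refine integral_congr_ae (Eventually.of_forall fun b => ?_)
    refine integral_congr_ae (Eventually.of_forall fun c => ?_)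
    simp only [prod_cube, Fin.sum_univ_three]
    simp [← add_assoc]
    rw [add_right_comm x b a, add_right_comm x c a, add_right_comm (x + b) c a,
      add_right_comm x b a]
    ring
  · refine Finset.measurable_prod _ fun ω _ => (hitm _).comp (hF.comp ?_)
    fun_prop
  · intro y
    rw [norm_prod]
    refine Finset.prod_le_one (fun _ _ => norm_nonneg _) fun ω _ => ?_
    rw [hit]; exact h1 _

/-- The fourth moment of the autocorrelation is at most the eighth power of the `U³` norm. -/
theorem integral_autoCorr_pow_four_le {F : ℝ → ℂ} (hF : Measurable F) (h1 : ∀ x, ‖F x‖ ≤ 1)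
    (hper : Function.Periodic F 1) :
    ∫ h in (0 : ℝ)..1, ‖autoCorr F h‖ ^ 4 ≤ ‖gowersIntegral 3 F‖ := by
  set G : ℝ → ℝ → ℂ := fun a x => F (x + a) * (starRingEnd ℂ) (F x) with hG
  have hconj : Measurable (starRingEnd ℂ) := Complex.continuous_conj.measurable
  have hGm : Measurable fun z : ℝ × ℝ => G z.1 z.2 := by
    simp only [hG]
    exact (hF.comp (measurable_snd.add measurable_fst)).mul
      (hconj.comp (hF.comp measurable_snd))
  have hGc : ∀ {α : Type} [MeasurableSpace α] (u v : α → ℝ), Measurable u → Measurable v →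
      Measurable fun z => G (u z) (v z) := fun u v hu hv => hGm.comp (hu.prodMk hv)
  have hG1 : ∀ a x, ‖G a x‖ ≤ 1 := fun a x => by
    rw [hG, norm_mul, RCLike.norm_conj]
    exact mul_le_one₀ (h1 _) (norm_nonneg _) (h1 _)
  have hGper : ∀ a, Function.Periodic (G a) 1 := fun a x => by
    simp only [hG]; rw [hper x, add_right_comm, hper]
  -- `A a b` is the autocorrelation at b of the derivative `G a`. The U³ integral is ∫∫ |A a b|² db
  -- da, whereas ∫ A a b db = |autoCorr F a|², so Cauchy–Schwarz in b gives the inequality.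
  set A : ℝ → ℝ → ℂ := fun a b => ∫ x, G a (x + b) * (starRingEnd ℂ) (G a x) ∂unitMeas with hA
  have hGG1 : ∀ a x y, ‖G a x * (starRingEnd ℂ) (G a y)‖ ≤ 1 := fun a x y => by
    rw [norm_mul, RCLike.norm_conj]
    exact mul_le_one₀ (hG1 _ _) (norm_nonneg _) (hG1 _ _)
  have hA1 : ∀ a b, ‖A a b‖ ≤ 1 := fun a b => norm_integral_le_one_of_norm_le_one fun x => hGG1 _ _ _
  have hAm : StronglyMeasurable fun z : ℝ × ℝ => A z.1 z.2 := by
    refine StronglyMeasurable.integral_prod_right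
      (f := fun (z : ℝ × ℝ) (x : ℝ) => G z.1 (x + z.2) * (starRingEnd ℂ) (G z.1 x)) ?_
    refine Measurable.stronglyMeasurable ?_
    exact (hGc (fun w : (ℝ × ℝ) × ℝ => w.1.1) (fun w => w.2 + w.1.2) (by fun_prop)
      (by fun_prop)).mul (hconj.comp (hGc (fun w : (ℝ × ℝ) × ℝ => w.1.1) (fun w => w.2)
        (by fun_prop) (by fun_prop)))
  set T : ℝ → ℝ → ℝ → ℂ := fun a b x =>
    (starRingEnd ℂ) (G a x) * G a (x + b) * (starRingEnd ℂ) (A a b) with hT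
  have hT1 : ∀ a b x, ‖T a b x‖ ≤ 1 := fun a b x => by
    rw [hT, norm_mul, norm_mul, RCLike.norm_conj, RCLike.norm_conj]
    exact mul_le_one₀ (mul_le_one₀ (hG1 _ _) (norm_nonneg _) (hG1 _ _)) (norm_nonneg _) (hA1 _ _)
  have hTm : Measurable fun w : (ℝ × ℝ) × ℝ => T w.1.1 w.1.2 w.2 := by
    refine ((hconj.comp (hGc (fun w : (ℝ × ℝ) × ℝ => w.1.1) (fun w => w.2)
        (by fun_prop) (by fun_prop))).mul (hGc (fun w : (ℝ × ℝ) × ℝ => w.1.1)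
        (fun w => w.2 + w.1.2) (by fun_prop) (by fun_prop))).mul
        (hconj.comp (hAm.measurable.comp measurable_fst))
  have e1 : gowersIntegral 3 F = ∫ x, ∫ a, ∫ b, T a b x ∂unitMeas ∂unitMeas ∂unitMeas := by
    rw [gowersIntegral_three_eq hF h1]
    refine integral_congr_ae (Eventually.of_forall fun x => ?_)
    refine integral_congr_ae (Eventually.of_forall fun a => ?_)
    refine integral_congr_ae (Eventually.of_forall fun b => ?_)
    simp only
    rw [integral_const_mul]
    simp only [hT, hG]
    congr 1
    have : ∀ c : ℝ, F (x + c + a) * (starRingEnd ℂ) (F (x + c)) *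
        (starRingEnd ℂ) (F (x + b + c + a) * (starRingEnd ℂ) (F (x + b + c))) =
        (fun u => G a u * (starRingEnd ℂ) (G a (u + b))) (c + x) := by
      intro c
      simp only [hG]
      rw [add_comm c x, add_right_comm x b c]
    simp only [this]
    rw [integral_unitMeas_shift (f := fun u => G a u * (starRingEnd ℂ) (G a (u + b)))
      (fun u => by simp only; rw [hGper a u, add_right_comm, hGper a])]
    simp only [hA]
    rw [← integral_conj]
    simp only [map_mul, Complex.conj_conj, hG]
    congr 1; ext u; ring
  have e2 : gowersIntegral 3 F = ∫ a, ∫ b, ((‖A a b‖ ^ 2 : ℝ) : ℂ) ∂unitMeas ∂unitMeas := by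
    rw [e1, integral_integral_swap]
    · refine integral_congr_ae (Eventually.of_forall fun a => ?_)
      simp only
      rw [integral_integral_swap]
      · refine integral_congr_ae (Eventually.of_forall fun b => ?_)
        simp only [hT]
        rw [integral_mul_const]
        push_cast
        rw [← Complex.mul_conj']
        congr 1
        simp only [hA]
        congr 1; ext x; ring
      · refine integrable_of_norm_le_one (Measurable.stronglyMeasurable ?_) fun z => hT1 _ _ _
        exact hTm.comp (f := fun z : ℝ × ℝ => ((a, z.2), z.1)) (by fun_prop)
    · refine integrable_of_norm_le_one ?_ fun z => norm_integral_le_one_of_norm_le_one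
        fun b => hT1 _ _ _
      refine StronglyMeasurable.integral_prod_right
        (f := fun (z : ℝ × ℝ) (b : ℝ) => T z.2 b z.1) (Measurable.stronglyMeasurable ?_)
      exact hTm.comp (f := fun w : (ℝ × ℝ) × ℝ => ((w.1.2, w.2), w.1.1)) (by fun_prop)
  have e3 : ∀ a, ∫ b, A a b ∂unitMeas = ((‖autoCorr F a‖ ^ 2 : ℝ) : ℂ) := by
    intro a
    simp only [hA]
    rw [integral_integral_swap]
    · have : ∀ x, ∫ b, G a (x + b) * (starRingEnd ℂ) (G a x) ∂unitMeas =
          (∫ b, G a b ∂unitMeas) * (starRingEnd ℂ) (G a x) := by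
        intro x
        rw [integral_mul_const]
        congr 1
        simp only [add_comm x]
        exact integral_unitMeas_shift (hGper a) x
      simp only [this]
      rw [integral_const_mul, integral_conj, Complex.mul_conj', autoCorr, ← integral_unitMeas]
      push_cast; rfl
    · refine integrable_of_norm_le_one (Measurable.stronglyMeasurable ?_) fun z => hGG1 _ _ _
      exact (hGc (fun _ : ℝ × ℝ => a) (fun w => w.2 + w.1) (by fun_prop) (by fun_prop)).mul
        (hconj.comp (hGc (fun _ : ℝ × ℝ => a) (fun w => w.2) (by fun_prop) (by fun_prop)))
  have hAa : ∀ a, StronglyMeasurable (A a) := fun a =>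
    (hAm.measurable.comp (measurable_const.prodMk measurable_id)).stronglyMeasurable
  have e4 : gowersIntegral 3 F = ((∫ a, ∫ b, ‖A a b‖ ^ 2 ∂unitMeas ∂unitMeas : ℝ) : ℂ) := by
    rw [e2, ← integral_complex_ofReal]
    congr 1; ext a
    exact integral_complex_ofReal
  have hle : ∀ a, ‖autoCorr F a‖ ^ 4 ≤ ∫ b, ‖A a b‖ ^ 2 ∂unitMeas := by
    intro a
    have := sq_norm_integral_le (μ := unitMeas) (hAa a) (hA1 a)
    rw [e3 a, Complex.norm_real, Real.norm_of_nonneg (by positivity), ← pow_mul] at this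
    exact this
  have hsqm : StronglyMeasurable fun a => ∫ b, ‖A a b‖ ^ 2 ∂unitMeas :=
    StronglyMeasurable.integral_prod_right (f := fun a b => ‖A a b‖ ^ 2) (hAm.norm.pow 2)
  have hsq1 : ∀ a, ‖∫ b, ‖A a b‖ ^ 2 ∂unitMeas‖ ≤ 1 := fun a => by
    simpa using norm_integral_le_of_norm_le_const (μ := unitMeas) (C := 1)
      (f := fun b => ‖A a b‖ ^ 2) (Eventually.of_forall fun b => by
        rw [norm_pow, norm_norm]; exact pow_le_one₀ (norm_nonneg _) (hA1 a b))
  rw [← integral_unitMeas, e4, Complex.norm_real]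
  refine le_trans ?_ (le_abs_self _)
  exact integral_mono_of_nonneg (Eventually.of_forall fun a => by positivity)
    (Integrable.of_bound hsqm.aestronglyMeasurable 1 (Eventually.of_forall hsq1))
    (Eventually.of_forall hle)

/-! ### The divisor bound. -/

theorem exists_add_one_pow_le_mul_two_pow (k : ℕ) : ∃ C : ℕ, 1 ≤ C ∧ ∀ a : ℕ, (a + 1) ^ k ≤ C * 2 ^ a := by
  obtain ⟨B, hB⟩ := (tendsto_pow_const_div_const_pow_of_one_lt k
    (one_lt_two (α := ℝ))).bddAbove_range
  refine ⟨2 * ⌈B⌉₊ + 1, by omega, fun a => ?_⟩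
  have h := hB ⟨a + 1, rfl⟩
  simp only at h
  rw [div_le_iff₀ (by positivity), pow_succ] at h
  have h2 : ((a + 1 : ℕ) : ℝ) ^ k ≤ (2 * ⌈B⌉₊ + 1) * 2 ^ a := by
    refine h.trans ?_
    have := Nat.le_ceil B
    have hp : (0 : ℝ) < 2 ^ a := by positivity
    nlinarith
  exact_mod_cast h2

/-- The divisor bound. -/
theorem exists_card_divisors_pow_le (k : ℕ) :
    ∃ C : ℕ, 1 ≤ C ∧ ∀ n : ℕ, n ≠ 0 → n.divisors.card ^ k ≤ C * n := by
  obtain ⟨C, hC1, hC⟩ := exists_add_one_pow_le_mul_two_pow k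
  -- Only primes below 2^k cost a factor C; for larger p one has (a + 1)^k ≤ 2^{ak} ≤ p^a.
  have key : ∀ n : ℕ, n ≠ 0 →
      n.divisors.card ^ k ≤ C ^ (n.primeFactors.filter (· < 2 ^ k)).card * n := by
    intro n
    induction n using Nat.recOnPosPrimePosCoprime with
    | prime_pow p a hp ha =>
      intro _
      rw [Nat.divisors_prime_pow hp, Finset.card_map, Finset.card_range,
        Nat.primeFactors_prime_pow ha.ne' hp, Finset.filter_singleton]
      split_ifs with h
      · rw [Finset.card_singleton, pow_one]
        exact (hC a).trans (Nat.mul_le_mul_left _ (Nat.pow_le_pow_left hp.two_le a))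
      · rw [Finset.card_empty, pow_zero, one_mul]
        calc (a + 1) ^ k ≤ (2 ^ a) ^ k := Nat.pow_le_pow_left (Nat.lt_two_pow_self) k
          _ = (2 ^ k) ^ a := by rw [← pow_mul, ← pow_mul, mul_comm]
          _ ≤ p ^ a := Nat.pow_le_pow_left (not_lt.1 h) a
    | zero => intro h; exact absurd rfl h
    | one => intro _; simp
    | coprime a b ha hb hab iha ihb =>
      intro _
      rw [hab.card_divisors_mul, hab.primeFactors_mul, Finset.filter_union,
        Finset.card_union_of_disjoint, mul_pow, pow_add]
      · calc _ ≤ _ := Nat.mul_le_mul (iha (by omega)) (ihb (by omega))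
          _ = _ := by ring
      · exact Finset.disjoint_filter_filter hab.disjoint_primeFactors
  refine ⟨C ^ (2 ^ k), Nat.one_le_pow _ _ hC1, fun n hn => (key n hn).trans ?_⟩
  refine Nat.mul_le_mul_right _ (Nat.pow_le_pow_right hC1 ?_)
  calc _ ≤ (Finset.range (2 ^ k)).card := Finset.card_le_card fun p hp => by
        simpa using (Finset.mem_filter.1 hp).2
    _ = _ := Finset.card_range _

/-! ### Fourier coefficients of step functions and of dilates. -/

/-- The Fourier coefficients of a `1`-periodic function. -/
def torusCoeff (v : ℝ → ℂ) (n : ℤ) : ℂ := ∫ x in (0 : ℝ)..1, e (-(n * x)) * v x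

instance fact_zero_lt_one_real : Fact ((0 : ℝ) < 1) := ⟨zero_lt_one⟩

theorem memLp_unit {v : ℝ → ℂ} (hv : Measurable v) (h1 : ∀ x, ‖v x‖ ≤ 1) :
    MemLp v 2 (volume.restrict (Set.Ioc (0 : ℝ) (0 + 1))) :=
  MemLp.of_bound hv.aestronglyMeasurable 1 (Eventually.of_forall h1)

theorem fourierCoeff_liftIoc_eq_torusCoeff (v : ℝ → ℂ) (n : ℤ) :
    fourierCoeff (AddCircle.liftIoc 1 0 v) n = torusCoeff v n := by
  rw [fourierCoeff_eq_intervalIntegral _ n 0, torusCoeff, zero_add, div_one, one_smul]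
  refine intervalIntegral.integral_congr_ae (Eventually.of_forall fun x hx => ?_)
  rw [Set.uIoc_of_le zero_le_one] at hx
  rw [AddCircle.liftIoc_coe_apply (by simpa using hx), fourier_coe_apply, smul_eq_mul, e]
  congr 2
  push_cast; ring

/-- Parseval's identity, transported from the circle with normalised Haar measure. -/
theorem hasSum_torusCoeff {u v : ℝ → ℂ} (hu : Measurable u) (hu1 : ∀ x, ‖u x‖ ≤ 1)
    (hv : Measurable v) (hv1 : ∀ x, ‖v x‖ ≤ 1) :
    HasSum (fun n => (starRingEnd ℂ) (torusCoeff u n) * torusCoeff v n)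
      (∫ x in (0 : ℝ)..1, (starRingEnd ℂ) (u x) * v x) := by
  have hU := (memLp_unit hu hu1).memLp_liftIoc.haarAddCircle
  have hV := (memLp_unit hv hv1).memLp_liftIoc.haarAddCircle
  have h := fourierBasis.hasSum_inner_mul_inner hU.toLp hV.toLp
  have e1 : (fun n => (starRingEnd ℂ) (torusCoeff u n) * torusCoeff v n) =
      fun n => inner ℂ (hU.toLp) (fourierBasis n) * inner ℂ (fourierBasis n) (hV.toLp) := by
    ext n
    rw [← fourierBasis.repr_apply_apply, ← inner_conj_symm, ← fourierBasis.repr_apply_apply,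
      fourierBasis_repr, fourierBasis_repr, fourierCoeff_congr_ae hU.coeFn_toLp,
      fourierCoeff_congr_ae hV.coeFn_toLp, fourierCoeff_liftIoc_eq_torusCoeff,
      fourierCoeff_liftIoc_eq_torusCoeff]
  have e2 : ∫ x in (0 : ℝ)..1, (starRingEnd ℂ) (u x) * v x = inner ℂ (hU.toLp) (hV.toLp) := by
    rw [L2.inner_def]
    have : ∫ x in (0 : ℝ)..(0 + 1), (starRingEnd ℂ) (u x) * v x =
        ∫ t : AddCircle (1 : ℝ), (AddCircle.liftIoc 1 0 fun x => (starRingEnd ℂ) (u x) * v x) t :=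
      (AddCircle.integral_liftIoc_eq_intervalIntegral _).symm
    rw [zero_add] at this
    rw [this]
    have h2 := AddCircle.integral_haarAddCircle (T := (1 : ℝ))
      (f := AddCircle.liftIoc 1 0 fun x => (starRingEnd ℂ) (u x) * v x)
    rw [inv_one, one_smul] at h2
    rw [← h2]
    refine integral_congr_ae ?_
    filter_upwards [hU.coeFn_toLp, hV.coeFn_toLp] with t ht1 ht2
    rw [ht1, ht2, RCLike.inner_apply']
    rfl
  rw [e1, e2]
  exact h

theorem sum_sq_torusCoeff_le {v : ℝ → ℂ} (hv : Measurable v) (hv1 : ∀ x, ‖v x‖ ≤ 1)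
    (s : Finset ℤ) : ∑ n ∈ s, ‖torusCoeff v n‖ ^ 2 ≤ 1 := by
  have h := hasSum_torusCoeff hv hv1 hv hv1
  have h2 := Complex.hasSum_re h
  have e1 : ∀ n, ((starRingEnd ℂ) (torusCoeff v n) * torusCoeff v n).re = ‖torusCoeff v n‖ ^ 2 := by
    intro n
    rw [mul_comm, Complex.mul_conj']
    norm_cast
  simp only [e1] at h2
  refine (sum_le_hasSum s (fun n _ => by positivity) h2).trans ?_
  refine (Complex.re_le_norm _).trans ?_
  have := intervalIntegral.norm_integral_le_of_norm_le_const (a := 0) (b := 1)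
    (f := fun x => (starRingEnd ℂ) (v x) * v x) (C := 1) fun x _ => by
      rw [norm_mul, RCLike.norm_conj]
      exact mul_le_one₀ (hv1 x) (norm_nonneg _) (hv1 x)
  simpa using this

theorem e_periodic_int (n : ℤ) (x : ℝ) : e (-(n * (x + 1))) = e (-(n * x)) := by
  rw [show -(n * (x + 1)) = -(n * x) + ((-n : ℤ) : ℝ) by push_cast; ring, e_add, e_int, mul_one]

theorem torusCoeff_translate {v : ℝ → ℂ} (hv : Function.Periodic v 1) (n : ℤ) (t : ℝ) :
    torusCoeff (fun x => v (x + t)) n = e (n * t) * torusCoeff v n := by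
  have hper : Function.Periodic (fun x => e (-(n * x)) * v x) 1 := fun x => by
    simp only [e_periodic_int, hv x]
  have h : torusCoeff v n = ∫ x in (0 : ℝ)..1, e (-(n * (x + t))) * v (x + t) := by
    have := integral_unitMeas_shift hper t
    rw [integral_unitMeas, integral_unitMeas] at this
    exact this.symm
  rw [h, torusCoeff, ← intervalIntegral.integral_const_mul]
  refine intervalIntegral.integral_congr fun x _ => ?_
  rw [← mul_assoc, ← e_add]
  congr 2; ring

/-- Translation by half a wavelength t = 1/(2|n|) changes the sign of the coefficient. Twice the
coefficient is thus an integral of v(x + t) - v(x) against a character, and the L¹ modulus of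
continuity 4Kt applies. -/
theorem IsStep.norm_torusCoeff_le {K : ℕ} {v : ℝ → ℂ} (h : IsStep K v) {n : ℤ} (hn : n ≠ 0) :
    ‖torusCoeff v n‖ ≤ K / |(n : ℝ)| := by
  have hn' : (1 : ℝ) ≤ |(n : ℝ)| := by exact_mod_cast Int.one_le_abs hn
  have hn0 : (n : ℝ) ≠ 0 := by exact_mod_cast hn
  set t : ℝ := 1 / (2 * |(n : ℝ)|) with ht
  have ht0 : 0 ≤ t := by positivity
  have ht1 : t < 1 := by rw [ht, div_lt_one (by positivity)]; linarith
  have he : e (n * t) = -1 := by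
    have hhalf : e (1 / 2) = -1 := by
      rw [e, show 2 * (Real.pi : ℂ) * Complex.I * ((1 / 2 : ℝ) : ℂ) = Real.pi * Complex.I by
        push_cast; ring, Complex.exp_pi_mul_I]
    rcases abs_choice (n : ℝ) with h | h
    · rw [ht, h, show (n : ℝ) * (1 / (2 * n)) = 1 / 2 by field_simp, hhalf]
    · rw [ht, h, show (n : ℝ) * (1 / (2 * -n)) = -(1 / 2) by field_simp, ← conj_e, hhalf]
      simp
  have h1 := torusCoeff_translate h.periodic n t
  rw [he] at h1
  have h2 : 2 * torusCoeff v n = -∫ x in (0 : ℝ)..1, e (-(n * x)) * (v (x + t) - v x) := by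
    have hi : ∀ w : ℝ → ℂ, IsStep K w →
        IntervalIntegrable (fun x => e (-(n * x)) * w x) volume 0 1 := by
      intro w hw
      refine (hw.intervalIntegrable 0 1).continuousOn_mul (Continuous.continuousOn ?_)
      unfold e; fun_prop
    simp only [mul_sub]
    rw [intervalIntegral.integral_sub (hi _ (h.translate t)) (hi _ h)]
    change _ = -(torusCoeff (fun x => v (x + t)) n - torusCoeff v n)
    rw [h1]; ring
  have h3 : ‖∫ x in (0 : ℝ)..1, e (-(n * x)) * (v (x + t) - v x)‖ ≤ 4 * K * t := by
    refine (intervalIntegral.norm_integral_le_integral_norm zero_le_one).trans ?_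
    simp only [norm_mul, norm_e, one_mul]
    exact h.integral_shift_le ht0 ht1
  have h4 : 2 * ‖torusCoeff v n‖ ≤ 4 * K * t := by
    rw [← Complex.norm_ofNat 2, ← norm_mul, h2, norm_neg]; exact h3
  have : 4 * (K : ℝ) * t = 2 * (K / |(n : ℝ)|) := by rw [ht]; field_simp; ring
  linarith

/-- The dilate has period 1/p, while translation by 1/p multiplies its n-th coefficient by e(n/p),
which is not 1 unless p divides n. -/
theorem torusCoeff_dilate_eq_zero {K : ℕ} {A : ℝ → ℂ} (hA : IsStep K A) {p : ℕ} (hp : 0 < p)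
    {n : ℤ} (hn : ¬ (p : ℤ) ∣ n) : torusCoeff (fun x => A (p * x)) n = 0 := by
  have hp' : (p : ℝ) ≠ 0 := by exact_mod_cast hp.ne'
  have h := torusCoeff_translate (hA.dilate hp).periodic n (1 / p)
  have e1 : (fun x : ℝ => A (p * (x + 1 / p))) = fun x => A (p * x) := by
    ext x
    rw [mul_add, mul_one_div_cancel hp', hA.periodic]
  rw [e1] at h
  by_contra hne
  have h1 : e (n * (1 / p)) = 1 := by
    refine mul_right_cancel₀ hne ?_
    rw [one_mul]; exact h.symm
  rw [e, Complex.exp_eq_one_iff] at h1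
  obtain ⟨l, hl⟩ := h1
  have hpi : (2 * (Real.pi : ℂ) * Complex.I) ≠ 0 := Complex.two_pi_I_ne_zero
  have hl' : ((n * (1 / p) : ℝ) : ℂ) = l := by
    refine mul_left_cancel₀ hpi ?_
    rw [hl]; ring
  have hl2 : (n : ℝ) * (1 / p) = l := by exact_mod_cast hl'
  refine hn ⟨l, ?_⟩
  have : (n : ℝ) = p * l := by rw [← hl2]; field_simp
  exact_mod_cast this

/-- The mass of the nonzero frequencies divisible by `p`. -/
def multMass (v : ℝ → ℂ) (p : ℕ) : ℝ :=
  ∑' n : ℤ, if n ≠ 0 ∧ (p : ℤ) ∣ n then ‖torusCoeff v n‖ ^ 2 else 0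

theorem summable_multMass {v : ℝ → ℂ} (hv : Measurable v) (hv1 : ∀ x, ‖v x‖ ≤ 1) (p : ℕ) :
    Summable fun n : ℤ => if n ≠ 0 ∧ (p : ℤ) ∣ n then ‖torusCoeff v n‖ ^ 2 else 0 := by
  have h : Summable fun n : ℤ => ‖torusCoeff v n‖ ^ 2 :=
    summable_of_sum_le (fun n => by positivity) (sum_sq_torusCoeff_le hv hv1)
  refine h.of_nonneg_of_le (fun n => ?_) (fun n => ?_) <;> split_ifs <;> first | positivity | rfl

/-- By Parseval only multiples of p contribute. Frequency 0 gives the integral of A times a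
coefficient of modulus at most 1; Cauchy–Schwarz handles the rest, because the coefficients of the
dilate have total mass at most 1. -/
theorem norm_integral_dilate_mul_conj_le {K : ℕ} {A v : ℝ → ℂ} (hA : IsStep K A) {p : ℕ}
    (hp : 0 < p) (hv : Measurable v) (hv1 : ∀ x, ‖v x‖ ≤ 1) :
    ‖∫ x in (0 : ℝ)..1, A (p * x) * (starRingEnd ℂ) (v x)‖ ≤
      ‖∫ x in (0 : ℝ)..1, A x‖ + √(multMass v p) := by
  classical
  have hAp := hA.dilate hp
  have h := hasSum_torusCoeff hv hv1 hAp.measurable hAp.norm_le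
  simp only [mul_comm _ (A _)] at h
  refine le_of_tendsto h.norm (Eventually.of_forall fun s => ?_)
  set u := fun n => torusCoeff (fun x => A (p * x)) n with hu
  have hu0 : u 0 = ∫ x in (0 : ℝ)..1, A x := by
    simp only [hu, torusCoeff]
    rw [← hA.integral_dilate hp]
    refine intervalIntegral.integral_congr fun x _ => ?_
    simp [e]
  have hv0 : ∀ n, ‖torusCoeff v n‖ ≤ 1 := by
    intro n
    have := sum_sq_torusCoeff_le hv hv1 {n}
    rw [Finset.sum_singleton] at this
    exact (sq_le_one_iff₀ (norm_nonneg _)).1 this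
  have hterm : ∀ n ∈ s, ‖(starRingEnd ℂ) (torusCoeff v n) * u n‖ ≤
      (if n = 0 then ‖u 0‖ else 0) +
        ‖u n‖ * (if n ≠ 0 ∧ (p : ℤ) ∣ n then ‖torusCoeff v n‖ else 0) := by
    intro n _
    rw [norm_mul, RCLike.norm_conj]
    by_cases hn : n = 0
    · subst hn
      simp only [if_true, ne_eq, not_true_eq_false, false_and, if_false, mul_zero, add_zero]
      exact mul_le_of_le_one_left (norm_nonneg _) (hv0 0)
    · rw [if_neg hn, zero_add]
      by_cases hd : (p : ℤ) ∣ n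
      · rw [if_pos ⟨hn, hd⟩, mul_comm]
      · simp only [hu]; rw [torusCoeff_dilate_eq_zero hA hp hd]; simp
  refine (norm_sum_le _ _).trans ((Finset.sum_le_sum hterm).trans ?_)
  rw [Finset.sum_add_distrib]
  refine add_le_add ?_ ?_
  · rw [Finset.sum_ite_eq']
    split_ifs
    · rw [hu0]
    · exact norm_nonneg _
  · have hcs := Finset.sum_mul_sq_le_sq_mul_sq s (fun n => ‖u n‖)
      (fun n => if n ≠ 0 ∧ (p : ℤ) ∣ n then ‖torusCoeff v n‖ else 0)
    refine Real.le_sqrt_of_sq_le (hcs.trans ?_)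
    have h1 := sum_sq_torusCoeff_le hAp.measurable hAp.norm_le s
    have h2 : ∑ n ∈ s, (if n ≠ 0 ∧ (p : ℤ) ∣ n then ‖torusCoeff v n‖ else 0) ^ 2 ≤
        multMass v p := by
      have : ∀ n : ℤ, (if n ≠ 0 ∧ (p : ℤ) ∣ n then ‖torusCoeff v n‖ else 0) ^ 2 =
          if n ≠ 0 ∧ (p : ℤ) ∣ n then ‖torusCoeff v n‖ ^ 2 else 0 := fun n => by
        split_ifs <;> simp
      simp only [this]
      exact (summable_multMass hv hv1 p).sum_le_tsum s fun n _ => by split_ifs <;> positivity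
    calc _ ≤ 1 * multMass v p := by
          refine mul_le_mul h1 h2 (Finset.sum_nonneg fun n _ => sq_nonneg _) zero_le_one
      _ = _ := one_mul _

/-- On average over `p`, little Fourier mass of a step function lies on the nonzero multiples of
`p`. -/
theorem exists_sum_multMass_le : ∃ C : ℝ, 0 < C ∧ ∀ (K : ℕ) (v : ℝ → ℂ), IsStep K v → 1 ≤ K →
    ∀ s : Finset ℕ, ∑ p ∈ s, multMass v p ≤ C * (K : ℝ) ^ (1 / 4 : ℝ) := by
  classical
  -- The 16th power bounds the number of divisors by C|n|^{1/16}, which is at most CK^{1/4} for |n|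
  -- ≤ K⁴.
  obtain ⟨C, hC1, hC⟩ := exists_card_divisors_pow_le 16
  have hsum : Summable fun n : ℤ => |(n : ℝ)| ^ (-(5 / 4) : ℝ) :=
    Real.summable_abs_int_rpow (by norm_num)
  set c := ∑' n : ℤ, |(n : ℝ)| ^ (-(5 / 4) : ℝ) with hc
  have hc0 : 0 ≤ c := tsum_nonneg fun n => by positivity
  have hC1' : (1 : ℝ) ≤ C := by exact_mod_cast hC1
  refine ⟨C * (1 + c), by positivity, fun K v hv hK s => ?_⟩
  have hK' : (1 : ℝ) ≤ K := by exact_mod_cast hK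
  have hdiv : ∀ n : ℤ, n ≠ 0 → ((s.filter (fun p : ℕ => (p : ℤ) ∣ n)).card : ℝ) ≤
      C * |(n : ℝ)| ^ (1 / 16 : ℝ) := by
    intro n hn
    have hsub : s.filter (fun p : ℕ => (p : ℤ) ∣ n) ⊆ n.natAbs.divisors := by
      intro p hp
      rw [Nat.mem_divisors]
      exact ⟨Int.natCast_dvd.1 (Finset.mem_filter.1 hp).2, by simpa using hn⟩
    have h1 := hC n.natAbs (by simpa using hn)
    have h2 : ((s.filter (fun p : ℕ => (p : ℤ) ∣ n)).card : ℝ) ^ 16 ≤ C * |(n : ℝ)| := by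
      have h3 : (s.filter (fun p : ℕ => (p : ℤ) ∣ n)).card ^ 16 ≤ C * n.natAbs :=
        (Nat.pow_le_pow_left (Finset.card_le_card hsub) 16).trans h1
      have h4 : (n.natAbs : ℝ) = |(n : ℝ)| := by
        rw [Nat.cast_natAbs]; push_cast; rfl
      rw [← h4]; exact_mod_cast h3
    have h5 : (C * |(n : ℝ)| ^ (1 / 16 : ℝ)) ^ 16 = (C : ℝ) ^ 16 * |(n : ℝ)| := by
      rw [mul_pow, ← Real.rpow_natCast (|(n : ℝ)| ^ (1 / 16 : ℝ)), ← Real.rpow_mul (abs_nonneg _)]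
      norm_num
    refine le_of_pow_le_pow_left₀ (n := 16) (by norm_num) (by positivity) ?_
    rw [h5]
    refine h2.trans ?_
    gcongr
    exact le_self_pow₀ hC1' (by norm_num)
  have hterm : ∀ n : ℤ, ∑ p ∈ s, (if n ≠ 0 ∧ (p : ℤ) ∣ n then ‖torusCoeff v n‖ ^ 2 else 0) ≤
      C * (K : ℝ) ^ (1 / 4 : ℝ) * ‖torusCoeff v n‖ ^ 2 + C * |(n : ℝ)| ^ (-(5 / 4) : ℝ) := by
    intro n
    by_cases hn : n = 0
    · simp only [hn, ne_eq, not_true_eq_false, false_and, if_false, Finset.sum_const_zero]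
      positivity
    have hn' : (1 : ℝ) ≤ |(n : ℝ)| := by exact_mod_cast Int.one_le_abs hn
    have hn0 : 0 < |(n : ℝ)| := by linarith
    simp only [ne_eq, hn, not_false_eq_true, true_and]
    rw [← Finset.sum_filter, Finset.sum_const, nsmul_eq_mul]
    have hd := hdiv n hn
    have hdec := hv.norm_torusCoeff_le hn
    -- Up to K⁴ total mass at most 1 suffices. Beyond, the squared coefficient is at most K²/n² ≤
    -- |n|^{-3/2}, and 1/16 - 3/2 < -5/4 leaves a convergent series.
    rcases le_or_gt |(n : ℝ)| ((K : ℝ) ^ 4) with hle | hgt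
    · have : |(n : ℝ)| ^ (1 / 16 : ℝ) ≤ (K : ℝ) ^ (1 / 4 : ℝ) := by
        calc |(n : ℝ)| ^ (1 / 16 : ℝ) ≤ ((K : ℝ) ^ 4) ^ (1 / 16 : ℝ) := by gcongr
          _ = (K : ℝ) ^ (1 / 4 : ℝ) := by
            rw [← Real.rpow_natCast, ← Real.rpow_mul (by positivity)]; norm_num
      have h3 : (C : ℝ) * |(n : ℝ)| ^ (1 / 16 : ℝ) * ‖torusCoeff v n‖ ^ 2 ≤
          C * (K : ℝ) ^ (1 / 4 : ℝ) * ‖torusCoeff v n‖ ^ 2 := by gcongr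
      have h4 : ((s.filter (fun p : ℕ => (p : ℤ) ∣ n)).card : ℝ) * ‖torusCoeff v n‖ ^ 2 ≤
          C * |(n : ℝ)| ^ (1 / 16 : ℝ) * ‖torusCoeff v n‖ ^ 2 := by gcongr
      have h5 : 0 ≤ (C : ℝ) * |(n : ℝ)| ^ (-(5 / 4) : ℝ) := by positivity
      linarith
    · have hK2 : (K : ℝ) ^ 2 ≤ |(n : ℝ)| ^ (1 / 2 : ℝ) := by
        calc (K : ℝ) ^ 2 = ((K : ℝ) ^ 4) ^ (1 / 2 : ℝ) := by
              rw [← Real.rpow_natCast, ← Real.rpow_natCast, ← Real.rpow_mul (by positivity)]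
              norm_num
          _ ≤ _ := by gcongr
      have h3 : ‖torusCoeff v n‖ ^ 2 ≤ |(n : ℝ)| ^ (1 / 2 : ℝ) / |(n : ℝ)| ^ 2 := by
        calc ‖torusCoeff v n‖ ^ 2 ≤ (K / |(n : ℝ)|) ^ 2 := by gcongr
          _ = (K : ℝ) ^ 2 / |(n : ℝ)| ^ 2 := div_pow _ _ _
          _ ≤ _ := by gcongr
      have h4 : |(n : ℝ)| ^ (1 / 16 : ℝ) * (|(n : ℝ)| ^ (1 / 2 : ℝ) / |(n : ℝ)| ^ 2) ≤
          |(n : ℝ)| ^ (-(5 / 4) : ℝ) := by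
        rw [← Real.rpow_natCast |(n : ℝ)| 2, ← Real.rpow_sub hn0, ← Real.rpow_add hn0]
        exact Real.rpow_le_rpow_of_exponent_le hn' (by norm_num)
      calc ((s.filter (fun p : ℕ => (p : ℤ) ∣ n)).card : ℝ) * ‖torusCoeff v n‖ ^ 2
          ≤ C * |(n : ℝ)| ^ (1 / 16 : ℝ) * (|(n : ℝ)| ^ (1 / 2 : ℝ) / |(n : ℝ)| ^ 2) := by gcongr
        _ = C * (|(n : ℝ)| ^ (1 / 16 : ℝ) * (|(n : ℝ)| ^ (1 / 2 : ℝ) / |(n : ℝ)| ^ 2)) := by ring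
        _ ≤ C * |(n : ℝ)| ^ (-(5 / 4) : ℝ) := by gcongr
        _ ≤ _ := le_add_of_nonneg_left (by positivity)
  have hsq : Summable fun n : ℤ => ‖torusCoeff v n‖ ^ 2 :=
    summable_of_sum_le (fun n => by positivity) (sum_sq_torusCoeff_le hv.measurable hv.norm_le)
  have hsq1 : ∑' n : ℤ, ‖torusCoeff v n‖ ^ 2 ≤ 1 :=
    Real.tsum_le_of_sum_le (fun n => by positivity) (sum_sq_torusCoeff_le hv.measurable hv.norm_le)
  simp only [multMass]
  rw [← Summable.tsum_finsetSum fun p _ => summable_multMass hv.measurable hv.norm_le p]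
  have hS1 : Summable fun n : ℤ =>
      C * (K : ℝ) ^ (1 / 4 : ℝ) * ‖torusCoeff v n‖ ^ 2 + C * |(n : ℝ)| ^ (-(5 / 4) : ℝ) :=
    (hsq.mul_left _).add (hsum.mul_left _)
  refine ((summable_sum fun p _ => summable_multMass hv.measurable hv.norm_le p).tsum_le_tsum
    hterm hS1).trans ?_
  rw [(hsq.mul_left _).tsum_add (hsum.mul_left _), tsum_mul_left, tsum_mul_left, ← hc]
  have hK4 : 1 ≤ (K : ℝ) ^ (1 / 4 : ℝ) := Real.one_le_rpow hK' (by norm_num)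
  calc C * (K : ℝ) ^ (1 / 4 : ℝ) * ∑' n : ℤ, ‖torusCoeff v n‖ ^ 2 + C * c
      ≤ C * (K : ℝ) ^ (1 / 4 : ℝ) * 1 + C * (c * (K : ℝ) ^ (1 / 4 : ℝ)) := by
        gcongr
        exact le_mul_of_one_le_right hc0 hK4
    _ = _ := by ring

/-! ### The autocorrelation of a step function at multiples of φ. -/

section AutoCorr

variable {K : ℕ} {F : ℝ → ℂ}

theorem IsStep.intervalIntegrable_mul_conj (h : IsStep K F) (a b c : ℝ) :
    IntervalIntegrable (fun x => F (x + c) * (starRingEnd ℂ) (F x)) volume a b :=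
  ((h.translate c).mul h.conj).intervalIntegrable a b

theorem IsStep.autoCorr_periodic (h : IsStep K F) : Function.Periodic (autoCorr F) 1 := fun t => by
  simp only [autoCorr, ← add_assoc, h.periodic _]

theorem IsStep.norm_autoCorr_le_one (h : IsStep K F) (t : ℝ) : ‖autoCorr F t‖ ≤ 1 :=
  ((h.translate t).mul h.conj).norm_integral_le_one

theorem IsStep.norm_autoCorr_sub_le_aux (h : IsStep K F) {s t : ℝ} (hst : s ≤ t)
    (hts : t - s < 1) : ‖autoCorr F t - autoCorr F s‖ ≤ 4 * K * (t - s) := by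
  rw [autoCorr, autoCorr, ← intervalIntegral.integral_sub (h.intervalIntegrable_mul_conj _ _ _)
    (h.intervalIntegrable_mul_conj _ _ _)]
  refine (intervalIntegral.norm_integral_le_integral_norm zero_le_one).trans ?_
  have hper : Function.Periodic (fun x => ‖F (x + (t - s)) - F x‖) 1 := fun x => by
    simp only [add_right_comm x 1, h.periodic _]
  have hsh := integral_unitMeas_shift hper s
  rw [integral_unitMeas, integral_unitMeas] at hsh
  refine le_trans ?_ (hsh.trans_le (h.integral_shift_le (by linarith) hts))
  have hi : ∀ a, IntervalIntegrable (fun x => F (x + a)) volume 0 1 := fun a =>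
    (h.translate a).intervalIntegrable 0 1
  refine intervalIntegral.integral_mono_on zero_le_one
    ((h.intervalIntegrable_mul_conj _ _ _).sub (h.intervalIntegrable_mul_conj _ _ _)).norm ?_
    fun x _ => ?_
  · have := ((hi t).sub (hi s)).norm
    refine this.congr (fun x _ => ?_)
    rw [show x + s + (t - s) = x + t by ring]
  · rw [← sub_mul, norm_mul, RCLike.norm_conj, show x + s + (t - s) = x + t by ring]
    exact mul_le_of_le_one_right (norm_nonneg _) (h.norm_le x)

theorem IsStep.norm_autoCorr_sub_le (h : IsStep K F) (hK : 1 ≤ K) (s t : ℝ) :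
    ‖autoCorr F s - autoCorr F t‖ ≤ 4 * K * |s - t| := by
  have hK' : (1 : ℝ) ≤ K := by exact_mod_cast hK
  rcases lt_or_ge |s - t| 1 with hlt | hge
  · rcases le_total s t with hst | hst
    · rw [norm_sub_rev, abs_sub_comm] at *
      rw [abs_of_nonneg (by linarith)] at *
      exact h.norm_autoCorr_sub_le_aux hst hlt
    · rw [abs_of_nonneg (by linarith)] at *
      exact h.norm_autoCorr_sub_le_aux hst hlt
  · have h1 := norm_sub_le (autoCorr F s) (autoCorr F t)
    have h2 := h.norm_autoCorr_le_one s
    have h3 := h.norm_autoCorr_le_one t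
    nlinarith

theorem IsStep.continuous_autoCorr (h : IsStep K F) (hK : 1 ≤ K) : Continuous (autoCorr F) := by
  refine (LipschitzWith.of_dist_le_mul (K := (4 * K : ℕ)) fun s t => ?_).continuous
  rw [dist_eq_norm, Real.dist_eq]
  refine (h.norm_autoCorr_sub_le hK s t).trans_eq ?_
  push_cast; ring

/-- Distinct n < F_j occupy distinct cells, and nφ is within 2/F_j of every point of its cell. As
the autocorrelation is 4K-Lipschitz, its value differs by at most 8K/F_j from any value on the cell;
the factor 8 is from (x + y)⁴ ≤ 8(x⁴ + y⁴). -/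
theorem IsStep.sum_norm_autoCorr_pow_four_le (h : IsStep K F) (hK : 1 ≤ K) {j : ℕ} (hj : 1 ≤ j)
    {s : Finset ℕ} (hs : ∀ n ∈ s, n < Nat.fib j) :
    ∑ n ∈ s, ‖autoCorr F (n * Real.goldenRatio)‖ ^ 4 ≤
      8 * (Nat.fib j * (∫ t in (0 : ℝ)..1, ‖autoCorr F t‖ ^ 4) +
        s.card * (8 * K / Nat.fib j) ^ 4) := by
  set Q := Nat.fib j with hQ
  have hQ0 : 0 < Q := Nat.fib_pos.2 hj
  have hQ' : (0 : ℝ) < Q := by exact_mod_cast hQ0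
  have hcont : Continuous fun t => ‖autoCorr F t‖ ^ 4 := (h.continuous_autoCorr hK).norm.pow 4
  set ε : ℝ := 8 * K / Q with hε
  have hterm : ∀ n ∈ s, ‖autoCorr F (n * Real.goldenRatio)‖ ^ 4 ≤
      8 * (Q * (∫ t in (cellIdx j n / Q : ℝ)..((cellIdx j n + 1) / Q), ‖autoCorr F t‖ ^ 4) +
        ε ^ 4) := by
    intro n hn
    obtain ⟨l, hl⟩ := exists_near_cellIdx hj (hs n hn)
    set k := cellIdx j n with hk
    have hlen : ((k : ℝ) + 1) / Q - k / Q = 1 / Q := by ring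
    have hle : (k : ℝ) / Q ≤ (k + 1) / Q := by linarith [one_div_pos.2 hQ']
    have hpt : ∀ t ∈ Set.Icc (k / Q : ℝ) ((k + 1) / Q), ‖autoCorr F (n * Real.goldenRatio)‖ ^ 4 ≤
        8 * (‖autoCorr F t‖ ^ 4 + ε ^ 4) := by
      intro t ht
      have e1 : autoCorr F (n * Real.goldenRatio) = autoCorr F (n * Real.goldenRatio + l) := by
        have := h.autoCorr_periodic.int_mul l (n * Real.goldenRatio)
        rw [mul_one] at this
        exact this.symm
      have hd : |n * Real.goldenRatio + l - t| ≤ 2 / Q := by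
        rw [abs_le] at hl ⊢
        have h2 : (2 : ℝ) / Q = 1 / Q + 1 / Q := by ring
        constructor <;> linarith [ht.1, ht.2]
      have h1 := h.norm_autoCorr_sub_le hK (n * Real.goldenRatio + l) t
      have h2 : ‖autoCorr F (n * Real.goldenRatio)‖ ≤ ‖autoCorr F t‖ + ε := by
        rw [e1]
        have h3 : 4 * (K : ℝ) * |n * Real.goldenRatio + l - t| ≤ ε := by
          calc 4 * (K : ℝ) * |n * Real.goldenRatio + l - t| ≤ 4 * K * (2 / Q) := by gcongr
            _ = ε := by rw [hε]; ring
        have := norm_le_norm_add_norm_sub' (autoCorr F (n * Real.goldenRatio + l)) (autoCorr F t)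
        linarith
      calc _ ≤ (‖autoCorr F t‖ + ε) ^ 4 := pow_le_pow_left₀ (norm_nonneg _) h2 4
        _ ≤ 2 ^ (4 - 1) * (‖autoCorr F t‖ ^ 4 + ε ^ 4) := add_pow_le (norm_nonneg _) (by positivity) 4
        _ = _ := by norm_num
    have hint := intervalIntegral.integral_mono_on (μ := volume) hle
      (f := fun _ => ‖autoCorr F (n * Real.goldenRatio)‖ ^ 4)
      (g := fun t => 8 * (‖autoCorr F t‖ ^ 4 + ε ^ 4)) (by simp)
      (Continuous.intervalIntegrable (by fun_prop) _ _) hpt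
    rw [intervalIntegral.integral_const, hlen, intervalIntegral.integral_const_mul,
      intervalIntegral.integral_add (hcont.intervalIntegrable _ _) (by simp),
      intervalIntegral.integral_const, hlen, smul_eq_mul, smul_eq_mul] at hint
    have hQ1 := mul_one_div_cancel hQ'.ne'
    calc _ = Q * (1 / Q * ‖autoCorr F (n * Real.goldenRatio)‖ ^ 4) := by
          rw [← mul_assoc, hQ1, one_mul]
      _ ≤ Q * (8 * ((∫ t in (k / Q : ℝ)..((k + 1) / Q), ‖autoCorr F t‖ ^ 4) + 1 / Q * ε ^ 4)) :=
          mul_le_mul_of_nonneg_left hint hQ'.le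
      _ = _ := by
          clear_value ε
          linear_combination 8 * ε ^ 4 * hQ1
  refine (Finset.sum_le_sum hterm).trans ?_
  rw [← Finset.mul_sum, Finset.sum_add_distrib, ← Finset.mul_sum, Finset.sum_const, nsmul_eq_mul]
  gcongr
  rw [← sum_integral_cells (fun a b => hcont.intervalIntegrable a b) hQ0,
    ← sum_cellIdx hj (fun k => ∫ x in (k / Q : ℝ)..((k + 1) / Q), ‖autoCorr F x‖ ^ 4)]
  refine Finset.sum_le_sum_of_subset_of_nonneg (fun n hn => Finset.mem_range.2 (hs n hn))
    fun n _ _ => ?_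
  refine intervalIntegral.integral_nonneg ?_ fun t _ => by positivity
  gcongr; linarith

/-- The autocorrelation is 1 at 0 and 4K-Lipschitz, hence at least 1/2 in modulus on [0, 1/(8K)]. -/
theorem IsStep.le_integral_norm_autoCorr_pow_four (h : IsStep K F) (hK : 1 ≤ K)
    (h1 : ∀ x, ‖F x‖ = 1) : 1 / (128 * K) ≤ ∫ t in (0 : ℝ)..1, ‖autoCorr F t‖ ^ 4 := by
  have hK' : (1 : ℝ) ≤ K := by exact_mod_cast hK
  have hcont : Continuous fun t => ‖autoCorr F t‖ ^ 4 := (h.continuous_autoCorr hK).norm.pow 4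
  set δ : ℝ := 1 / (8 * K) with hδ
  have hδ0 : 0 < δ := by positivity
  have hδ1 : δ ≤ 1 := by rw [hδ, div_le_one (by positivity)]; linarith
  have h0 : autoCorr F 0 = 1 := by
    simp [autoCorr, Complex.mul_conj', h1]
  have hpt : ∀ t ∈ Set.Icc 0 δ, (1 / 2 : ℝ) ^ 4 ≤ ‖autoCorr F t‖ ^ 4 := by
    intro t ht
    have h2 := h.norm_autoCorr_sub_le hK 0 t
    rw [zero_sub, abs_neg, abs_of_nonneg ht.1, h0] at h2
    have h3 : 4 * (K : ℝ) * t ≤ 1 / 2 := by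
      calc 4 * (K : ℝ) * t ≤ 4 * K * δ := by gcongr; exact ht.2
        _ = 1 / 2 := by rw [hδ]; field_simp; norm_num
    have h4 := norm_le_norm_add_norm_sub' (1 : ℂ) (autoCorr F t)
    rw [norm_one] at h4
    exact pow_le_pow_left₀ (by norm_num) (by linarith) 4
  have h5 := intervalIntegral.integral_mono_on (μ := volume) hδ0.le (by simp)
    (hcont.intervalIntegrable 0 δ) hpt
  rw [intervalIntegral.integral_const, sub_zero, smul_eq_mul] at h5
  have h6 : ∫ t in (0 : ℝ)..δ, ‖autoCorr F t‖ ^ 4 ≤ ∫ t in (0 : ℝ)..1, ‖autoCorr F t‖ ^ 4 := by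
    refine intervalIntegral.integral_mono_interval le_rfl hδ0.le hδ1
      (Eventually.of_forall fun t => by positivity) (hcont.intervalIntegrable 0 1)
  refine le_trans (le_of_eq ?_) (h5.trans h6)
  rw [hδ]; field_simp; norm_num

end AutoCorr

theorem fib_succ_le_two_mul {lam : ℕ} (hlam : 1 ≤ lam) :
    (Nat.fib (lam + 1) : ℝ) ≤ 2 * Nat.fib lam := by
  rw [Nat.fib_add_one (by omega)]
  have : Nat.fib (lam - 1) ≤ Nat.fib lam := Nat.fib_mono (Nat.sub_le _ _)
  have : (Nat.fib (lam - 1) : ℝ) ≤ Nat.fib lam := by exact_mod_cast this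
  push_cast; linarith

/-- A unimodular step function with F_{λ+1} jumps has fourth moment at least of order 1/F_λ, so no
faster decay in λ is possible. This supplies the later condition κ ≤ 1/432 without any restriction
on c₂. -/
theorem exponent_le_of_autoCorr_bound {B c ϑ : ℝ}
    (h : ∀ lam : ℕ, 2 ≤ lam → ∫ t in (0 : ℝ)..1, ‖autoCorr (torusExp ϑ lam) t‖ ^ 4 ≤
      B * (Nat.fib lam : ℝ) ^ (-(8 * c))) : 8 * c ≤ 1 := by
  by_contra hc
  rw [not_le] at hc
  have hbd : ∀ lam : ℕ, 2 ≤ lam → (Nat.fib lam : ℝ) ^ (8 * c - 1) ≤ 256 * B := by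
    intro lam hlam
    have hf0 : (0 : ℝ) < Nat.fib lam := by exact_mod_cast Nat.fib_pos.2 (by omega)
    have hf1 : 1 ≤ Nat.fib (lam + 1) := Nat.fib_pos.2 (by omega)
    have hf2 : (Nat.fib (lam + 1) : ℝ) ≤ 2 * Nat.fib lam := fib_succ_le_two_mul (by omega)
    have h1 := (isStep_torusExp ϑ lam).le_integral_norm_autoCorr_pow_four hf1
      (norm_torusExp ϑ lam)
    have h2 := h1.trans (h lam hlam)
    have h3 : 1 / (256 * (Nat.fib lam : ℝ)) ≤ 1 / (128 * (Nat.fib (lam + 1) : ℕ)) := by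
      have : (0 : ℝ) < Nat.fib (lam + 1) := by exact_mod_cast hf1
      exact one_div_le_one_div_of_le (by positivity) (by linarith)
    have h4 := h3.trans h2
    rw [Real.rpow_neg hf0.le, div_le_iff₀ (by positivity)] at h4
    rw [Real.rpow_sub_one hf0.ne', div_le_iff₀ hf0]
    have hp : 0 < (Nat.fib lam : ℝ) ^ (8 * c) := Real.rpow_pos_of_pos hf0 _
    calc (Nat.fib lam : ℝ) ^ (8 * c) = 1 * (Nat.fib lam : ℝ) ^ (8 * c) := (one_mul _).symm
      _ ≤ B * ((Nat.fib lam : ℝ) ^ (8 * c))⁻¹ * (256 * Nat.fib lam) * (Nat.fib lam : ℝ) ^ (8 * c) :=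
        by gcongr
      _ = _ := by field_simp
  have htend : Tendsto (fun lam : ℕ => (Nat.fib lam : ℝ) ^ (8 * c - 1)) atTop atTop := by
    refine (tendsto_rpow_atTop (by linarith)).comp (tendsto_natCast_atTop_atTop.comp ?_)
    refine tendsto_atTop_mono' _ (eventually_atTop.2 ⟨5, fun n hn => ?_⟩) tendsto_id
    exact Nat.le_fib_self hn
  obtain ⟨n, hn1, hn2⟩ := ((htend.eventually_gt_atTop (256 * B)).and (eventually_ge_atTop 2)).exists
  exact absurd (hbd n hn2) (not_le.2 hn1)

/-! ### Averages over p and the bilinear estimate. -/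

theorem exists_fib_between {X : ℝ} (hX : 1 ≤ X) :
    ∃ j : ℕ, 2 ≤ j ∧ X ≤ Nat.fib j ∧ (Nat.fib j : ℝ) ≤ 2 * X := by
  classical
  have hex : ∃ j : ℕ, 2 ≤ j ∧ X ≤ Nat.fib j := by
    refine ⟨⌈X⌉₊ + 5, by omega, (Nat.le_ceil X).trans ?_⟩
    have : ⌈X⌉₊ + 5 ≤ Nat.fib (⌈X⌉₊ + 5) := Nat.le_fib_self (by omega)
    exact_mod_cast (Nat.le_add_right _ 5).trans this
  obtain ⟨h1, h2⟩ := Nat.find_spec hex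
  refine ⟨Nat.find hex, h1, h2, ?_⟩
  rcases h1.eq_or_lt with heq | hlt
  · rw [← heq]; simp; linarith
  · have hmin := Nat.find_min hex (m := Nat.find hex - 1) (by omega)
    have hlt' : (Nat.fib (Nat.find hex - 1) : ℝ) < X := by
      by_contra hcon
      exact hmin ⟨by omega, not_lt.1 hcon⟩
    have : Nat.fib (Nat.find hex) ≤ 2 * Nat.fib (Nat.find hex - 1) := by
      obtain ⟨i, hi⟩ : ∃ i, Nat.find hex = i + 2 := ⟨Nat.find hex - 2, by omega⟩
      rw [hi, show i + 2 - 1 = i + 1 by omega, Nat.fib_add_two]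
      have : Nat.fib i ≤ Nat.fib (i + 1) := Nat.fib_mono (Nat.le_succ i)
      omega
    have : (Nat.fib (Nat.find hex) : ℝ) ≤ 2 * Nat.fib (Nat.find hex - 1) := by exact_mod_cast this
    linarith

theorem sum_pow_four_le (s : Finset ℕ) (x : ℕ → ℝ) :
    (∑ p ∈ s, x p) ^ 4 ≤ (s.card : ℝ) ^ 3 * ∑ p ∈ s, x p ^ 4 := by
  have h1 := sq_sum_le_card_mul_sum_sq (s := s) (f := x)
  have h2 := sq_sum_le_card_mul_sum_sq (s := s) (f := fun p => x p ^ 2)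
  have h3 : ∑ p ∈ s, (x p ^ 2) ^ 2 = ∑ p ∈ s, x p ^ 4 :=
    Finset.sum_congr rfl fun p _ => by ring
  rw [h3] at h2
  calc (∑ p ∈ s, x p) ^ 4 = ((∑ p ∈ s, x p) ^ 2) ^ 2 := by ring
    _ ≤ (s.card * ∑ p ∈ s, x p ^ 2) ^ 2 := pow_le_pow_left₀ (sq_nonneg _) h1 2
    _ = (s.card : ℝ) ^ 2 * (∑ p ∈ s, x p ^ 2) ^ 2 := by ring
    _ ≤ (s.card : ℝ) ^ 2 * (s.card * ∑ p ∈ s, x p ^ 4) := by gcongr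
    _ = _ := by ring

/-- The autocorrelation at the points `rpφ` is small on average over `p`. -/
theorem sum_norm_autoCorr_le {ϑ B P T : ℝ} {lam r : ℕ} {s : Finset ℕ} (hB : 1 ≤ B) (hT : 1 ≤ T)
    (hP : 1 ≤ P) (hs : ∀ p ∈ s, 1 ≤ p ∧ (p : ℝ) ≤ P) (hcard : (s.card : ℝ) ≤ P) (hr : 1 ≤ r)
    (hrT : (r : ℝ) < T ^ 2) (hlam2 : (Nat.fib (lam + 1) : ℝ) ≤ 4 * (P * T ^ 4))
    (hG : ∫ t in (0 : ℝ)..1, ‖autoCorr (torusExp ϑ lam) t‖ ^ 4 ≤ B * (T ^ 14)⁻¹) :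
    ∑ p ∈ s, ‖autoCorr (torusExp ϑ lam) (r * p * Real.goldenRatio)‖ ≤ 14 * B * (P / T ^ 2) := by
  have hT0 : 0 < T := by linarith
  have hX : 1 ≤ 4 * (P * T ^ 6) := by
    have : 1 ≤ P * T ^ 6 := one_le_mul_of_one_le_of_one_le hP (one_le_pow₀ hT)
    linarith
  -- F_j of order PT⁶ exceeds all products rp < T²P, and it is so large compared with F_{λ+1} ≤ 4PT⁴
  -- that the Lipschitz error is O(T^{-2}).
  obtain ⟨j, hj2, hjl, hju⟩ := exists_fib_between hX
  have hF := isStep_torusExp ϑ lam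
  have hK1 : 1 ≤ Nat.fib (lam + 1) := Nat.fib_pos.2 (by omega)
  set Φ := autoCorr (torusExp ϑ lam) with hΦ
  have hinj : Set.InjOn (fun p => r * p) (s : Set ℕ) := fun a _ b _ hab =>
    Nat.eq_of_mul_eq_mul_left hr hab
  have hlt : ∀ n ∈ s.image (fun p => r * p), n < Nat.fib j := by
    intro n hn
    obtain ⟨p, hp, rfl⟩ := Finset.mem_image.1 hn
    have h1 : (r : ℝ) * p < 4 * (P * T ^ 6) := by
      have hp0 : (0 : ℝ) < p := by exact_mod_cast (hs p hp).1
      calc (r : ℝ) * p < T ^ 2 * p := by gcongr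
        _ ≤ T ^ 2 * P := by gcongr; exact (hs p hp).2
        _ = 1 * (P * T ^ 2) := by ring
        _ ≤ 4 * (P * T ^ 6) := by
          gcongr
          · norm_num
          · norm_num
    exact_mod_cast h1.trans_le hjl
  have hsum := hF.sum_norm_autoCorr_pow_four_le hK1 (by omega : 1 ≤ j) hlt
  rw [Finset.sum_image hinj, Finset.card_image_of_injOn hinj] at hsum
  simp only [Nat.cast_mul] at hsum
  rw [← hΦ] at hsum
  have hfj : (0 : ℝ) < Nat.fib j := by linarith
  have hε : 8 * (Nat.fib (lam + 1) : ℝ) / Nat.fib j ≤ 8 * (T ^ 2)⁻¹ := by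
    rw [div_le_iff₀ hfj]
    have : 8 * (T ^ 2)⁻¹ * (4 * (P * T ^ 6)) ≤ 8 * (T ^ 2)⁻¹ * Nat.fib j := by gcongr
    refine le_trans ?_ this
    have e : 8 * (T ^ 2)⁻¹ * (4 * (P * T ^ 6)) = 8 * (4 * (P * T ^ 4)) := by field_simp
    rw [e]; gcongr
  -- The two contributions total 8 · (8 + 4096) = 32832 ≤ 38416 = 14⁴, hence the constant 14 after
  -- the fourth root.
  have hfour : ∑ p ∈ s, ‖Φ (r * p * Real.goldenRatio)‖ ^ 4 ≤ 38416 * B * P * (T ^ 8)⁻¹ := by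
    refine hsum.trans ?_
    have hI0 : 0 ≤ ∫ t in (0 : ℝ)..1, ‖Φ t‖ ^ 4 :=
      intervalIntegral.integral_nonneg zero_le_one fun t _ => by positivity
    have h1 : (Nat.fib j : ℝ) * (∫ t in (0 : ℝ)..1, ‖Φ t‖ ^ 4) ≤
        2 * (4 * (P * T ^ 6)) * (B * (T ^ 14)⁻¹) := by gcongr
    have h2 : (s.card : ℝ) * (8 * (Nat.fib (lam + 1) : ℕ) / Nat.fib j) ^ 4 ≤
        P * (8 * (T ^ 2)⁻¹) ^ 4 := by gcongr
    have e1 : 2 * (4 * (P * T ^ 6)) * (B * (T ^ 14)⁻¹) = 8 * B * P * (T ^ 8)⁻¹ := by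
      field_simp; norm_num
    have e2 : P * (8 * (T ^ 2)⁻¹) ^ 4 = 4096 * P * (T ^ 8)⁻¹ := by
      field_simp; norm_num
    have h3 : 4096 * P * (T ^ 8)⁻¹ ≤ 4096 * (B * P) * (T ^ 8)⁻¹ := by
      gcongr; exact le_mul_of_one_le_left (by linarith) hB
    have h4 : 0 ≤ B * P * (T ^ 8)⁻¹ := by positivity
    rw [e1] at h1
    rw [e2] at h2
    linarith
  have hfin := sum_pow_four_le s fun p => ‖Φ (r * p * Real.goldenRatio)‖
  refine (pow_le_pow_iff_left₀ (Finset.sum_nonneg fun _ _ => norm_nonneg _) (by positivity)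
    four_ne_zero).1 (hfin.trans ?_)
  calc (s.card : ℝ) ^ 3 * ∑ p ∈ s, ‖Φ (r * p * Real.goldenRatio)‖ ^ 4
      ≤ P ^ 3 * (38416 * B * P * (T ^ 8)⁻¹) := by gcongr
    _ = 38416 * B * (P ^ 4 * (T ^ 8)⁻¹) := by ring
    _ ≤ 38416 * B ^ 4 * (P ^ 4 * (T ^ 8)⁻¹) := by gcongr; exact le_self_pow₀ hB (by norm_num)
    _ = _ := by field_simp; norm_num

/-- The main integrals are small on average over `p`. -/
theorem exists_sum_norm_corrIntegral_le : ∃ D : ℝ, 0 < D ∧ ∀ (ϑ B P T : ℝ) (lam r q : ℕ)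
    (s : Finset ℕ), 1 ≤ B → 1 ≤ T → T ^ 16 ≤ P → (∀ p ∈ s, 1 ≤ p ∧ (p : ℝ) ≤ P) →
    (s.card : ℝ) ≤ P → 1 ≤ q → (q : ℝ) ≤ P → 1 ≤ r → (r : ℝ) < T ^ 2 →
    (Nat.fib (lam + 1) : ℝ) ≤ 4 * (P * T ^ 4) →
    ∫ t in (0 : ℝ)..1, ‖autoCorr (torusExp ϑ lam) t‖ ^ 4 ≤ B * (T ^ 14)⁻¹ →
    ∑ p ∈ s, ‖corrIntegral ϑ lam p q r‖ ≤ D * B * (P / T ^ 2) := by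
  obtain ⟨C, hC, hmass⟩ := exists_sum_multMass_le
  refine ⟨14 + √(2 * C), by positivity, ?_⟩
  intro ϑ B P T lam r q s hB hT hTP hs hcard hq hqP hr hrT hlam2 hG
  have hT0 : 0 < T := by linarith
  have hP : 1 ≤ P := (one_le_pow₀ hT).trans hTP
  have hP0 : 0 < P := by linarith
  have hK1 : 1 ≤ Nat.fib (lam + 1) := Nat.fib_pos.2 (by omega)
  set v : ℝ → ℂ := fun x => torusDiff ϑ lam (r * q * Real.goldenRatio) (q * x) with hv
  have hvs : IsStep (q * (2 * Nat.fib (lam + 1))) v := (isStep_torusDiff ϑ lam _).dilate hq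
  have h1 : ∀ p ∈ s, ‖corrIntegral ϑ lam p q r‖ ≤
      ‖autoCorr (torusExp ϑ lam) (r * p * Real.goldenRatio)‖ + √(multMass v p) := fun p hp =>
    norm_integral_dilate_mul_conj_le (isStep_torusDiff ϑ lam _) (hs p hp).1 hvs.measurable
      hvs.norm_le
  refine (Finset.sum_le_sum h1).trans ?_
  rw [Finset.sum_add_distrib]
  have h2 := sum_norm_autoCorr_le hB hT hP hs hcard hr hrT hlam2 hG
  have h3 := hmass _ v hvs (Nat.one_le_iff_ne_zero.2 (by positivity)) s
  -- The bound for the jumps of v is 8P²T⁴. By T¹⁶ ≤ P its fourth root is at most 2P/T⁴, so the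
  -- total mass is O(P/T⁴), and Cauchy–Schwarz over p turns this into a saving of T².
  have hKle : ((q * (2 * Nat.fib (lam + 1)) : ℕ) : ℝ) ≤ (2 * P / T ^ 4) ^ 4 := by
    push_cast
    have e : (2 * P / T ^ 4) ^ 4 = 16 * P ^ 4 / T ^ 16 := by field_simp; norm_num
    rw [e, le_div_iff₀ (by positivity)]
    calc (q : ℝ) * (2 * Nat.fib (lam + 1)) * T ^ 16 ≤ P * (2 * (4 * (P * T ^ 4))) * T ^ 16 := by
          gcongr
      _ = 8 * P ^ 2 * T ^ 20 := by ring
      _ ≤ 8 * P ^ 2 * T ^ 32 := by gcongr; norm_num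
      _ = 8 * P ^ 2 * (T ^ 16) ^ 2 := by ring
      _ ≤ 8 * P ^ 2 * P ^ 2 := by gcongr
      _ ≤ 16 * P ^ 4 := by nlinarith [pow_pos hP0 4]
  have hKle' : ((q * (2 * Nat.fib (lam + 1)) : ℕ) : ℝ) ^ (1 / 4 : ℝ) ≤ 2 * P / T ^ 4 := by
    calc _ ≤ ((2 * P / T ^ 4) ^ 4) ^ (1 / 4 : ℝ) := by gcongr
      _ = 2 * P / T ^ 4 := by
        rw [← Real.rpow_natCast, ← Real.rpow_mul (by positivity)]; norm_num
  have hm0 : ∀ p, 0 ≤ multMass v p := fun p => tsum_nonneg fun n => by split_ifs <;> positivity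
  have h4 : ∑ p ∈ s, √(multMass v p) ≤ √(2 * C) * (P / T ^ 2) := by
    have hcs := sq_sum_le_card_mul_sum_sq (s := s) (f := fun p => √(multMass v p))
    simp only [Real.sq_sqrt (hm0 _)] at hcs
    refine (sq_le_sq₀ (Finset.sum_nonneg fun _ _ => Real.sqrt_nonneg _) (by positivity)).1 ?_
    rw [mul_pow, Real.sq_sqrt (by positivity)]
    calc _ ≤ (s.card : ℝ) * ∑ p ∈ s, multMass v p := hcs
      _ ≤ P * (C * (2 * P / T ^ 4)) := by
        gcongr
        · exact Finset.sum_nonneg fun p _ => hm0 p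
        · exact h3.trans (by gcongr)
      _ = _ := by field_simp
  calc _ ≤ 14 * B * (P / T ^ 2) + √(2 * C) * (P / T ^ 2) := add_le_add h2 h4
    _ ≤ 14 * B * (P / T ^ 2) + √(2 * C) * B * (P / T ^ 2) := by
      gcongr; exact le_mul_of_one_le_right (Real.sqrt_nonneg _) hB
    _ = _ := by ring

/-- The correlation sum for one pair `(p, r)`. -/
theorem norm_corr_sum_le {ϑ P T M : ℝ} {lam r q p a b k : ℕ} (hT : 1 ≤ T)
    (hP : 1 ≤ P) (hM : P ^ 2 * T ^ 8 ≤ M) (hp : 1 ≤ p) (hpP : (p : ℝ) ≤ P) (hq : 1 ≤ q)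
    (hqP : (q : ℝ) ≤ P) (hrT : (r : ℝ) < T ^ 2) (hlam : 1 ≤ lam)
    (hlam1 : P * T ^ 4 ≤ Nat.fib lam) (hlam2 : (Nat.fib (lam + 1) : ℝ) ≤ 4 * (P * T ^ 4))
    (hk1 : 1 ≤ k) (hk : b - a < 2 ^ k) (hL : ((b - a : ℕ) : ℝ) ≤ 2 * M) :
    ‖∑ m ∈ Finset.Ioc a (b - r),
        (zeckExp ϑ ((m + r) * p) * (starRingEnd ℂ) (zeckExp ϑ ((m + r) * q))) *
        (starRingEnd ℂ) (zeckExp ϑ (m * p) * (starRingEnd ℂ) (zeckExp ϑ (m * q)))‖ ≤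
      2 * M * ‖corrIntegral ϑ lam p q r‖ + 112 * (M * k / T ^ 2) := by
  have hT0 : 0 < T := by linarith
  have hP0 : 0 < P := by linarith
  have hM0 : 0 < M := lt_of_lt_of_le (by positivity) hM
  have hk' : (1 : ℝ) ≤ k := by exact_mod_cast hk1
  rcases le_or_gt a (b - r) with hab | hab
  · have h := norm_shifted_sum_le (ϑ := ϑ) (r := r) hlam hab
      (lt_of_le_of_lt (by omega : b - r - a ≤ b - a) hk) hp hq
    have hL' : ((b - r - a : ℕ) : ℝ) ≤ 2 * M :=
      le_trans (by exact_mod_cast (by omega : b - r - a ≤ b - a)) hL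
    refine h.trans ?_
    have hfl : (0 : ℝ) < Nat.fib lam := lt_of_lt_of_le (by positivity) hlam1
    have hterm : ∀ p : ℕ, (p : ℝ) ≤ P → (r : ℝ) * p * (((b - r - a : ℕ) : ℝ) / Nat.fib lam +
        8 * p * k) ≤ 2 * (M / T ^ 2) + 8 * (P ^ 2 * T ^ 2) * k := by
      intro p hpP
      calc (r : ℝ) * p * (((b - r - a : ℕ) : ℝ) / Nat.fib lam + 8 * p * k)
          ≤ T ^ 2 * P * (2 * M / (P * T ^ 4) + 8 * P * k) := by gcongr
        _ = _ := by field_simp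
    have h1 : 8 * ((p : ℝ) + q) * Nat.fib (lam + 1) * k ≤ 8 * (P + P) * (4 * (P * T ^ 4)) * k := by
      gcongr
    -- P²T⁸ ≤ M absorbs the discrepancy errors into Mk/T². The constants add up to 64 + 8 + 32 ≤
    -- 112.
    have h2 : P ^ 2 * T ^ 4 ≤ M / T ^ 2 := by
      rw [le_div_iff₀ (by positivity)]
      refine le_trans ?_ hM
      rw [mul_assoc, ← pow_add]
      gcongr
      norm_num
    have h3 : P ^ 2 * T ^ 2 ≤ M / T ^ 2 := by
      refine le_trans ?_ h2
      gcongr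
      norm_num
    have h4 : (P ^ 2 * T ^ 4) * k ≤ M / T ^ 2 * k := by gcongr
    have h5 : (P ^ 2 * T ^ 2) * k ≤ M / T ^ 2 * k := by gcongr
    have h6 : M / T ^ 2 ≤ M / T ^ 2 * k := le_mul_of_one_le_right (by positivity) hk'
    have h7 : ((b - r - a : ℕ) : ℝ) * ‖corrIntegral ϑ lam p q r‖ ≤
        2 * M * ‖corrIntegral ϑ lam p q r‖ := by gcongr
    have h8 : 0 ≤ M / T ^ 2 * k := by positivity
    have e : M * k / T ^ 2 = M / T ^ 2 * k := by ring
    rw [e]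
    have := hterm p hpP
    have := hterm q hqP
    linarith
  · rw [Finset.Ioc_eq_empty (by omega), Finset.sum_empty, norm_zero]
    positivity

/-- The core estimate for the bilinear sum. -/
theorem exists_bilinear_sum_le : ∃ D : ℝ, 0 < D ∧ ∀ (ϑ B P T M : ℝ) (q a k : ℕ) (b : ℕ → ℕ)
    (s : Finset ℕ), 1 ≤ B → 1 ≤ T → T ^ 16 ≤ P → P ^ 2 * T ^ 8 ≤ M →
    (∀ lam : ℕ, 2 ≤ lam → P ≤ Nat.fib lam →
      ∫ t in (0 : ℝ)..1, ‖autoCorr (torusExp ϑ lam) t‖ ^ 4 ≤ B * (T ^ 14)⁻¹) →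
    (∀ p ∈ s, 1 ≤ p ∧ (p : ℝ) ≤ P) → (s.card : ℝ) ≤ P → 1 ≤ q → (q : ℝ) ≤ P → 1 ≤ k →
    (∀ p ∈ s, a ≤ b p ∧ b p - a < 2 ^ k ∧ ((b p - a : ℕ) : ℝ) ≤ 2 * M) →
    ∑ p ∈ s, ‖∑ m ∈ Finset.Ioc a (b p), zeckExp ϑ (m * p) * (starRingEnd ℂ) (zeckExp ϑ (m * q))‖ ≤
      D * B * (P * M) * k / T := by
  obtain ⟨D, hD, hcorr⟩ := exists_sum_norm_corrIntegral_le
  refine ⟨16 * (D + 60), by positivity, ?_⟩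
  intro ϑ B P T M q a k b s hB hT hTP hM hG hs hcard hq hqP hk1 hb
  have hT0 : 0 < T := by linarith
  have hP : 1 ≤ P := (one_le_pow₀ hT).trans hTP
  have hP0 : 0 < P := by linarith
  have hM0 : 0 < M := lt_of_lt_of_le (by positivity) hM
  have hk' : (1 : ℝ) ≤ k := by exact_mod_cast hk1
  have hX : 1 ≤ P * T ^ 4 := one_le_mul_of_one_le_of_one_le hP (one_le_pow₀ hT)
  -- F_λ of order PT⁴ is large enough that carries, of proportion rp/F_λ, have density O(T^{-2}),
  -- and small enough that the discrepancy O(P F_λ k) stays below Mk/T².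
  obtain ⟨lam, hlam, hlam1, hlam1'⟩ := exists_fib_between hX
  have hlam2 : (Nat.fib (lam + 1) : ℝ) ≤ 4 * (P * T ^ 4) := by
    have := fib_succ_le_two_mul (lam := lam) (by omega)
    linarith
  have hG' := hG lam hlam (le_trans (le_mul_of_one_le_right hP0.le (one_le_pow₀ hT)) hlam1)
  -- With about T² shifts, the diagonal term of van der Corput saves T², as the correlations do;
  -- taking the square root leaves T.
  set R := ⌈T ^ 2⌉₊ with hR
  have hT2 : 1 ≤ T ^ 2 := one_le_pow₀ hT
  have hR1 : T ^ 2 ≤ R := Nat.le_ceil _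
  have hR2 : (R : ℝ) ≤ 2 * T ^ 2 := by
    have := (Nat.ceil_lt_add_one (by positivity : 0 ≤ T ^ 2)).le
    linarith
  have hR0 : 0 < R := Nat.ceil_pos.2 (by positivity)
  have hrT : ∀ r ∈ Finset.Ico 1 R, (r : ℝ) < T ^ 2 := fun r hr =>
    Nat.lt_ceil.1 (Finset.mem_Ico.1 hr).2
  have hRM : (R : ℝ) ≤ 2 * M := by
    refine hR2.trans (mul_le_mul_of_nonneg_left (le_trans ?_ hM) (by norm_num))
    calc T ^ 2 ≤ T ^ 8 := pow_le_pow_right₀ hT (by norm_num)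
      _ ≤ P ^ 2 * T ^ 8 := le_mul_of_one_le_left (by positivity) (one_le_pow₀ hP)
  set A : ℕ → ℂ := fun p =>
    ∑ m ∈ Finset.Ioc a (b p), zeckExp ϑ (m * p) * (starRingEnd ℂ) (zeckExp ϑ (m * q)) with hA
  have hAp : ∀ p ∈ s, ‖A p‖ ^ 2 ≤ 4 * M / T ^ 2 * (2 * M + 2 * ∑ r ∈ Finset.Ico 1 R,
      (2 * M * ‖corrIntegral ϑ lam p q r‖ + 112 * (M * k / T ^ 2))) := by
    intro p hp
    obtain ⟨hab, hbk, hL⟩ := hb p hp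
    have hv := van_der_corput
      (fun m => zeckExp ϑ (m * p) * (starRingEnd ℂ) (zeckExp ϑ (m * q)))
      (fun m => by simp [norm_zeckExp]) hab hR0
    refine hv.trans ?_
    have h1 : (((b p - a : ℕ) : ℝ) + R) / R ≤ 4 * M / T ^ 2 := by
      calc (((b p - a : ℕ) : ℝ) + R) / R ≤ (2 * M + 2 * M) / T ^ 2 := by gcongr
        _ = _ := by ring
    refine mul_le_mul h1 ?_ (by positivity) (by positivity)
    gcongr with r hr
    exact norm_corr_sum_le hT hP hM (hs p hp).1 (hs p hp).2 hq hqP (hrT r hr) (by omega) hlam1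
      hlam2 hk1 hbk hL
  have hr : ∀ r ∈ Finset.Ico 1 R, ∑ p ∈ s, (2 * M * ‖corrIntegral ϑ lam p q r‖ +
      112 * (M * k / T ^ 2)) ≤ (2 * D + 112) * B * k * (M * P / T ^ 2) := by
    intro r hr
    have h1 := hcorr ϑ B P T lam r q s hB hT hTP hs hcard hq hqP (Finset.mem_Ico.1 hr).1 (hrT r hr)
      hlam2 hG'
    rw [Finset.sum_add_distrib, ← Finset.mul_sum, Finset.sum_const, nsmul_eq_mul]
    have hBk : 1 ≤ B * k := one_le_mul_of_one_le_of_one_le hB hk'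
    calc 2 * M * ∑ p ∈ s, ‖corrIntegral ϑ lam p q r‖ + s.card * (112 * (M * k / T ^ 2))
        ≤ 2 * M * (D * B * (P / T ^ 2)) + P * (112 * (M * k / T ^ 2)) := by gcongr
      _ = 2 * D * B * (M * P / T ^ 2) * 1 + 112 * k * (M * P / T ^ 2) * 1 := by ring
      _ ≤ 2 * D * B * (M * P / T ^ 2) * k + 112 * k * (M * P / T ^ 2) * B := by gcongr
      _ = _ := by ring
  have hsq : ∑ p ∈ s, ‖A p‖ ^ 2 ≤ 16 * (D + 60) * B * k * (M ^ 2 * P / T ^ 2) * 2 := by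
    refine (Finset.sum_le_sum hAp).trans ?_
    rw [← Finset.mul_sum, Finset.sum_add_distrib, Finset.sum_const, nsmul_eq_mul, ← Finset.mul_sum,
      Finset.sum_comm]
    have h1 : ∑ r ∈ Finset.Ico 1 R, ∑ p ∈ s, (2 * M * ‖corrIntegral ϑ lam p q r‖ +
        112 * (M * k / T ^ 2)) ≤ 2 * T ^ 2 * ((2 * D + 112) * B * k * (M * P / T ^ 2)) := by
      refine (Finset.sum_le_card_nsmul _ _ _ hr).trans ?_
      rw [nsmul_eq_mul, Nat.card_Ico]
      gcongr
      exact le_trans (Nat.cast_le.2 (Nat.sub_le _ _)) hR2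
    have hBk : 1 ≤ B * k := one_le_mul_of_one_le_of_one_le hB hk'
    have hMP : M * P ≤ B * k * (M * P) := le_mul_of_one_le_left (by positivity) hBk
    have e : 2 * T ^ 2 * ((2 * D + 112) * B * k * (M * P / T ^ 2)) =
        2 * ((2 * D + 112) * B * k * (M * P)) := by field_simp
    rw [e] at h1
    calc 4 * M / T ^ 2 * (s.card * (2 * M) + 2 * _)
        ≤ 4 * M / T ^ 2 * (P * (2 * M) + 2 * (2 * ((2 * D + 112) * B * k * (M * P)))) := by gcongr
      _ ≤ 4 * M / T ^ 2 * (8 * (D + 60) * (B * k * (M * P))) := by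
        gcongr
        nlinarith
      _ = _ := by ring
  have hcs := sq_sum_le_card_mul_sum_sq (s := s) (f := fun p => ‖A p‖)
  refine (sq_le_sq₀ (Finset.sum_nonneg fun _ _ => norm_nonneg _) (by positivity)).1 (hcs.trans ?_)
  set E := 16 * (D + 60) with hE
  have hE1 : 2 ≤ E := by rw [hE]; linarith
  have hBk : 1 ≤ B * k := one_le_mul_of_one_le_of_one_le hB hk'
  calc (s.card : ℝ) * ∑ p ∈ s, ‖A p‖ ^ 2 ≤ P * (E * B * k * (M ^ 2 * P / T ^ 2) * 2) := by gcongr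
    _ = E * 2 * (B * k) * 1 * (P * M / T) ^ 2 := by field_simp
    _ ≤ E * E * (B * k) * (B * k) * (P * M / T) ^ 2 := by gcongr
    _ = _ := by ring

/-! ### The type II sum and the choice of parameters. -/

/-- The Gowers norm hypothesis bounds the fourth moment of the autocorrelation. -/
theorem exists_integral_autoCorr_pow_four_le {c C₀ : ℝ}
    (h : ∀ (ϑ : ℝ) (lam : ℕ), 2 ≤ lam → gowersNorm 3 (fun x : ℝ => e (ϑ * (torusSum lam x : ℝ))) ≤
      C₀ * (Nat.fib lam : ℝ) ^ (-(c * distInt ϑ ^ 2))) :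
    ∃ B : ℝ, 1 ≤ B ∧ ∀ (ϑ : ℝ) (lam : ℕ), 2 ≤ lam →
      ∫ t in (0 : ℝ)..1, ‖autoCorr (torusExp ϑ lam) t‖ ^ 4 ≤
        B * (Nat.fib lam : ℝ) ^ (-(8 * (c * distInt ϑ ^ 2))) := by
  refine ⟨max 1 (C₀ ^ 8), le_max_left _ _, fun ϑ lam hlam => ?_⟩
  have hF := isStep_torusExp ϑ lam
  refine (integral_autoCorr_pow_four_le hF.measurable hF.norm_le hF.periodic).trans ?_
  have hf : (0 : ℝ) ≤ Nat.fib lam := Nat.cast_nonneg _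
  have h8 : ‖gowersIntegral 3 (torusExp ϑ lam)‖ = gowersNorm 3 (torusExp ϑ lam) ^ 8 := by
    rw [gowersNorm, ← Real.rpow_natCast, ← Real.rpow_mul (norm_nonneg _)]
    norm_num
  have h0 : 0 ≤ gowersNorm 3 (torusExp ϑ lam) := Real.rpow_nonneg (norm_nonneg _) _
  rw [h8]
  calc gowersNorm 3 (torusExp ϑ lam) ^ 8
      ≤ (C₀ * (Nat.fib lam : ℝ) ^ (-(c * distInt ϑ ^ 2))) ^ 8 :=
        pow_le_pow_left₀ h0 (h ϑ lam hlam) 8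
    _ = C₀ ^ 8 * (Nat.fib lam : ℝ) ^ (-(8 * (c * distInt ϑ ^ 2))) := by
      rw [mul_pow, ← Real.rpow_natCast ((Nat.fib lam : ℝ) ^ _), ← Real.rpow_mul hf]
      congr 2
      push_cast
      ring
    _ ≤ _ := by
      gcongr
      exact le_max_right _ _

/-- The summation range in the type II sum, as an interval. -/
theorem filter_Ioc_le_eq {a b : ℕ} {w : ℝ} (hw : 0 ≤ w) :
    (Finset.Ioc a b).filter (fun m : ℕ => (m : ℝ) ≤ w) =
      Finset.Ioc a (max a (min b ⌊w⌋₊)) := by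
  ext m
  simp only [Finset.mem_filter, Finset.mem_Ioc, ← Nat.le_floor_iff hw]
  omega

theorem natLog_add_one_le_logPlus {n : ℕ} {N : ℝ} (hN : 1 ≤ N) (hn : (n : ℝ) ≤ N) :
    ((Nat.log 2 n + 1 : ℕ) : ℝ) ≤ 3 * logPlus N := by
  have h2 : 0.6931471803 < Real.log 2 := Real.log_two_gt_d9
  have h1 : (Nat.log 2 n : ℝ) * Real.log 2 ≤ Real.log N := by
    rcases Nat.eq_zero_or_pos n with rfl | hpos
    · simpa using Real.log_nonneg hN
    · rw [← Real.log_pow]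
      refine Real.log_le_log (by positivity) (le_trans ?_ hn)
      exact_mod_cast Nat.pow_log_le_self 2 hpos.ne'
  have h3 : Real.log N ≤ logPlus N := le_max_right _ _
  have h4 : 1 ≤ logPlus N := le_max_left _ _
  have h5 : (0 : ℝ) ≤ Nat.log 2 n := Nat.cast_nonneg _
  push_cast
  nlinarith

theorem floor_two_mul_sub_floor_le {M : ℝ} (hM : 1 ≤ M) :
    ((⌊2 * M⌋₊ - ⌊M⌋₊ : ℕ) : ℝ) ≤ 2 * M := by
  have h : ⌊M⌋₊ ≤ ⌊2 * M⌋₊ := Nat.floor_mono (by linarith)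
  rw [Nat.cast_sub h]
  linarith [Nat.floor_le (by linarith : 0 ≤ 2 * M), Nat.lt_floor_add_one M]

/-- The parameter choice: with `τ = P^{-κ} + P^{1/2+κ} M^{-1/4} ≤ 1`, the value `T = 1/τ` is
admissible in the bilinear estimate. -/
theorem parameter_bounds {P M κ τ : ℝ} (hP : 1 ≤ P) (hM : 1 ≤ M) (hκ' : κ ≤ 1 / 432)
    (hτ : τ = (P ^ κ)⁻¹ + P ^ (1 / 2 + κ) / M ^ (1 / 4 : ℝ)) (hτ1 : τ ≤ 1) :
    1 ≤ τ⁻¹ ∧ τ⁻¹ ^ 16 ≤ P ∧ P ^ 2 * τ⁻¹ ^ 8 ≤ M ∧ τ⁻¹ ≤ P ^ κ := by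
  have hP0 : 0 < P := by linarith
  have hM0 : 0 < M := by linarith
  set x := P ^ κ with hx
  set y := P ^ (1 / 2 : ℝ) with hy
  set z := M ^ (1 / 4 : ℝ) with hz
  have hx0 : 0 < x := Real.rpow_pos_of_pos hP0 _
  have hy0 : 0 < y := Real.rpow_pos_of_pos hP0 _
  have hz0 : 0 < z := Real.rpow_pos_of_pos hM0 _
  have hy2 : y ^ 2 = P := by rw [hy, ← Real.rpow_natCast, ← Real.rpow_mul hP0.le]; norm_num
  have hz4 : z ^ 4 = M := by rw [hz, ← Real.rpow_natCast, ← Real.rpow_mul hM0.le]; norm_num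
  rw [Real.rpow_add hP0] at hτ
  have hτ0 : 0 < τ := by rw [hτ]; positivity
  have hTx : τ⁻¹ ≤ x := by
    rw [inv_le_comm₀ hτ0 hx0, hτ]
    exact le_add_of_nonneg_right (by positivity)
  have hyz : y * x ≤ τ * z := by
    have : y * x / z ≤ τ := by
      rw [hτ]
      exact le_add_of_nonneg_left (by positivity)
    rwa [div_le_iff₀ hz0] at this
  -- With T = τ⁻¹, combine T ≤ x with yx ≤ τz; the fourth power of yT² ≤ z is P²T⁸ ≤ M.
  have hyT : y * τ⁻¹ ^ 2 ≤ z := by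
    calc y * τ⁻¹ ^ 2 ≤ y * (τ⁻¹ * x) := by rw [pow_two]; gcongr
      _ = y * x * τ⁻¹ := by ring
      _ ≤ τ * z * τ⁻¹ := by gcongr
      _ = z := by field_simp
  refine ⟨(one_le_inv₀ hτ0).2 hτ1, ?_, ?_, hTx⟩
  · calc τ⁻¹ ^ 16 ≤ x ^ 16 := by gcongr
      _ = P ^ (κ * (16 : ℕ)) := by rw [hx, ← Real.rpow_natCast, ← Real.rpow_mul hP0.le]
      _ ≤ P ^ (1 : ℝ) := Real.rpow_le_rpow_of_exponent_le hP (by push_cast; linarith)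
      _ = P := Real.rpow_one P
  · calc P ^ 2 * τ⁻¹ ^ 8 = (y * τ⁻¹ ^ 2) ^ 4 := by rw [← hy2]; ring
      _ ≤ z ^ 4 := by gcongr
      _ = M := hz4

/-- If τ ≤ 1, the bilinear estimate applies with T = 1/τ; if τ > 1, the trivial bound 2N is enough.
The passage to U uses P = N/M: the second term of τ equals N^{1/2+κ}/M^{3/4+κ}, which decreases in M
≥ U. -/
theorem exists_sum_norm_typeII_le : ∃ D : ℝ, 0 < D ∧ ∀ (ϑ B κ N U V M : ℝ) (q : ℕ), 1 ≤ B →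
    0 ≤ κ → κ ≤ 1 / 432 →
    (∀ lam : ℕ, 2 ≤ lam → ∫ t in (0 : ℝ)..1, ‖autoCorr (torusExp ϑ lam) t‖ ^ 4 ≤
      B * (Nat.fib lam : ℝ) ^ (-(432 * κ))) →
    2 ≤ N → 2 ≤ U → 2 ≤ V → U ≤ M → M ≤ N / V → V ≤ (q : ℝ) → (q : ℝ) ≤ N / M →
    ∑ p ∈ Finset.Ioc ⌊V⌋₊ ⌊N / M⌋₊,
      ‖∑ m ∈ (Finset.Ioc ⌊M⌋₊ ⌊2 * M⌋₊).filter (fun m : ℕ => (m : ℝ) ≤ min (N / p) (N / q)),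
        zeckExp ϑ (m * p) * (starRingEnd ℂ) (zeckExp ϑ (m * q))‖ ≤
      D * B * (N * logPlus N * (V ^ (-κ) + N ^ (1 / 2 + κ) / U ^ (3 / 4 + κ))) := by
  obtain ⟨D, hD, hcore⟩ := exists_bilinear_sum_le
  refine ⟨3 * D + 2, by positivity, ?_⟩
  intro ϑ B κ N U V M q hB hκ hκ' hG hN hU hV hUM hMN hVq hqN
  have hU0 : 0 < U := by linarith
  have hV0 : 0 < V := by linarith
  have hM0 : 0 < M := by linarith
  have hN0 : 0 < N := by linarith
  set P := N / M with hP
  have hVP : V ≤ P := by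
    rw [hP, le_div_iff₀ hM0, mul_comm]
    exact (le_div_iff₀ hV0).1 hMN
  have hP1 : 1 ≤ P := by linarith
  have hP0 : 0 < P := by linarith
  have hPM : P * M = N := div_mul_cancel₀ N hM0.ne'
  have h2M : 2 * M ≤ N := by rw [← hPM]; gcongr; linarith
  have hL : 1 ≤ logPlus N := le_max_left _ _
  set τ := (P ^ κ)⁻¹ + P ^ (1 / 2 + κ) / M ^ (1 / 4 : ℝ) with hτ
  set τ' := V ^ (-κ) + N ^ (1 / 2 + κ) / U ^ (3 / 4 + κ) with hτ'
  have hτ0 : 0 < τ := by positivity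
  have hττ' : τ ≤ τ' := by
    rw [hτ, hτ', ← Real.rpow_neg hP0.le]
    refine add_le_add (Real.rpow_le_rpow_of_nonpos hV0 hVP (by linarith)) ?_
    calc P ^ (1 / 2 + κ) / M ^ (1 / 4 : ℝ) = N ^ (1 / 2 + κ) / M ^ (3 / 4 + κ) := by
          rw [hP, Real.div_rpow hN0.le hM0.le, div_div, ← Real.rpow_add hM0]
          congr 2
          ring
      _ ≤ N ^ (1 / 2 + κ) / U ^ (3 / 4 + κ) := by gcongr
  set s := Finset.Ioc ⌊V⌋₊ ⌊P⌋₊ with hs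
  have hsp : ∀ p ∈ s, 1 ≤ p ∧ (p : ℝ) ≤ P := fun p hp =>
    ⟨(Nat.zero_le _).trans_lt (Finset.mem_Ioc.1 hp).1,
      (Nat.le_floor_iff hP0.le).1 (Finset.mem_Ioc.1 hp).2⟩
  have hcard : (s.card : ℝ) ≤ P := by
    rw [hs, Nat.card_Ioc]
    exact le_trans (Nat.cast_le.2 (Nat.sub_le _ _)) (Nat.floor_le hP0.le)
  set a := ⌊M⌋₊ with ha
  have ha2 : a ≤ ⌊2 * M⌋₊ := Nat.floor_mono (by linarith)
  set b : ℕ → ℕ := fun p => max a (min ⌊2 * M⌋₊ ⌊min (N / p) (N / q)⌋₊) with hb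
  have hbL : ∀ p, ((b p - a : ℕ) : ℝ) ≤ 2 * M := by
    intro p
    refine le_trans (Nat.cast_le.2 ?_) (floor_two_mul_sub_floor_le (by linarith : 1 ≤ M))
    simp only [hb]
    omega
  have hfilter : ∀ p : ℕ, (Finset.Ioc a ⌊2 * M⌋₊).filter
      (fun m : ℕ => (m : ℝ) ≤ min (N / p) (N / q)) = Finset.Ioc a (b p) := fun p =>
    filter_Ioc_le_eq (by positivity)
  simp only [hfilter]
  have hNL : N ≤ N * logPlus N := le_mul_of_one_le_right hN0.le hL
  rcases le_or_gt τ 1 with hτ1 | hτ1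
  · obtain ⟨hT1, hT16, hT8, hTx⟩ :=
      parameter_bounds hP1 (by linarith : 1 ≤ M) hκ' hτ hτ1
    set k := Nat.log 2 ⌊2 * M⌋₊ + 1 with hk
    have hkL : (k : ℝ) ≤ 3 * logPlus N := natLog_add_one_le_logPlus (by linarith)
      ((Nat.floor_le (by positivity)).trans h2M)
    have h := hcore ϑ B P τ⁻¹ M q a k b s hB hT1 hT16 hT8 ?_ hsp hcard
      (by exact_mod_cast (by linarith : (1 : ℝ) ≤ q)) hqN (by omega)
      fun p _ => ⟨le_max_left _ _, ?_, hbL p⟩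
    · refine h.trans ?_
      rw [hPM, div_inv_eq_mul]
      calc D * B * N * k * τ ≤ D * B * N * (3 * logPlus N) * τ' := by gcongr
        _ = 3 * D * B * (N * logPlus N * τ') := by ring
        _ ≤ (3 * D + 2) * B * (N * logPlus N * τ') := by
          have : 0 ≤ τ' := hτ0.le.trans hττ'
          gcongr
          linarith
    · intro lam hlam hPf
      refine (hG lam hlam).trans ?_
      gcongr
      calc (Nat.fib lam : ℝ) ^ (-(432 * κ)) ≤ P ^ (-(432 * κ)) :=
            Real.rpow_le_rpow_of_nonpos hP0 hPf (by linarith)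
        _ = ((P ^ κ) ^ 432)⁻¹ := by
          rw [Real.rpow_neg hP0.le, ← Real.rpow_natCast (P ^ κ), ← Real.rpow_mul hP0.le, mul_comm]
          norm_num
        -- There is ample room: T ≤ P^κ, so the decay P^{-432κ} far exceeds the required T^{-14}.
        _ ≤ (τ⁻¹ ^ 14)⁻¹ := by
          gcongr
          calc τ⁻¹ ^ 14 ≤ (P ^ κ) ^ 14 := by gcongr
            _ ≤ (P ^ κ) ^ 432 := pow_le_pow_right₀ (hT1.trans hTx) (by norm_num)
    · refine lt_of_le_of_lt ?_ (Nat.lt_pow_succ_log_self one_lt_two ⌊2 * M⌋₊)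
      simp only [hb]
      omega
  · have htriv : ∀ p ∈ s, ‖∑ m ∈ Finset.Ioc a (b p),
        zeckExp ϑ (m * p) * (starRingEnd ℂ) (zeckExp ϑ (m * q))‖ ≤ 2 * M := by
      intro p _
      refine (norm_sum_le _ _).trans ?_
      simp only [norm_mul, RCLike.norm_conj, norm_zeckExp, mul_one, Finset.sum_const,
        Nat.card_Ioc, nsmul_eq_mul]
      exact hbL p
    calc _ ≤ s.card • (2 * M) := Finset.sum_le_card_nsmul _ _ _ htriv
      _ ≤ P * (2 * M) := by rw [nsmul_eq_mul]; gcongr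
      _ = 2 * 1 * (N * 1) := by rw [← hPM]; ring
      _ ≤ (3 * D + 2) * B * (N * logPlus N * τ') := by
        have h1 : N * 1 ≤ N * logPlus N * τ' :=
          mul_le_mul hNL (hτ1.le.trans hττ') zero_le_one (by positivity)
        have h2 : 2 * 1 ≤ (3 * D + 2) * B :=
          mul_le_mul (by linarith) hB zero_le_one (by positivity)
        exact mul_le_mul h2 h1 (by positivity) (by positivity)

/-- The type II estimate from a bound for the fourth moments of the autocorrelations. -/
theorem exists_typeIISum_le : ∃ D : ℝ, 0 < D ∧ ∀ B c : ℝ, 1 ≤ B → 0 ≤ c →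
    (∀ (ϑ : ℝ) (lam : ℕ), 2 ≤ lam → ∫ t in (0 : ℝ)..1, ‖autoCorr (torusExp ϑ lam) t‖ ^ 4 ≤
      B * (Nat.fib lam : ℝ) ^ (-(8 * (c * distInt ϑ ^ 2)))) →
    ∀ N U V ϑ : ℝ, 2 ≤ N → 2 ≤ U → 2 ≤ V →
      typeIISum (fun n : ℕ => e (ϑ * (zeckSum n : ℝ))) N U V ≤
        √(D * B) * (N * logPlus N ^ 5 * √(V ^ (-(c * distInt ϑ ^ 2 / 54)) +
          N ^ (1 / 2 + c * distInt ϑ ^ 2 / 54) / U ^ (3 / 4 + c * distInt ϑ ^ 2 / 54))) := by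
  obtain ⟨D, hD, hsum⟩ := exists_sum_norm_typeII_le
  refine ⟨D, hD, ?_⟩
  intro B c hB hc hG N U V ϑ hN hU hV
  set d := c * distInt ϑ ^ 2 with hd
  have hd0 : 0 ≤ d := by positivity
  have hd8 : 8 * d ≤ 1 := exponent_le_of_autoCorr_bound (hG ϑ)
  have hN0 : 0 < N := by linarith
  have hU0 : 0 < U := by linarith
  have hV0 : 0 < V := by linarith
  have hL : 1 ≤ logPlus N := le_max_left _ _
  have hL0 : 0 < logPlus N := by linarith
  set τ := V ^ (-(d / 54)) + N ^ (1 / 2 + d / 54) / U ^ (3 / 4 + d / 54) with hτ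
  have hτ0 : 0 ≤ τ := by positivity
  have hsup : sSup (typeIIValues (fun n : ℕ => e (ϑ * (zeckSum n : ℝ))) N U V) ≤
      √(D * B * (N * logPlus N * τ)) := by
    -- Nonnegativity of the bound covers the case of no admissible pair, where the supremum is 0.
    refine Real.sSup_le ?_ (Real.sqrt_nonneg _)
    rintro t ⟨M, q, hUM, hMN, hVq, hqN, rfl⟩
    refine Real.sqrt_le_sqrt ?_
    refine hsum ϑ B (d / 54) N U V M q hB (by positivity) (by linarith) ?_ hN hU hV hUM hMN hVq hqN
    intro lam hlam
    -- The 54 in the exponent is 432/8, with the 8 coming from the eighth power of the U³ norm.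
    rw [show 432 * (d / 54) = 8 * d by ring]
    exact hG ϑ lam hlam
  have hlog0 : 0 ≤ Real.log N := Real.log_nonneg (by linarith)
  have hlog : Real.log N ≤ logPlus N := le_max_right _ _
  have hsqrt : √(D * B * (N * logPlus N * τ)) ≤ √(D * B) * (√N * logPlus N * √τ) := by
    rw [Real.sqrt_mul (by positivity : 0 ≤ D * B), Real.sqrt_mul (by positivity : 0 ≤ N * _),
      Real.sqrt_mul hN0.le]
    gcongr
    exact Real.sqrt_le_iff.2 ⟨hL0.le, (le_self_pow₀ hL two_ne_zero)⟩
  calc √N * Real.log N ^ 3 * sSup (typeIIValues (fun n : ℕ => e (ϑ * (zeckSum n : ℝ))) N U V)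
      ≤ √N * logPlus N ^ 3 * (√(D * B) * (√N * logPlus N * √τ)) := by
        refine mul_le_mul ?_ (hsup.trans hsqrt) (Real.sSup_nonneg ?_) (by positivity)
        · gcongr
        · rintro t ⟨M, q, -, -, -, -, rfl⟩
          exact Real.sqrt_nonneg _
    _ = √(D * B) * (√N * √N * logPlus N ^ 4 * √τ) := by ring
    _ = √(D * B) * (N * logPlus N ^ 4 * √τ) := by rw [Real.mul_self_sqrt hN0.le]
    _ ≤ _ := by
      gcongr
      norm_num

/-! ### Large U and V, and the theorem. -/

theorem distInt_sq_le (x : ℝ) : distInt x ^ 2 ≤ 1 / 4 := by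
  have h := abs_sub_round x
  have h0 : 0 ≤ distInt x := abs_nonneg _
  rw [distInt] at h0 ⊢
  nlinarith

/-- The bracket in the type II estimate, when `V` and `U` are large. -/
theorem bracket_le {a ε κ N U V : ℝ} (ha : 0 < a) (hε : 0 < ε) (hκ : 0 ≤ κ) (hκ1 : κ ≤ 1)
    (hκε : κ ≤ ε) (hN : 1 ≤ N) (hV : a * N ^ ε ≤ V) (hU : a * N ^ (2 / 3 + ε) ≤ U) :
    V ^ (-κ) + N ^ (1 / 2 + κ) / U ^ (3 / 4 + κ) ≤ 2 * (1 + a⁻¹) ^ 2 * N ^ (-(ε * κ)) := by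
  have hN0 : 0 < N := by linarith
  have hA : 1 ≤ 1 + a⁻¹ := le_add_of_nonneg_right (by positivity)
  have hinv : ∀ σ : ℝ, 0 ≤ σ → σ ≤ 2 → a ^ (-σ) ≤ (1 + a⁻¹) ^ 2 := by
    intro σ h0 h2
    calc a ^ (-σ) = a⁻¹ ^ σ := by rw [Real.rpow_neg ha.le, Real.inv_rpow ha.le]
      _ ≤ (1 + a⁻¹) ^ σ := by gcongr; linarith
      _ ≤ (1 + a⁻¹) ^ (2 : ℝ) := Real.rpow_le_rpow_of_exponent_le hA h2
      _ = (1 + a⁻¹) ^ 2 := Real.rpow_two _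
  have h1 : V ^ (-κ) ≤ (1 + a⁻¹) ^ 2 * N ^ (-(ε * κ)) := by
    calc V ^ (-κ) ≤ (a * N ^ ε) ^ (-κ) :=
          Real.rpow_le_rpow_of_nonpos (by positivity) hV (by linarith)
      _ = a ^ (-κ) * N ^ (-(ε * κ)) := by
        rw [Real.mul_rpow ha.le (by positivity), ← Real.rpow_mul hN0.le, mul_neg]
      _ ≤ _ := by gcongr; exact hinv κ hκ (by linarith)
  have h2 : N ^ (1 / 2 + κ) / U ^ (3 / 4 + κ) ≤ (1 + a⁻¹) ^ 2 * N ^ (-(ε * κ)) := by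
    calc N ^ (1 / 2 + κ) / U ^ (3 / 4 + κ)
        ≤ N ^ (1 / 2 + κ) / (a * N ^ (2 / 3 + ε)) ^ (3 / 4 + κ) := by gcongr
      _ = a ^ (-(3 / 4 + κ)) * N ^ (1 / 2 + κ - (2 / 3 + ε) * (3 / 4 + κ)) := by
        rw [Real.mul_rpow ha.le (by positivity), ← Real.rpow_mul hN0.le, Real.rpow_sub hN0,
          Real.rpow_neg ha.le]
        field_simp
      _ ≤ (1 + a⁻¹) ^ 2 * N ^ (-(ε * κ)) := by
        gcongr
        · exact hinv _ (by linarith) (by linarith)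
        -- Since (2/3)(3/4) = 1/2, the exponent of N is κ/3 - 3ε/4 - εκ, and κ ≤ ε makes it at most
        -- -εκ.
        · nlinarith
  linarith

end ZeckTypeII

end

theorem mainTheorem6 (c₂ : ℝ) (hc₂ : 0 < c₂)
    (hGowers : ∃ C₀ : ℝ, ∀ (ϑ : ℝ) (lam : ℕ), 2 ≤ lam →
      ZeckTypeII.gowersNorm 3 (fun x : ℝ => ZeckTypeII.e (ϑ * (ZeckTypeII.torusSum lam x : ℝ))) ≤
        C₀ * (Nat.fib lam : ℝ) ^ (-(c₂ * ZeckTypeII.distInt ϑ ^ 2))) :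
    (∃ C : ℝ, ∀ (N U V ϑ : ℝ), 2 ≤ N → 2 ≤ U → 2 ≤ V → U * V ≤ N →
      ZeckTypeII.typeIISum (fun n : ℕ => ZeckTypeII.e (ϑ * (ZeckTypeII.zeckSum n : ℝ))) N U V ≤
        C * (N * ZeckTypeII.logPlus N ^ 5 *
          √(V ^ (-(c₂ * ZeckTypeII.distInt ϑ ^ 2 / 54)) +
            N ^ (1 / 2 + c₂ * ZeckTypeII.distInt ϑ ^ 2 / 54) /
              U ^ (3 / 4 + c₂ * ZeckTypeII.distInt ϑ ^ 2 / 54)))) ∧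
    (∀ ε : ℝ, 0 < ε → ∃ η : ℝ, 0 < η ∧ ∀ a : ℝ, 0 < a →
      ∃ C : ℝ, ∀ (N U V ϑ : ℝ), 2 ≤ N → 2 ≤ U → 2 ≤ V → U * V ≤ N →
        a * N ^ ε ≤ V → a * N ^ (2 / 3 + ε) ≤ U →
        ZeckTypeII.typeIISum (fun n : ℕ => ZeckTypeII.e (ϑ * (ZeckTypeII.zeckSum n : ℝ))) N U V ≤
          C * (N ^ (1 - η * ZeckTypeII.distInt ϑ ^ 2) * ZeckTypeII.logPlus N ^ 5)) := by
  obtain ⟨C₀, hC₀⟩ := hGowers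
  obtain ⟨B, hB, hG⟩ := ZeckTypeII.exists_integral_autoCorr_pow_four_le hC₀
  obtain ⟨D, hD, hmain⟩ := ZeckTypeII.exists_typeIISum_le
  refine ⟨⟨√(D * B), fun N U V ϑ hN hU hV _ => hmain B c₂ hB hc₂.le hG N U V ϑ hN hU hV⟩, ?_⟩
  intro ε hε
  -- Lowering c₂ only weakens the moment bound, because F_λ ≥ 1. The smaller c secures κ ≤ 1 and κ ≤
  -- ε for κ = c‖ϑ‖²/54.
  set c := min c₂ (min 1 ε) with hc
  have hc0 : 0 < c := by positivity
  have hcc : c ≤ c₂ := min_le_left _ _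
  have hc1 : c ≤ 1 := (min_le_right _ _).trans (min_le_left _ _)
  have hcε : c ≤ ε := (min_le_right _ _).trans (min_le_right _ _)
  have hG' : ∀ (ϑ : ℝ) (lam : ℕ), 2 ≤ lam →
      ∫ t in (0 : ℝ)..1, ‖ZeckTypeII.autoCorr (ZeckTypeII.torusExp ϑ lam) t‖ ^ 4 ≤
        B * (Nat.fib lam : ℝ) ^ (-(8 * (c * ZeckTypeII.distInt ϑ ^ 2))) := by
    intro ϑ lam hlam
    refine (hG ϑ lam hlam).trans ?_
    have hf : (1 : ℝ) ≤ Nat.fib lam := by exact_mod_cast Nat.fib_pos.2 (by omega)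
    gcongr
  -- The bracket saves N^{-εκ}; its square root halves the exponent, so 54 becomes 108. The factor 1
  -- + a⁻¹ enters only the implied constant.
  refine ⟨ε * c / 108, by positivity, fun a ha => ⟨√(D * B) * (√2 * (1 + a⁻¹)), ?_⟩⟩
  intro N U V ϑ hN hU hV _ hVa hUa
  refine (hmain B c hB hc0.le hG' N U V ϑ hN hU hV).trans ?_
  have hd := ZeckTypeII.distInt_sq_le ϑ
  have hd0 := sq_nonneg (ZeckTypeII.distInt ϑ)
  set d := ZeckTypeII.distInt ϑ ^ 2 with hdd
  have hcd : c * d ≤ c * 1 := by gcongr; linarith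
  have hcd0 : 0 ≤ c * d := by positivity
  have hN0 : 0 < N := by linarith
  have hb := ZeckTypeII.bracket_le ha hε (κ := c * d / 54) (by positivity) (by linarith)
    (by linarith) (by linarith) hVa hUa
  have hs : √(2 * (1 + a⁻¹) ^ 2 * N ^ (-(ε * (c * d / 54)))) =
      √2 * (1 + a⁻¹) * N ^ (-(ε * c / 108 * d)) := by
    rw [Real.sqrt_mul (by positivity), Real.sqrt_mul (by positivity),
      Real.sqrt_sq (by positivity), Real.sqrt_eq_rpow (N ^ _), ← Real.rpow_mul hN0.le]
    congr 2
    ring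
  have hL : 0 ≤ ZeckTypeII.logPlus N := zero_le_one.trans (le_max_left _ _)
  calc _ ≤ √(D * B) * (N * ZeckTypeII.logPlus N ^ 5 *
        (√2 * (1 + a⁻¹) * N ^ (-(ε * c / 108 * d)))) := by
        rw [← hs]
        gcongr
    _ = _ := by
        rw [sub_eq_add_neg, Real.rpow_add hN0, Real.rpow_one]
        ring
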